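/- Fix a positive integer $d$. The $d$-Simultaneous Conjugacy problem asks, given $n$ and two $d$-tuples $(a_1,\dots,a_d)$, $(b_1,\dots,b_d)$ of permutations in the symmetric group $S_n$, whether there is a $\tau\in S_n$ such that $b_j=\tau^{-1}a_j\tau$ for all $j=1,\dots,d$. For every fixed positive integer $d$ this problem can be decided in $o(n^2)$ time on a word RAM: there are a single program $P$, a constant $c$ and a function $T:\mathbb N\to\mathbb N$ with $T(n)=o(n^2)$ (all depending only on $d$) such that for every $n$, every word length $w\ge c(\lfloor\log_2 n\rfloor+1)$ (reading $\lfloor\log_2 0\rfloor$ as $0$) and all $d$-tuples $a,b$ of permutations in $S_n$, the program $P$, started with $n$ in a register and the tables of values of $a_1,\dots,a_d,b_1,\dots,b_d$ in consecutive memory cells (all else being $0$), halts after at most $T(n)$ steps with output $1$ if $a$ and $b$ are simultaneously conjugate and $0$ otherwise. Here a word RAM with word length $w$ is the usual random access machine with finitely many registers and an indirectly addressable memory whose cells hold $w$-bit integers, where each copy, load, store, arithmetic operation ($+$, truncated $-$, $\times$, $\lfloor\cdot/\cdot\rfloor$, $\bmod$; sums and products modulo $2^w$) and comparison is one step. -/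

import Mathlib

namespace SCP

/-- The `d`-tuples `a` and `b` of permutations in `S_n` are simultaneously conjugate: some `τ`
satisfies `b_j = τ⁻¹ a_j τ` for all `j`. -/
def SimConj {d n : ℕ} (a b : Fin d → Equiv.Perm (Fin n)) : Prop :=
  ∃ τ : Equiv.Perm (Fin n), ∀ j : Fin d, b j = τ⁻¹ * a j * τ

/-! A word RAM with unit-cost instructions and structured control flow. -/

/-- A configuration: registers and an addressable memory, both holding natural numbers. A program
mentions only finitely many registers, by name; memory is addressed indirectly. -/
structure State where
  reg : ℕ → ℕ
  mem : ℕ → ℕ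

/-- Arithmetic instructions. -/
inductive Op where
  | add | sub | mul | div | mod

/-- Arithmetic on words of `w` bits: sums and products wrap around modulo `2 ^ w`, subtraction is
truncated at `0`, and `x / 0 = 0`, `x mod 0 = x`. -/
def Op.eval (w : ℕ) : Op → ℕ → ℕ → ℕ
  | .add, x, y => (x + y) % 2 ^ w
  | .sub, x, y => x - y
  | .mul, x, y => (x * y) % 2 ^ w
  | .div, x, y => x / y
  | .mod, x, y => x % y

/-- Comparisons of two registers. -/
inductive Test where
  | eq (r s : ℕ)
  | ne (r s : ℕ)
  | lt (r s : ℕ)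
  | le (r s : ℕ)

/-- The truth of a comparison in a configuration. -/
def Test.Holds : Test → State → Prop
  | .eq r s, σ => σ.reg r = σ.reg s
  | .ne r s, σ => σ.reg r ≠ σ.reg s
  | .lt r s, σ => σ.reg r < σ.reg s
  | .le r s, σ => σ.reg r ≤ σ.reg s

/-- Programs of the machine. -/
inductive Prog where
  /-- do nothing -/
  | skip
  /-- `R_r := k` -/
  | const (r k : ℕ)
  /-- `R_r := R_s` -/
  | copy (r s : ℕ)
  /-- `R_r := R_s op R_t` -/
  | arith (o : Op) (r s t : ℕ)
  /-- `R_r := M[R_s]` -/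
  | load (r s : ℕ)
  /-- `M[R_r] := R_s` -/
  | store (r s : ℕ)
  /-- first `P`, then `Q` -/
  | seq (P Q : Prog)
  /-- `P` if the test holds, and `Q` otherwise -/
  | cond (c : Test) (P Q : Prog)
  /-- repeat `P` as long as the test holds -/
  | loop (c : Test) (P : Prog)

/-- Write `x` into register `r`. -/
def State.setReg (σ : State) (r x : ℕ) : State :=
  { σ with reg := Function.update σ.reg r x }

/-- Write `x` into memory cell `p`. -/
def State.setMem (σ : State) (p x : ℕ) : State :=
  { σ with mem := Function.update σ.mem p x }

/-- `Exec w P σ σ' t`: with word length `w`, the program `P` started in `σ` halts in `σ'` after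
exactly `t` steps. Every elementary instruction and every evaluation of a test is one step. -/
inductive Exec (w : ℕ) : Prog → State → State → ℕ → Prop where
  | skip (σ : State) : Exec w .skip σ σ 1
  | const (r k : ℕ) (σ : State) : Exec w (.const r k) σ (σ.setReg r (k % 2 ^ w)) 1
  | copy (r s : ℕ) (σ : State) : Exec w (.copy r s) σ (σ.setReg r (σ.reg s)) 1
  | arith (o : Op) (r s t : ℕ) (σ : State) :
      Exec w (.arith o r s t) σ (σ.setReg r (o.eval w (σ.reg s) (σ.reg t))) 1
  | load (r s : ℕ) (σ : State) : Exec w (.load r s) σ (σ.setReg r (σ.mem (σ.reg s))) 1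
  | store (r s : ℕ) (σ : State) : Exec w (.store r s) σ (σ.setMem (σ.reg r) (σ.reg s)) 1
  | seq {P Q : Prog} {σ σ₁ σ₂ : State} {t₁ t₂ : ℕ} :
      Exec w P σ σ₁ t₁ → Exec w Q σ₁ σ₂ t₂ → Exec w (.seq P Q) σ σ₂ (t₁ + t₂)
  | cond_true {c : Test} {P Q : Prog} {σ σ₁ : State} {t : ℕ} :
      c.Holds σ → Exec w P σ σ₁ t → Exec w (.cond c P Q) σ σ₁ (t + 1)
  | cond_false {c : Test} {P Q : Prog} {σ σ₁ : State} {t : ℕ} :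
      ¬ c.Holds σ → Exec w Q σ σ₁ t → Exec w (.cond c P Q) σ σ₁ (t + 1)
  | loop_true {c : Test} {P : Prog} {σ σ₁ σ₂ : State} {t₁ t₂ : ℕ} :
      c.Holds σ → Exec w P σ σ₁ t₁ → Exec w (.loop c P) σ₁ σ₂ t₂ →
      Exec w (.loop c P) σ σ₂ (t₁ + t₂ + 1)
  | loop_false {c : Test} {P : Prog} {σ : State} :
      ¬ c.Holds σ → Exec w (.loop c P) σ σ 1

/-- The input configuration of an instance: `n` is in register `0`, the image of `i` under `a_j` in
memory cell `j n + i` and its image under `b_j` in cell `d n + j n + i` (for `0 ≤ j < d` and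
`0 ≤ i < n`), and every other register and cell holds `0`. -/
def input {d n : ℕ} (a b : Fin d → Equiv.Perm (Fin n)) : State where
  reg := fun r => if r = 0 then n else 0
  mem := fun p =>
    if h : p < d * n then
      (a (Fin.divNat ⟨p, h⟩) (Fin.modNat ⟨p, h⟩) : ℕ)
    else if h : p - d * n < d * n then
      (b (Fin.divNat ⟨p - d * n, h⟩) (Fin.modNat ⟨p - d * n, h⟩) : ℕ)
    else 0

/-- With word length `w`, the program `P` started on the instance `(a, b)` halts after at most `T`
steps, with the answer `1` (yes) or `0` (no) in register `0`. -/
def DecidesWithin {d n : ℕ} (w : ℕ) (P : Prog) (T : ℕ) (a b : Fin d → Equiv.Perm (Fin n)) : Prop :=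
  ∃ (σ : State) (t : ℕ), Exec w P (input a b) σ t ∧ t ≤ T ∧
    (SimConj a b → σ.reg 0 = 1) ∧ (¬ SimConj a b → σ.reg 0 = 0)

end SCP

set_option linter.constructorNameAsVariable false

namespace SCP

section

/-! A small imperative language with named variables and arrays, and its compiler to the RAM. -/

/-! Let `a` act on the points below `n` and `b` on the points from `n` to `2n - 1`. This gives one
system `G` of `d` permutations of `N = 2n` points (`pairAct`). The tuples are simultaneously
conjugate exactly if every isomorphism type of component (orbit) covers as many points on the left
as on the right (`balanced_iff_simConj`). So it suffices to sort the components by type, comparing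
each new one with a representative of every type of the same size met so far.

An isomorphism between two components of size `m` is determined by the image of one point, but
trying all images costs order `m ^ 2`. Instead, two candidate sets of equal size are kept that every
isomorphism maps onto each other (`Cand`). A breadth-first search tries to extend `r ↦ s` for one
candidate from each side. If it succeeds, there is a homomorphism between components of equal size,
hence an isomorphism (`Sys.sameRel_of_hom`). If it fails, it yields two words that agree at `r` but
not at `s`. Isomorphisms preserve agreement, so if the numbers of agreeing candidates differ, the
components are not isomorphic (`Cand.le_of_sim`). If they are equal, both the agreeing and the
disagreeing class are non-empty on each side, and the smaller class becomes the new candidate set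
(`Cand.head`, `Cand.tail`). Since candidates halve, there are about `log m` searches, and the
evaluations of words form a geometric series dominated by `m` times the word length. A table of the
actions of about `√n` words covers all words of length `κ ~ log n / (2 log (d + 1))`, so a path in
the search tree is evaluated with at most `m / κ + 1` look-ups. A comparison thus costs `O(m *
weight κ m)` with `weight κ m = m / κ + log m + 1`.

A component of size `m` is compared only with representatives of size `m`, so its cost is `O(m *
B)`, where `B` bounds the total weight of pairwise non-isomorphic components. Summed over all
components this is `O(n * B)`. Finally `B = o(n)`: there are boundedly many types of any bounded
size (`card_le_of_not_sim`), large components have weight much below their size, and the sizes add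
up to at most `2n` (`mul_maxWeight_le`). The table costs only `O(n ^ (3/2))`.

The algorithm is written in a small language with a weakest-precondition calculus whose states carry
a clock; `Cmd.exec_comp` transfers correctness and time to the word RAM with a constant factor. -/

inductive Var where
  | n | N | S | i | x | y | j | r | s | p | tl | xx | yy | ok | cx | cj | cv | k | k1 | lo | z | z1
  | o | c | q | e | oA | oB | r0 | s0 | res | e1 | v | R | m | t | found

inductive Arr where
  | inp | tab | qu | phi | top | code | buf | C | vis | rep | rsz | cnt

/-- Values of the variables and arrays, and the elapsed time. -/
structure HS where
  (n N S i x y j r s p tl xx yy ok cx cj cv k k1 lo z z1 : ℕ)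
  (o c q e oA oB r0 s0 res e1 v R m t found : ℕ)
  (inp tab qu phi top code buf C vis rep rsz cnt : ℕ → ℕ)
  tm : ℕ

namespace HS

def get (σ : HS) : Var → ℕ
  | .n => σ.n | .N => σ.N | .S => σ.S | .i => σ.i | .x => σ.x | .y => σ.y | .j => σ.j | .r => σ.r
  | .s => σ.s | .p => σ.p | .tl => σ.tl | .xx => σ.xx | .yy => σ.yy | .ok => σ.ok | .cx => σ.cx
  | .cj => σ.cj | .cv => σ.cv | .k => σ.k | .k1 => σ.k1 | .lo => σ.lo | .z => σ.z | .z1 => σ.z1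
  | .o => σ.o | .c => σ.c | .q => σ.q | .e => σ.e | .oA => σ.oA | .oB => σ.oB | .r0 => σ.r0
  | .s0 => σ.s0 | .res => σ.res | .e1 => σ.e1 | .v => σ.v | .R => σ.R | .m => σ.m | .t => σ.t
  | .found => σ.found

def set (σ : HS) (a : ℕ) : Var → HS
  | .n => { σ with n := a } | .N => { σ with N := a } | .S => { σ with S := a }
  | .i => { σ with i := a } | .x => { σ with x := a } | .y => { σ with y := a }
  | .j => { σ with j := a } | .r => { σ with r := a } | .s => { σ with s := a }
  | .p => { σ with p := a } | .tl => { σ with tl := a } | .xx => { σ with xx := a }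
  | .yy => { σ with yy := a } | .ok => { σ with ok := a } | .cx => { σ with cx := a }
  | .cj => { σ with cj := a } | .cv => { σ with cv := a } | .k => { σ with k := a }
  | .k1 => { σ with k1 := a } | .lo => { σ with lo := a } | .z => { σ with z := a }
  | .z1 => { σ with z1 := a } | .o => { σ with o := a } | .c => { σ with c := a }
  | .q => { σ with q := a } | .e => { σ with e := a } | .oA => { σ with oA := a }
  | .oB => { σ with oB := a } | .r0 => { σ with r0 := a } | .s0 => { σ with s0 := a }
  | .res => { σ with res := a } | .e1 => { σ with e1 := a } | .v => { σ with v := a }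
  | .R => { σ with R := a } | .m => { σ with m := a } | .t => { σ with t := a }
  | .found => { σ with found := a }

def arr (σ : HS) : Arr → ℕ → ℕ
  | .inp => σ.inp | .tab => σ.tab | .qu => σ.qu | .phi => σ.phi | .top => σ.top | .code => σ.code
  | .buf => σ.buf | .C => σ.C | .vis => σ.vis | .rep => σ.rep | .rsz => σ.rsz | .cnt => σ.cnt

def upd (σ : HS) (i a : ℕ) : Arr → HS
  | .inp => { σ with inp := Function.update σ.inp i a }
  | .tab => { σ with tab := Function.update σ.tab i a }
  | .qu => { σ with qu := Function.update σ.qu i a }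
  | .phi => { σ with phi := Function.update σ.phi i a }
  | .top => { σ with top := Function.update σ.top i a }
  | .code => { σ with code := Function.update σ.code i a }
  | .buf => { σ with buf := Function.update σ.buf i a }
  | .C => { σ with C := Function.update σ.C i a }
  | .vis => { σ with vis := Function.update σ.vis i a }
  | .rep => { σ with rep := Function.update σ.rep i a }
  | .rsz => { σ with rsz := Function.update σ.rsz i a }
  | .cnt => { σ with cnt := Function.update σ.cnt i a }

def tick (σ : HS) : HS := { σ with tm := σ.tm + 1 }

theorem get_set_self (σ : HS) (a : ℕ) (x : Var) : (σ.set a x).get x = a := by cases x <;> rfl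

theorem get_set_ne (σ : HS) (a : ℕ) {x y : Var} (h : y ≠ x) : (σ.set a x).get y = σ.get y := by
  cases x <;> cases y <;> first | rfl | exact absurd rfl h

theorem arr_set (σ : HS) (a : ℕ) (x : Var) (A : Arr) : (σ.set a x).arr A = σ.arr A := by
  cases x <;> cases A <;> rfl

theorem tm_set (σ : HS) (a : ℕ) (x : Var) : (σ.set a x).tm = σ.tm := by cases x <;> rfl

theorem arr_upd_self (σ : HS) (i a : ℕ) (A : Arr) :
    (σ.upd i a A).arr A = Function.update (σ.arr A) i a := by cases A <;> rfl

theorem arr_upd_ne (σ : HS) (i a : ℕ) {A B : Arr} (h : B ≠ A) :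
    (σ.upd i a A).arr B = σ.arr B := by
  cases A <;> cases B <;> first | rfl | exact absurd rfl h

theorem get_upd (σ : HS) (i a : ℕ) (x : Var) (A : Arr) : (σ.upd i a A).get x = σ.get x := by
  cases A <;> cases x <;> rfl

theorem tm_upd (σ : HS) (i a : ℕ) (A : Arr) : (σ.upd i a A).tm = σ.tm := by cases A <;> rfl

theorem get_tick (σ : HS) (x : Var) : σ.tick.get x = σ.get x := by cases x <;> rfl

theorem arr_tick (σ : HS) (A : Arr) : σ.tick.arr A = σ.arr A := by cases A <;> rfl

theorem tm_tick (σ : HS) : σ.tick.tm = σ.tm + 1 := rfl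

end HS

inductive Exp where
  | lit (k : ℕ)
  | var (x : Var)
  | bin (o : Op) (a b : Exp)
  | idx (A : Arr) (a : Exp)

/-- The operations on unbounded natural numbers. -/
def Op.val : Op → ℕ → ℕ → ℕ
  | .add, x, y => x + y
  | .sub, x, y => x - y
  | .mul, x, y => x * y
  | .div, x, y => x / y
  | .mod, x, y => x % y

/-- Only sums and products can wrap around modulo `2 ^ w`; the other operations agree with those on
natural numbers anyway. -/
def Op.safe (Z : ℕ) : Op → ℕ → ℕ → Prop
  | .add, x, y => x + y < Z
  | .mul, x, y => x * y < Z
  | _, _, _ => True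

namespace Exp

instance : Coe Var Exp := ⟨Exp.var⟩
instance (k : ℕ) : OfNat Exp k := ⟨Exp.lit k⟩
instance : Add Exp := ⟨Exp.bin .add⟩
instance : Sub Exp := ⟨Exp.bin .sub⟩
instance : Mul Exp := ⟨Exp.bin .mul⟩
instance : Div Exp := ⟨Exp.bin .div⟩
instance : Mod Exp := ⟨Exp.bin .mod⟩

def val (σ : HS) : Exp → ℕ
  | lit k => k
  | var x => σ.get x
  | bin o a b => o.val (a.val σ) (b.val σ)
  | idx A a => σ.arr A (a.val σ)

/-- All intermediate values and all array indices are below `Z`. -/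
def good (Z : ℕ) (σ : HS) : Exp → Prop
  | lit k => k < Z
  | var _ => True
  | bin o a b => a.good Z σ ∧ b.good Z σ ∧ o.safe Z (a.val σ) (b.val σ)
  | idx _ a => a.good Z σ ∧ a.val σ < Z

variable (Z k : ℕ) (σ : HS) (a b : Exp)

theorem val_ofNat : (OfNat.ofNat k : Exp).val σ = k := rfl
theorem val_add : (a + b).val σ = a.val σ + b.val σ := rfl
theorem val_sub : (a - b).val σ = a.val σ - b.val σ := rfl
theorem val_mul : (a * b).val σ = a.val σ * b.val σ := rfl
theorem val_div : (a / b).val σ = a.val σ / b.val σ := rfl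
theorem val_mod : (a % b).val σ = a.val σ % b.val σ := rfl
theorem good_ofNat : (OfNat.ofNat k : Exp).good Z σ ↔ k < Z := Iff.rfl
theorem good_add : (a + b).good Z σ ↔ a.good Z σ ∧ b.good Z σ ∧ a.val σ + b.val σ < Z := Iff.rfl
theorem good_mul : (a * b).good Z σ ↔ a.good Z σ ∧ b.good Z σ ∧ a.val σ * b.val σ < Z := Iff.rfl
theorem good_sub : (a - b).good Z σ ↔ a.good Z σ ∧ b.good Z σ := by
  change _ ∧ _ ∧ True ↔ _; simp
theorem good_div : (a / b).good Z σ ↔ a.good Z σ ∧ b.good Z σ := by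
  change _ ∧ _ ∧ True ↔ _; simp
theorem good_mod : (a % b).good Z σ ↔ a.good Z σ ∧ b.good Z σ := by
  change _ ∧ _ ∧ True ↔ _; simp

end Exp

inductive Rel where
  | eq | ne | lt | le

def Rel.holds : Rel → ℕ → ℕ → Prop
  | .eq, x, y => x = y
  | .ne, x, y => x ≠ y
  | .lt, x, y => x < y
  | .le, x, y => x ≤ y

inductive Cmd where
  | skip
  | asg (x : Var) (a : Exp)
  | sto (A : Arr) (a b : Exp)
  | seq (P Q : Cmd)
  | ite (R : Rel) (a b : Exp) (P Q : Cmd)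
  | loop (R : Rel) (a b : Exp) (P : Cmd)

/-- A block of commands. -/
def Cmd.block : List Cmd → Cmd
  | [] => .skip
  | [P] => P
  | P :: Ps => .seq P (Cmd.block Ps)

/-! ### Weakest preconditions for total correctness. -/

open Cmd

/-- At most `f` tests are evaluated before the loop terminates with `Q`. -/
def iterWp (Z : ℕ) (R : Rel) (a b : Exp) (W : (HS → Prop) → HS → Prop) (Q : HS → Prop) :
    ℕ → HS → Prop
  | 0, _ => False
  | f + 1, σ => a.good Z σ ∧ b.good Z σ ∧
      (R.holds (a.val σ) (b.val σ) → W (iterWp Z R a b W Q f) σ.tick) ∧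
      (¬ R.holds (a.val σ) (b.val σ) → Q σ.tick)

/-- Weakest precondition for termination in a configuration that satisfies `Q`. -/
def wp (Z : ℕ) : Cmd → (HS → Prop) → HS → Prop
  | .skip, Q, σ => Q σ.tick
  | .asg x a, Q, σ => a.good Z σ ∧ Q (σ.set (a.val σ) x).tick
  | .sto A a b, Q, σ => a.good Z σ ∧ b.good Z σ ∧ a.val σ < Z ∧
      Q (σ.upd (a.val σ) (b.val σ) A).tick
  | .seq P P', Q, σ => wp Z P (wp Z P' Q) σ
  | .ite R a b P P', Q, σ => a.good Z σ ∧ b.good Z σ ∧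
      (R.holds (a.val σ) (b.val σ) → wp Z P Q σ.tick) ∧
      (¬ R.holds (a.val σ) (b.val σ) → wp Z P' Q σ.tick)
  | .loop R a b P, Q, σ => ∃ f, iterWp Z R a b (wp Z P) Q f σ

section
variable {Z : ℕ} {Q : HS → Prop} {σ : HS}

theorem wp_skip : wp Z .skip Q σ ↔ Q σ.tick := Iff.rfl

theorem wp_asg {x : Var} {a : Exp} :
    wp Z (.asg x a) Q σ ↔ a.good Z σ ∧ Q (σ.set (a.val σ) x).tick := Iff.rfl

theorem wp_sto {A : Arr} {a b : Exp} : wp Z (.sto A a b) Q σ ↔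
    a.good Z σ ∧ b.good Z σ ∧ a.val σ < Z ∧ Q (σ.upd (a.val σ) (b.val σ) A).tick := Iff.rfl

theorem wp_seq {P P' : Cmd} : wp Z (.seq P P') Q σ ↔ wp Z P (wp Z P' Q) σ := Iff.rfl

theorem wp_ite {R : Rel} {a b : Exp} {P P' : Cmd} : wp Z (.ite R a b P P') Q σ ↔
    a.good Z σ ∧ b.good Z σ ∧ (R.holds (a.val σ) (b.val σ) → wp Z P Q σ.tick) ∧
      (¬ R.holds (a.val σ) (b.val σ) → wp Z P' Q σ.tick) := Iff.rfl

end

theorem iterWp_mono {Z : ℕ} {R : Rel} {a b : Exp} {W : (HS → Prop) → HS → Prop}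
    (hW : ∀ {Q Q' : HS → Prop}, (∀ σ, Q σ → Q' σ) → ∀ σ, W Q σ → W Q' σ) {Q Q' : HS → Prop}
    (h : ∀ σ, Q σ → Q' σ) : ∀ f σ, iterWp Z R a b W Q f σ → iterWp Z R a b W Q' f σ
  | 0, _ => id
  | f + 1, _ => fun ⟨h1, h2, h3, h4⟩ =>
      ⟨h1, h2, fun hr => hW (iterWp_mono hW h f) _ (h3 hr), fun hr => h _ (h4 hr)⟩

theorem wp_imp {Z : ℕ} (P : Cmd) : ∀ {Q Q' : HS → Prop}, (∀ σ, Q σ → Q' σ) →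
    ∀ σ, wp Z P Q σ → wp Z P Q' σ := by
  induction P with
  | skip => exact fun h σ => h _
  | asg x a => exact fun h σ ⟨h1, h2⟩ => ⟨h1, h _ h2⟩
  | sto A a b => exact fun h σ ⟨h1, h2, h3, h4⟩ => ⟨h1, h2, h3, h _ h4⟩
  | seq P P' ih ih' => exact fun h σ => ih (ih' h) σ
  | ite R a b P P' ih ih' =>
    exact fun h σ ⟨h1, h2, h3, h4⟩ => ⟨h1, h2, fun hr => ih h _ (h3 hr), fun hr => ih' h _ (h4 hr)⟩
  | loop R a b P ih => exact fun h σ ⟨f, hf⟩ => ⟨f, iterWp_mono ih h f σ hf⟩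

theorem wp_mono {Z : ℕ} {P : Cmd} {Q Q' : HS → Prop} {σ : HS} (h : wp Z P Q σ)
    (hQ : ∀ σ', Q σ' → Q' σ') : wp Z P Q' σ := wp_imp P hQ σ h

/-- Total correctness of a loop, from an invariant and a variant. -/
theorem wp_loop {Z : ℕ} {R : Rel} {a b : Exp} {P : Cmd} {Q : HS → Prop} (Inv : HS → Prop)
    (μ : HS → ℕ)
    (h : ∀ σ, Inv σ → a.good Z σ ∧ b.good Z σ ∧
      (R.holds (a.val σ) (b.val σ) → wp Z P (fun σ' => Inv σ' ∧ μ σ' < μ σ) σ.tick) ∧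
      (¬ R.holds (a.val σ) (b.val σ) → Q σ.tick)) {σ : HS} (hσ : Inv σ) :
    wp Z (.loop R a b P) Q σ := by
  have key : ∀ k σ, Inv σ → μ σ < k → iterWp Z R a b (wp Z P) Q k σ := by
    intro k
    induction k with
    | zero => intro σ _ hk; omega
    | succ k ih =>
      intro σ hσ hk
      obtain ⟨h1, h2, h3, h4⟩ := h σ hσ
      exact ⟨h1, h2, fun hr => wp_mono (h3 hr) fun σ' ⟨hi, hm⟩ => ih σ' hi (by omega), h4⟩
  exact ⟨_, key _ σ hσ (Nat.lt_succ_self _)⟩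

/-! The compiler. -/

/-- The variable `n` gets register `0`, where the input size arrives and the answer is left.
Register `60` is reserved for `Z`, and those from `61` on are scratch. -/
def Var.reg (x : Var) : ℕ := x.ctorIdx

theorem Var.reg_lt (x : Var) : x.reg < 60 := by cases x <;> decide

def Var.all : List Var :=
  [.n, .N, .S, .i, .x, .y, .j, .r, .s, .p, .tl, .xx, .yy, .ok, .cx, .cj, .cv, .k, .k1, .lo,
   .z, .z1, .o, .c, .q, .e, .oA, .oB, .r0, .s0, .res, .e1, .v, .R, .m, .t, .found]

theorem Var.reg_inj {x y : Var} (h : x.reg = y.reg) : x = y := by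
  have hget : ∀ x : Var, Var.all[x.reg]? = some x := fun x => by cases x <;> rfl
  exact Option.some.inj ((hget x).symm.trans ((congrArg (Var.all[·]?) h).trans (hget y)))

/-- The array `inp` gets number `0`, so it starts at address `0`, exactly where the input tables
lie. -/
def Arr.num (A : Arr) : ℕ := A.ctorIdx

theorem Arr.num_lt (A : Arr) : A.num < 20 := by cases A <;> decide

def Arr.all : List Arr :=
  [.inp, .tab, .qu, .phi, .top, .code, .buf, .C, .vis, .rep, .rsz, .cnt]

theorem Arr.num_inj {A B : Arr} (h : A.num = B.num) : A = B := by
  have hget : ∀ A : Arr, Arr.all[A.num]? = some A := fun A => by cases A <;> rfl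
  exact Option.some.inj ((hget A).symm.trans ((congrArg (Arr.all[·]?) h).trans (hget B)))

/-- Turn the array index in register `t` into an address. Register `60` holds `Z`. -/
def addr (A : Arr) (t : ℕ) : Prog :=
  .seq (.const (t + 1) A.num) (.seq (.arith .mul (t + 1) (t + 1) 60) (.arith .add t t (t + 1)))

/-- The value ends up in register `t`; the registers above `t` form an evaluation stack, and those
below are left alone. -/
def Exp.comp : Exp → ℕ → Prog
  | lit k, t => .const t k
  | var x, t => .copy t x.reg
  | bin o a b, t => .seq (a.comp t) (.seq (b.comp (t + 1)) (.arith o t t (t + 1)))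
  | idx A a, t => .seq (a.comp t) (.seq (addr A t) (.load t t))

def Exp.cost : Exp → ℕ
  | lit _ => 1
  | var _ => 1
  | bin _ a b => a.cost + (b.cost + 1)
  | idx _ a => a.cost + (3 + 1)

def Rel.test : Rel → ℕ → ℕ → Test
  | .eq => .eq
  | .ne => .ne
  | .lt => .lt
  | .le => .le

/-- Machine tests compare registers only, so a loop evaluates its operands once before entry and
again at the end of every round. -/
def Cmd.comp : Cmd → Prog
  | .skip => .skip
  | .asg x a => .seq (a.comp 61) (.copy x.reg 61)
  | .sto A a b => .seq (a.comp 61) (.seq (addr A 61) (.seq (b.comp 62) (.store 61 62)))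
  | .seq P Q => .seq P.comp Q.comp
  | .ite R a b P Q =>
    .seq (.seq (a.comp 61) (b.comp 62)) (.cond (R.test 61 62) P.comp Q.comp)
  | .loop R a b P =>
    .seq (.seq (a.comp 61) (b.comp 62))
      (.loop (R.test 61 62) (.seq P.comp (.seq (a.comp 61) (b.comp 62))))

/-- A bound for the number of machine steps that one unit of time stands for. -/
def Cmd.unit : Cmd → ℕ
  | .skip => 1
  | .asg _ a => a.cost + 1
  | .sto _ a b => a.cost + b.cost + 4
  | .seq P Q => max P.unit Q.unit
  | .ite _ a b P Q => max (a.cost + b.cost + 1) (max P.unit Q.unit)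
  | .loop _ a b P => max (a.cost + b.cost + 1) P.unit

/-- The machine configuration `ρ` represents `σ`, with array `A` starting at address `A.num * Z`. -/
structure Repr (Z : ℕ) (σ : HS) (ρ : State) : Prop where
  reg : ∀ x : Var, ρ.reg x.reg = σ.get x
  size : ρ.reg 60 = Z
  mem : ∀ (A : Arr) (i : ℕ), i < Z → ρ.mem (A.num * Z + i) = σ.arr A i

theorem Repr.congr {Z : ℕ} {σ : HS} {ρ ρ' : State} (h : Repr Z σ ρ) (hm : ρ'.mem = ρ.mem)
    (hr : ∀ q < 61, ρ'.reg q = ρ.reg q) : Repr Z σ ρ' :=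
  ⟨fun x => by rw [hr _ (by have := x.reg_lt; omega), h.reg], by rw [hr _ (by omega), h.size],
    fun A i hi => by rw [hm, h.mem A i hi]⟩

theorem Repr.tick {Z : ℕ} {σ : HS} {ρ : State} (h : Repr Z σ ρ) : Repr Z σ.tick ρ :=
  ⟨fun x => by rw [h.reg, HS.get_tick], h.size, fun A i hi => by rw [h.mem A i hi, HS.arr_tick]⟩

variable {w Z : ℕ}

theorem Op.eval_eq_val {o : Op} {x y : ℕ} (hZ : Z ≤ 2 ^ w) (h : o.safe Z x y) :
    o.eval w x y = o.val x y := by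
  cases o <;> simp only [Op.eval, Op.val, Op.safe] at h ⊢ <;> exact Nat.mod_eq_of_lt (by omega)

theorem exec_addr (hZ : 20 * Z ≤ 2 ^ w) (A : Arr) {t : ℕ} (ht : 61 ≤ t) {ρ : State}
    (hz : ρ.reg 60 = Z) (hi : ρ.reg t < Z) :
    ∃ ρ', Exec w (addr A t) ρ ρ' 3 ∧ ρ'.reg t = A.num * Z + ρ.reg t ∧ ρ'.mem = ρ.mem ∧
      ∀ q < t, ρ'.reg q = ρ.reg q := by
  have hA := A.num_lt
  have h1 : A.num * Z + Z ≤ 20 * Z := by nlinarith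
  have h2 : A.num < 2 ^ w := by omega
  refine ⟨_, .seq (.const _ _ _) (.seq (.arith _ _ _ _ _) (.arith _ _ _ _ _)), ?_, rfl, ?_⟩
  · simp only [State.setReg, Op.eval, Function.update_self, Function.update_of_ne (show 60 ≠ t + 1 by omega),
      Function.update_of_ne (show t ≠ t + 1 by omega), hz, Nat.mod_eq_of_lt h2]
    rw [Nat.mod_eq_of_lt (show A.num * Z < 2 ^ w by omega),
      Nat.mod_eq_of_lt (by omega), Nat.add_comm]
  · intro q hq
    simp only [State.setReg]
    rw [Function.update_of_ne (by omega), Function.update_of_ne (by omega),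
      Function.update_of_ne (by omega)]

theorem Exp.exec_comp (hZ : 20 * Z ≤ 2 ^ w) {σ : HS} (a : Exp) : ∀ {t : ℕ} {ρ : State},
    61 ≤ t → Repr Z σ ρ → a.good Z σ →
    ∃ ρ', Exec w (a.comp t) ρ ρ' a.cost ∧ ρ'.reg t = a.val σ ∧ ρ'.mem = ρ.mem ∧
      ∀ q < t, ρ'.reg q = ρ.reg q := by
  induction a with
  | lit k =>
    intro t ρ ht hρ hg
    have hk : k < 2 ^ w := by simp only [Exp.good] at hg; omega
    exact ⟨_, .const _ _ _, by simp [State.setReg, Exp.val, Nat.mod_eq_of_lt hk], rfl,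
      fun q hq => Function.update_of_ne (by omega) _ _⟩
  | var x =>
    intro t ρ ht hρ hg
    exact ⟨_, .copy _ _ _, by simp [State.setReg, Exp.val, hρ.reg], rfl,
      fun q hq => Function.update_of_ne (by omega) _ _⟩
  | bin o a b iha ihb =>
    intro t ρ ht hρ ⟨ha, hb, hs⟩
    obtain ⟨ρ₁, e₁, v₁, m₁, r₁⟩ := iha ht hρ ha
    obtain ⟨ρ₂, e₂, v₂, m₂, r₂⟩ := ihb (t := t + 1) (by omega)
      (hρ.congr m₁ fun q hq => r₁ q (by omega)) hb
    refine ⟨_, .seq e₁ (.seq e₂ (.arith _ _ _ _ _)), ?_, by rw [← m₁, ← m₂]; rfl, fun q hq => ?_⟩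
    · simp only [State.setReg, Function.update_self, v₂, r₂ t (by omega), v₁, Exp.val]
      exact Op.eval_eq_val (by omega) hs
    · simp only [State.setReg, Function.update_of_ne (show q ≠ t by omega)]
      rw [r₂ q (by omega), r₁ q hq]
  | idx A a ih =>
    intro t ρ ht hρ ⟨ha, hi⟩
    obtain ⟨ρ₁, e₁, v₁, m₁, r₁⟩ := ih ht hρ ha
    obtain ⟨ρ₂, e₂, v₂, m₂, r₂⟩ := exec_addr hZ A ht (ρ := ρ₁) (by rw [r₁ _ (by omega), hρ.size])
      (by rw [v₁]; exact hi)
    refine ⟨_, .seq e₁ (.seq e₂ (.load _ _ _)), ?_, by rw [← m₁, ← m₂]; rfl, fun q hq => ?_⟩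
    · simp only [State.setReg, Function.update_self, v₂, m₂, m₁, v₁, Exp.val]
      exact hρ.mem A _ hi
    · simp only [State.setReg, Function.update_of_ne (show q ≠ t by omega)]
      rw [r₂ q (by omega), r₁ q hq]

theorem Rel.test_holds (R : Rel) (p q : ℕ) (ρ : State) :
    (R.test p q).Holds ρ ↔ R.holds (ρ.reg p) (ρ.reg q) := by cases R <;> rfl

theorem exec_operands (hZ : 20 * Z ≤ 2 ^ w) {σ : HS} {a b : Exp} (ha : a.good Z σ)
    (hb : b.good Z σ) {ρ : State} (hρ : Repr Z σ ρ) :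
    ∃ ρ', Exec w (.seq (a.comp 61) (b.comp 62)) ρ ρ' (a.cost + b.cost) ∧ Repr Z σ ρ' ∧
      ρ'.reg 61 = a.val σ ∧ ρ'.reg 62 = b.val σ := by
  obtain ⟨ρ₁, e₁, v₁, m₁, r₁⟩ := a.exec_comp hZ le_rfl hρ ha
  have hρ₁ := hρ.congr m₁ fun q hq => r₁ q hq
  obtain ⟨ρ₂, e₂, v₂, m₂, r₂⟩ := b.exec_comp hZ (t := 62) (by omega) hρ₁ hb
  exact ⟨ρ₂, .seq e₁ e₂, hρ₁.congr m₂ fun q hq => r₂ q (by omega), by rw [r₂ _ (by omega), v₁], v₂⟩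

/-- The compiled program runs as the weakest precondition predicts, `K` steps per unit of time. -/
theorem Cmd.exec_comp (hZ : 20 * Z ≤ 2 ^ w) {K : ℕ} (P : Cmd) : P.unit ≤ K →
    ∀ {Q : HS → Prop} {σ : HS} {ρ : State}, wp Z P Q σ → Repr Z σ ρ →
    ∃ σ' ρ' t, Exec w P.comp ρ ρ' t ∧ Repr Z σ' ρ' ∧ Q σ' ∧ K * σ.tm + t ≤ K * σ'.tm := by
  induction P with
  | skip =>
    intro hK Q σ ρ h hρ
    simp only [Cmd.unit] at hK
    exact ⟨_, ρ, 1, .skip _, hρ.tick, h, by rw [HS.tm_tick]; nlinarith⟩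
  | asg x a =>
    intro hK Q σ ρ ⟨hg, h⟩ hρ
    simp only [Cmd.unit] at hK
    obtain ⟨ρ₁, e₁, v₁, m₁, r₁⟩ := a.exec_comp hZ le_rfl hρ hg
    have hρ₁ := hρ.congr m₁ fun q hq => r₁ q hq
    refine ⟨_, _, _, .seq e₁ (.copy _ _ _), ⟨fun y => ?_, ?_, fun A i hi => ?_⟩, h, ?_⟩
    · rw [HS.get_tick]
      by_cases hxy : y = x
      · subst hxy
        simp only [State.setReg, Function.update_self, v₁, HS.get_set_self]
      · simp only [State.setReg, HS.get_set_ne _ _ hxy]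
        rw [Function.update_of_ne (fun hh => hxy (Var.reg_inj hh)), hρ₁.reg]
    · simp only [State.setReg]
      rw [Function.update_of_ne (by have := x.reg_lt; omega), hρ₁.size]
    · rw [HS.arr_tick, HS.arr_set]; exact hρ₁.mem A i hi
    · rw [HS.tm_tick, HS.tm_set]; nlinarith
  | sto A a b =>
    intro hK Q σ ρ ⟨ha, hb, hi, h⟩ hρ
    simp only [Cmd.unit] at hK
    obtain ⟨ρ₁, e₁, v₁, m₁, r₁⟩ := a.exec_comp hZ le_rfl hρ ha
    have hρ₁ := hρ.congr m₁ fun q hq => r₁ q hq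
    obtain ⟨ρ₂, e₂, v₂, m₂, r₂⟩ := exec_addr hZ A le_rfl hρ₁.size (by rw [v₁]; exact hi)
    have hρ₂ := hρ₁.congr m₂ fun q hq => r₂ q hq
    obtain ⟨ρ₃, e₃, v₃, m₃, r₃⟩ := b.exec_comp hZ (t := 62) (by omega) hρ₂ hb
    have hρ₃ := hρ₂.congr m₃ fun q hq => r₃ q (by omega)
    refine ⟨_, _, _, .seq e₁ (.seq e₂ (.seq e₃ (.store _ _ _))),
      ⟨fun y => ?_, hρ₃.size, fun B i hi' => ?_⟩, h, ?_⟩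
    · rw [HS.get_tick, HS.get_upd]; exact hρ₃.reg y
    · rw [HS.arr_tick]
      simp only [State.setMem, v₃, r₃ 61 (by omega), v₂, v₁]
      by_cases hAB : B = A
      · subst hAB
        rw [HS.arr_upd_self]
        by_cases hii : i = a.val σ
        · subst hii; simp
        · rw [Function.update_of_ne hii, Function.update_of_ne (by omega), hρ₃.mem B i hi']
      · rw [HS.arr_upd_ne _ _ _ hAB, Function.update_of_ne, hρ₃.mem B i hi']
        intro hh
        apply hAB
        apply Arr.num_inj
        have h1 : (B.num * Z + i) / Z = B.num := by
          rw [Nat.add_comm, Nat.add_mul_div_right _ _ (by omega), Nat.div_eq_of_lt hi']; omega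
        have h2 : (A.num * Z + a.val σ) / Z = A.num := by
          rw [Nat.add_comm, Nat.add_mul_div_right _ _ (by omega), Nat.div_eq_of_lt hi]; omega
        rw [← h1, ← h2, hh]
    · rw [HS.tm_tick, HS.tm_upd]; nlinarith
  | seq P P' ih ih' =>
    intro hK Q σ ρ h hρ
    simp only [Cmd.unit, max_le_iff] at hK
    obtain ⟨σ₁, ρ₁, t₁, e₁, hρ₁, h₁, ht₁⟩ := ih hK.1 h hρ
    obtain ⟨σ₂, ρ₂, t₂, e₂, hρ₂, h₂, ht₂⟩ := ih' hK.2 h₁ hρ₁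
    exact ⟨σ₂, ρ₂, _, .seq e₁ e₂, hρ₂, h₂, by omega⟩
  | ite R a b P P' ih ih' =>
    intro hK Q σ ρ ⟨ha, hb, hP, hP'⟩ hρ
    simp only [Cmd.unit, max_le_iff] at hK
    obtain ⟨ρ₁, e₁, hρ₁, va, vb⟩ := exec_operands hZ ha hb hρ
    by_cases hR : R.holds (a.val σ) (b.val σ)
    · obtain ⟨σ₂, ρ₂, t₂, e₂, hρ₂, h₂, ht₂⟩ := ih hK.2.1 (hP hR) hρ₁.tick
      rw [HS.tm_tick] at ht₂
      exact ⟨σ₂, ρ₂, _, .seq e₁ (.cond_true (by rwa [Rel.test_holds, va, vb]) e₂), hρ₂, h₂,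
        by nlinarith⟩
    · obtain ⟨σ₂, ρ₂, t₂, e₂, hρ₂, h₂, ht₂⟩ := ih' hK.2.2 (hP' hR) hρ₁.tick
      rw [HS.tm_tick] at ht₂
      exact ⟨σ₂, ρ₂, _, .seq e₁ (.cond_false (by rwa [Rel.test_holds, va, vb]) e₂), hρ₂, h₂,
        by nlinarith⟩
  | loop R a b P ih =>
    intro hK Q σ ρ ⟨f, hf⟩ hρ
    simp only [Cmd.unit, max_le_iff] at hK
    -- On entry the registers `61` and `62` already hold the operands. The summands `a.cost +
    -- b.cost` let the tick of the coming test pay for that earlier evaluation.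
    have key : ∀ f σ ρ, iterWp Z R a b (wp Z P) Q f σ → Repr Z σ ρ →
        ρ.reg 61 = a.val σ → ρ.reg 62 = b.val σ → ∃ σ' ρ' t,
        Exec w (.loop (R.test 61 62) (.seq P.comp (.seq (a.comp 61) (b.comp 62)))) ρ ρ' t ∧
        Repr Z σ' ρ' ∧ Q σ' ∧ K * σ.tm + t + a.cost + b.cost ≤ K * σ'.tm := by
      intro f
      induction f with
      | zero => intro σ ρ h; exact h.elim
      | succ f ihf =>
        intro σ ρ ⟨_, _, hP, hQ⟩ hρ va vb
        by_cases hR : R.holds (a.val σ) (b.val σ)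
        · obtain ⟨σ₁, ρ₁, t₁, e₁, hρ₁, h₁, ht₁⟩ := ih hK.2 (hP hR) hρ.tick
          rw [HS.tm_tick] at ht₁
          cases f with
          | zero => exact h₁.elim
          | succ f =>
            obtain ⟨ρ₂, e₂, hρ₂, va₂, vb₂⟩ := exec_operands hZ h₁.1 h₁.2.1 hρ₁
            obtain ⟨σ₃, ρ₃, t₃, e₃, hρ₃, h₃, ht₃⟩ := ihf σ₁ ρ₂ h₁ hρ₂ va₂ vb₂
            exact ⟨σ₃, ρ₃, _, .loop_true (by rwa [Rel.test_holds, va, vb]) (.seq e₁ e₂) e₃,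
              hρ₃, h₃, by nlinarith⟩
        · exact ⟨_, ρ, _, .loop_false (by rwa [Rel.test_holds, va, vb]), hρ.tick, hQ hR,
            by rw [HS.tm_tick]; nlinarith⟩
    cases f with
    | zero => exact hf.elim
    | succ f =>
      obtain ⟨ρ₁, e₁, hρ₁, va, vb⟩ := exec_operands hZ hf.1 hf.2.1 hρ
      obtain ⟨σ₂, ρ₂, t₂, e₂, hρ₂, h₂, ht₂⟩ := key _ σ ρ₁ hf hρ₁ va vb
      exact ⟨σ₂, ρ₂, _, .seq e₁ e₂, hρ₂, h₂, by omega⟩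

end

open Cmd

/-! Systems of `d` permutations of `{0, …, N - 1}`; letters outside `{1, …, d}` act trivially. -/

structure Sys (d N : ℕ) (G : ℕ → ℕ → ℕ) : Prop where
  lt : ∀ j x, x < N → G j x < N
  inj : ∀ j x y, x < N → y < N → G j x = G j y → x = y
  triv : ∀ j x, ¬ (1 ≤ j ∧ j ≤ d) → G j x = x

def act (G : ℕ → ℕ → ℕ) (l : List ℕ) (x : ℕ) : ℕ := l.foldl (fun y j => G j y) x

section
variable {G : ℕ → ℕ → ℕ}

@[simp] theorem act_nil (x : ℕ) : act G [] x = x := rfl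

@[simp] theorem act_cons (j : ℕ) (l : List ℕ) (x : ℕ) : act G (j :: l) x = act G l (G j x) := rfl

@[simp] theorem act_append (l l' : List ℕ) (x : ℕ) : act G (l ++ l') x = act G l' (act G l x) := by
  simp [act]

def Reach (G : ℕ → ℕ → ℕ) (x y : ℕ) : Prop := ∃ l, act G l x = y

/-- `x` and `y` have the same relations: the components of `x` and `y` are isomorphic by an
isomorphism that maps `x` to `y`. -/
def SameRel (G : ℕ → ℕ → ℕ) (x y : ℕ) : Prop :=
  ∀ l l', act G l x = act G l' x ↔ act G l y = act G l' y

/-- The components of `x` and `y` are isomorphic. -/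
def Sim (G : ℕ → ℕ → ℕ) (x y : ℕ) : Prop := ∃ l, SameRel G x (act G l y)

open Classical in
noncomputable def orb (G : ℕ → ℕ → ℕ) (N x : ℕ) : Finset ℕ := (Finset.range N).filter (Reach G x)

theorem card_orb_le {N x : ℕ} : (orb G N x).card ≤ N := by
  classical
  exact (Finset.card_filter_le _ _).trans_eq (Finset.card_range N)

theorem Reach.refl (x : ℕ) : Reach G x x := ⟨[], rfl⟩

theorem Reach.trans {x y z : ℕ} : Reach G x y → Reach G y z → Reach G x z :=
  fun ⟨l, hl⟩ ⟨l', hl'⟩ => ⟨l ++ l', by simp [hl, hl']⟩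

theorem Reach.step {x y : ℕ} (h : Reach G x y) (j : ℕ) : Reach G x (G j y) :=
  h.trans ⟨[j], rfl⟩

theorem SameRel.refl (x : ℕ) : SameRel G x x := fun _ _ => Iff.rfl

theorem SameRel.symm {x y : ℕ} (h : SameRel G x y) : SameRel G y x := fun l l' => (h l l').symm

theorem SameRel.trans {x y z : ℕ} (h : SameRel G x y) (h' : SameRel G y z) : SameRel G x z :=
  fun l l' => (h l l').trans (h' l l')

theorem SameRel.act {x y : ℕ} (h : SameRel G x y) (l : List ℕ) :
    SameRel G (act G l x) (act G l y) :=
  fun m m' => by simpa using h (l ++ m) (l ++ m')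

theorem Sim.refl (x : ℕ) : Sim G x x := ⟨[], SameRel.refl x⟩

theorem Sim.trans {x y z : ℕ} : Sim G x y → Sim G y z → Sim G x z :=
  fun ⟨l, h⟩ ⟨l', h'⟩ => ⟨l' ++ l, h.trans (by simpa using h'.act l)⟩

theorem SameRel.sim {x y : ℕ} (h : SameRel G x y) : Sim G x y := ⟨[], h⟩

/-- The isomorphism of components. -/
theorem SameRel.exists_map {x y : ℕ} (h : SameRel G x y) :
    ∃ f : ℕ → ℕ, ∀ l, f (SCP.act G l x) = SCP.act G l y := by
  classical
  refine ⟨fun z => if hz : Reach G x z then SCP.act G hz.choose y else z, fun l => ?_⟩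
  have hz : Reach G x (SCP.act G l x) := ⟨l, rfl⟩
  simp only [dif_pos hz]
  exact (h _ _).1 hz.choose_spec

namespace Sys
variable {d N : ℕ} (hG : Sys d N G)
include hG

theorem act_lt {x : ℕ} (hx : x < N) (l : List ℕ) : act G l x < N := by
  induction l generalizing x with
  | nil => exact hx
  | cons j l ih => exact ih (hG.lt j x hx)

theorem reach_lt {x y : ℕ} (hx : x < N) (h : Reach G x y) : y < N := by
  obtain ⟨l, rfl⟩ := h
  exact hG.act_lt hx l

/-- Words contain no inverse letters, but an injective self-map of a finite set is periodic at every
point, so a power of `G j` leads back. -/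
theorem reach_back {x : ℕ} (hx : x < N) (j : ℕ) : Reach G (G j x) x := by
  let f : Fin N → Fin N := fun z => ⟨G j z, hG.lt j z z.2⟩
  have hf : Function.Injective f := fun a b hab =>
    Fin.ext (hG.inj j a b a.2 b.2 (congrArg Fin.val hab))
  obtain ⟨k, hk, hp⟩ := hf.mem_periodicPts ⟨x, hx⟩
  obtain ⟨k, rfl⟩ : ∃ k', k = k' + 1 := ⟨k - 1, by omega⟩
  have key : ∀ k (z : Fin N), act G (List.replicate k j) z = (f^[k] z : Fin N) := by
    intro k
    induction k with
    | zero => intro z; rfl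
    | succ k ih => intro z; rw [List.replicate_succ, act_cons, Function.iterate_succ_apply, ← ih]
  refine ⟨List.replicate k j, ?_⟩
  have := key (k + 1) ⟨x, hx⟩
  rw [hp.eq] at this
  simpa [List.replicate_succ] using this

theorem reach_symm {x y : ℕ} (hx : x < N) : Reach G x y → Reach G y x := by
  rintro ⟨l, rfl⟩
  induction l generalizing x with
  | nil => exact Reach.refl x
  | cons j l ih => exact (ih (hG.lt j x hx)).trans (hG.reach_back hx j)

theorem mem_orb {x y : ℕ} (hx : x < N) : y ∈ orb G N x ↔ Reach G x y := by
  simp only [orb, Finset.mem_filter, Finset.mem_range, and_iff_right_iff_imp]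
  exact fun h => hG.reach_lt hx h

theorem self_mem_orb {x : ℕ} (hx : x < N) : x ∈ orb G N x := (hG.mem_orb hx).2 (Reach.refl x)

theorem orb_eq {x y : ℕ} (hx : x < N) (h : Reach G x y) : orb G N y = orb G N x := by
  ext z
  rw [hG.mem_orb (hG.reach_lt hx h), hG.mem_orb hx]
  exact ⟨h.trans, (hG.reach_symm hx h).trans⟩

theorem reach_step_iff {x : ℕ} (j : ℕ) {y : ℕ} (hy : y < N) :
    Reach G x (G j y) ↔ Reach G x y :=
  ⟨fun h => h.trans (hG.reach_back hy j), fun h => h.step j⟩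

theorem sim_symm {x y : ℕ} (hy : y < N) : Sim G x y → Sim G y x := by
  rintro ⟨l, h⟩
  obtain ⟨l', h'⟩ := hG.reach_symm hy ⟨l, rfl⟩
  exact ⟨l', by simpa [h'] using (h.act l').symm⟩

theorem sim_of_reach {x y : ℕ} (hx : x < N) (h : Reach G x y) : Sim G x y := by
  obtain ⟨l, hl⟩ := hG.reach_symm hx h
  exact ⟨l, by rw [hl]; exact SameRel.refl x⟩

theorem orb_image {x y : ℕ} (hx : x < N) (hy : y < N) {f : ℕ → ℕ}
    (hf : ∀ l, f (act G l x) = act G l y) : (orb G N x).image f = orb G N y := by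
  ext z
  simp only [Finset.mem_image, hG.mem_orb hx, hG.mem_orb hy]
  constructor
  · rintro ⟨_, ⟨l, rfl⟩, rfl⟩
    exact ⟨l, (hf l).symm⟩
  · rintro ⟨l, rfl⟩
    exact ⟨_, ⟨l, rfl⟩, hf l⟩

theorem map_injOn {x y : ℕ} (hx : x < N) (h : SameRel G x y) {f : ℕ → ℕ}
    (hf : ∀ l, f (act G l x) = act G l y) : Set.InjOn f (orb G N x) := by
  intro a ha b hb hab
  obtain ⟨l, rfl⟩ := (hG.mem_orb hx).1 (Finset.mem_coe.1 ha)
  obtain ⟨l', rfl⟩ := (hG.mem_orb hx).1 (Finset.mem_coe.1 hb)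
  rw [hf, hf] at hab
  exact (h l l').2 hab

theorem card_orb_of_sameRel {x y : ℕ} (hx : x < N) (hy : y < N) (h : SameRel G x y) :
    (orb G N x).card = (orb G N y).card := by
  obtain ⟨f, hf⟩ := h.exists_map
  rw [← hG.orb_image hx hy hf, Finset.card_image_of_injOn (hG.map_injOn hx h hf)]

theorem card_orb_of_sim {x y : ℕ} (hx : x < N) (hy : y < N) :
    Sim G x y → (orb G N x).card = (orb G N y).card := by
  rintro ⟨l, h⟩
  rw [hG.card_orb_of_sameRel hx (hG.act_lt hy l) h, hG.orb_eq hy ⟨l, rfl⟩]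

/-- A homomorphism between components of equal size is an isomorphism. -/
theorem sameRel_of_hom {x y : ℕ} (hx : x < N) (hy : y < N)
    (h : ∀ l l', act G l x = act G l' x → act G l y = act G l' y)
    (hc : (orb G N x).card = (orb G N y).card) : SameRel G x y := by
  classical
  have hf : ∃ f : ℕ → ℕ, ∀ l, f (act G l x) = act G l y := by
    refine ⟨fun z => if hz : Reach G x z then act G hz.choose y else z, fun l => ?_⟩
    have hz : Reach G x (act G l x) := ⟨l, rfl⟩
    simp only [dif_pos hz]
    exact h _ _ hz.choose_spec
  obtain ⟨f, hf⟩ := hf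
  -- `f` maps one component onto the other, and a surjection between finite sets of equal size is
  -- injective.
  have hinj : Set.InjOn f (orb G N x) :=
    Finset.injOn_of_card_image_eq (by rw [hG.orb_image hx hy hf, hc])
  intro l l'
  refine ⟨h l l', fun he => hinj ?_ ?_ (by rw [hf, hf, he])⟩ <;>
  · rw [Finset.mem_coe, hG.mem_orb hx]
    exact ⟨_, rfl⟩

open Classical in
/-- Two invariant sets with the same number of points of each type are isomorphic. -/
theorem exists_equivariant_bijOn (U V : Finset ℕ) (hU : ∀ x ∈ U, x < N ∧ ∀ j, G j x ∈ U)
    (hV : ∀ x ∈ V, x < N ∧ ∀ j, G j x ∈ V)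
    (hc : ∀ x < N, (U.filter (Sim G x)).card = (V.filter (Sim G x)).card) :
    ∃ f : ℕ → ℕ, Set.BijOn f U V ∧ ∀ j, ∀ x ∈ U, f (G j x) = G j (f x) := by
  induction hk : U.card using Nat.strong_induction_on generalizing U V with
  | _ k ih =>
  have hclosed : ∀ W : Finset ℕ, (∀ x ∈ W, x < N ∧ ∀ j, G j x ∈ W) → ∀ x ∈ W, ∀ y, Reach G x y →
      y ∈ W := by
    rintro W hW x hx y ⟨l, rfl⟩
    induction l generalizing x with
    | nil => exact hx
    | cons j l ihl => exact ihl _ ((hW x hx).2 j)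
  rcases U.eq_empty_or_nonempty with rfl | ⟨x, hx⟩
  · have : V = ∅ := by
      by_contra hne
      obtain ⟨y, hy⟩ := Finset.nonempty_iff_ne_empty.2 hne
      have h := hc y (hV y hy).1
      rw [Finset.filter_empty, Finset.card_empty] at h
      exact absurd (Finset.mem_filter.2 ⟨hy, Sim.refl y⟩)
        (Finset.card_eq_zero.1 h.symm ▸ Finset.notMem_empty y)
    subst this
    exact ⟨id, by simp, by simp⟩
  have hxN := (hU x hx).1
  obtain ⟨y', hy'⟩ : (V.filter (Sim G x)).Nonempty := by
    rw [← Finset.card_pos, ← hc x hxN, Finset.card_pos]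
    exact ⟨x, Finset.mem_filter.2 ⟨hx, Sim.refl x⟩⟩
  obtain ⟨hy'V, l, hl⟩ := Finset.mem_filter.1 hy'
  set y := act G l y'
  have hy : y ∈ V := hclosed V hV y' hy'V _ ⟨l, rfl⟩
  have hyN := (hV y hy).1
  have hsub : ∀ W : Finset ℕ, (∀ x ∈ W, x < N ∧ ∀ j, G j x ∈ W) → ∀ x ∈ W,
      ∀ z ∈ W \ orb G N x, z < N ∧ ∀ j, G j z ∈ W \ orb G N x := by
    intro W hW x hx z hz
    obtain ⟨hz, hzo⟩ := Finset.mem_sdiff.1 hz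
    refine ⟨(hW z hz).1, fun j => Finset.mem_sdiff.2 ⟨(hW z hz).2 j, ?_⟩⟩
    rwa [hG.mem_orb (hW x hx).1, hG.reach_step_iff j (hW z hz).1,
      ← hG.mem_orb (hW x hx).1]
  -- Removing a component lowers the count of its own type by its size and changes no other count.
  -- Isomorphic components have equal sizes, so the hypothesis on the counts survives the removal of
  -- one component from each side.
  have hcard : ∀ W : Finset ℕ, (∀ x ∈ W, x < N ∧ ∀ j, G j x ∈ W) → ∀ x ∈ W, ∀ z < N,
      ((W \ orb G N x).filter (Sim G z)).card + (if Sim G z x then (orb G N x).card else 0) =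
        (W.filter (Sim G z)).card := by
    intro W hW x hx z hz
    have hxN := (hW x hx).1
    have h1 : (orb G N x).filter (Sim G z) = if Sim G z x then orb G N x else ∅ := by
      split_ifs with h
      · exact Finset.filter_true_of_mem fun a ha =>
          h.trans (hG.sim_of_reach hxN ((hG.mem_orb hxN).1 ha))
      · refine Finset.filter_false_of_mem fun a ha hza => h (hza.trans ?_)
        have hr := (hG.mem_orb hxN).1 ha
        exact hG.sim_of_reach (hG.reach_lt hxN hr) (hG.reach_symm hxN hr)
    have h2 : orb G N x ⊆ W := fun a ha => hclosed W hW x hx a ((hG.mem_orb hxN).1 ha)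
    rw [← Finset.sdiff_union_of_subset h2 (s₁ := orb G N x), Finset.filter_union,
      Finset.card_union_of_disjoint, h1, Finset.sdiff_union_of_subset h2]
    · split_ifs <;> simp
    · exact Finset.disjoint_filter_filter Finset.sdiff_disjoint
  have hsame := hG.card_orb_of_sameRel hxN hyN hl
  obtain ⟨f, hf, hfe⟩ := ih (U \ orb G N x).card (by
      rw [← hk]
      exact Finset.card_lt_card ⟨Finset.sdiff_subset, fun h =>
        (Finset.mem_sdiff.1 (h hx)).2 (hG.self_mem_orb hxN)⟩)
    (U \ orb G N x) (V \ orb G N y) (hsub U hU x hx) (hsub V hV y hy) (fun z hz => by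
      have h1 := hcard U hU x hx z hz
      have h2 := hcard V hV y hy z hz
      have h3 := hc z hz
      have h4 : Sim G z x ↔ Sim G z y :=
        ⟨fun h => h.trans hl.sim, fun h => h.trans hl.symm.sim⟩
      simp only [h4, hsame] at h1
      omega) rfl
  obtain ⟨g, hg⟩ := hl.exists_map
  have hgb : Set.BijOn g (orb G N x) (orb G N y) := by
    have := (hG.map_injOn hxN hl hg).bijOn_image
    rwa [← Finset.coe_image, hG.orb_image hxN hyN hg] at this
  have hUo : (U : Set ℕ) = (↑(U \ orb G N x) : Set ℕ) ∪ orb G N x := by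
    rw [← Finset.coe_union, Finset.sdiff_union_of_subset]
    exact fun a ha => hclosed U hU x hx a ((hG.mem_orb hxN).1 ha)
  have hVo : (V : Set ℕ) = (↑(V \ orb G N y) : Set ℕ) ∪ orb G N y := by
    rw [← Finset.coe_union, Finset.sdiff_union_of_subset]
    exact fun a ha => hclosed V hV y hy a ((hG.mem_orb hyN).1 ha)
  -- The component isomorphism `g` and the map `f` from the induction are glued; their images are
  -- disjoint because `f` avoids the component of `y`.
  let F : ℕ → ℕ := fun z => if z ∈ orb G N x then g z else f z
  have hF1 : Set.EqOn g F (orb G N x) := fun z hz => by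
    simp only [F, if_pos (Finset.mem_coe.1 hz)]
  have hF2 : Set.EqOn f F ↑(U \ orb G N x) := fun z hz => by
    simp only [F, if_neg (Finset.mem_sdiff.1 (Finset.mem_coe.1 hz)).2]
  have b1 := hgb.congr hF1
  have b2 := hf.congr hF2
  refine ⟨F, ?_, fun j z hz => ?_⟩
  · rw [hUo, hVo]
    refine b2.union b1 ?_
    rintro a ha b hb hab
    rcases ha with ha | ha <;> rcases hb with hb | hb
    · exact b2.injOn ha hb hab
    · have h1 := b2.mapsTo ha
      have h2 := b1.mapsTo hb
      rw [hab] at h1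
      exact absurd (Finset.mem_coe.1 h2) (Finset.mem_sdiff.1 (Finset.mem_coe.1 h1)).2
    · have h1 := b2.mapsTo hb
      have h2 := b1.mapsTo ha
      rw [hab] at h2
      exact absurd (Finset.mem_coe.1 h2) (Finset.mem_sdiff.1 (Finset.mem_coe.1 h1)).2
    · exact b1.injOn ha hb hab
  · by_cases hzo : z ∈ orb G N x
    · obtain ⟨m, rfl⟩ := (hG.mem_orb hxN).1 hzo
      have h1 : G j (act G m x) = act G (m ++ [j]) x := by simp
      rw [← hF1 hzo, h1, ← hF1 ((hG.mem_orb hxN).2 ⟨_, rfl⟩), hg, hg]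
      simp
    · have hzU := Finset.mem_sdiff.2 ⟨hz, hzo⟩
      have := (hsub U hU x hx z hzU).2 j
      rw [← hF2 hzU, ← hF2 this]
      exact hfe j z hzU

omit hG in
open Classical in
-- An equivariant bijection preserves the relations of every point, hence its type, so it restricts
-- to a bijection between the points of one type.
theorem card_filter_sim_of_bijOn {U V : Finset ℕ} (hU : ∀ x ∈ U, ∀ j, G j x ∈ U) {f : ℕ → ℕ} (hf : Set.BijOn f U V)
    (he : ∀ j, ∀ x ∈ U, f (G j x) = G j (f x)) (x : ℕ) :
    (U.filter (Sim G x)).card = (V.filter (Sim G x)).card := by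
  have hact : ∀ l, ∀ z ∈ U, act G l z ∈ U ∧ f (act G l z) = act G l (f z) := by
    intro l
    induction l with
    | nil => exact fun z hz => ⟨hz, rfl⟩
    | cons j l ih =>
      intro z hz
      obtain ⟨h1, h2⟩ := ih _ (hU z hz j)
      exact ⟨h1, by rw [act_cons, h2, he j z hz, act_cons]⟩
  have hsr : ∀ z ∈ U, SameRel G z (f z) := fun z hz l l' => by
    rw [← (hact l z hz).2, ← (hact l' z hz).2]
    exact ⟨fun h => by rw [h], fun h => hf.injOn (hact l z hz).1 (hact l' z hz).1 h⟩
  refine Finset.card_bij (fun z _ => f z) ?_ ?_ ?_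
  · intro z hz
    obtain ⟨hz, hs⟩ := Finset.mem_filter.1 hz
    exact Finset.mem_filter.2 ⟨hf.mapsTo hz, hs.trans (hsr z hz).sim⟩
  · intro a ha b hb
    exact hf.injOn (Finset.mem_filter.1 ha).1 (Finset.mem_filter.1 hb).1
  · intro b hb
    obtain ⟨hb, hs⟩ := Finset.mem_filter.1 hb
    obtain ⟨a, ha, rfl⟩ := hf.surjOn hb
    exact ⟨a, Finset.mem_filter.2 ⟨ha, hs.trans (hsr a ha).symm.sim⟩, rfl⟩

end Sys

/-- There are boundedly many types of components with at most `f` points. -/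
theorem card_le_of_not_sim (d f : ℕ) : ∃ B : ℕ, ∀ (N : ℕ) (G : ℕ → ℕ → ℕ), Sys d N G →
    ∀ T : Finset ℕ, (∀ x ∈ T, x < N ∧ (orb G N x).card ≤ f) →
    (∀ x ∈ T, ∀ y ∈ T, Sim G x y → x = y) → T.card ≤ B := by
  classical
  refine ⟨Fintype.card ((Fin (d + 1) → Fin (f + 1) → Fin (f + 1)) × Fin (f + 1)), ?_⟩
  intro N G hG T hT hsep
  have hen : ∀ x, ∃ e : ℕ → Fin (f + 1), x ∈ T → Set.InjOn e (orb G N x) := by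
    intro x
    by_cases hx : x ∈ T
    · refine ⟨fun z => if hz : z ∈ orb G N x then
        Fin.castLE ((hT x hx).2.trans (Nat.le_succ f)) ((orb G N x).equivFin ⟨z, hz⟩) else 0,
        fun _ a ha b hb hab => ?_⟩
      simp only [dif_pos (Finset.mem_coe.1 ha), dif_pos (Finset.mem_coe.1 hb)] at hab
      simpa using hab
    · exact ⟨fun _ => 0, fun h => absurd h hx⟩
  choose e he using hen
  -- Label the points of each component by `Fin (f + 1)`. The transition tables in these labels,
  -- together with the label of the root, determine which words agree at the root, and there are
  -- boundedly many such data.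
  let code : ℕ → (Fin (d + 1) → Fin (f + 1) → Fin (f + 1)) × Fin (f + 1) := fun x =>
    (fun j i => if h : ∃ z ∈ orb G N x, e x z = i then e x (G j h.choose) else 0, e x x)
  rw [← Finset.card_univ]
  refine Finset.card_le_card_of_injOn code (fun _ _ => Finset.mem_coe.2 (Finset.mem_univ _)) ?_
  intro x hx y hy hxy
  have hx := Finset.mem_coe.1 hx
  have hy := Finset.mem_coe.1 hy
  have hxN := (hT x hx).1
  have hyN := (hT y hy).1
  apply hsep x hx y hy
  have hcode : ∀ x ∈ T, ∀ z ∈ orb G N x, ∀ j : Fin (d + 1), (code x).1 j (e x z) = e x (G j z) := by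
    intro x hx z hz j
    have h : ∃ z' ∈ orb G N x, e x z' = e x z := ⟨z, hz, rfl⟩
    simp only [code, dif_pos h]
    rw [he x hx h.choose_spec.1 hz h.choose_spec.2]
  have key : ∀ l, e x (act G l x) = e y (act G l y) := by
    intro l
    induction l using List.reverseRecOn with
    | nil => exact congrArg Prod.snd hxy
    | append_singleton l j ih =>
      simp only [act_append, act_cons, act_nil]
      by_cases hj : 1 ≤ j ∧ j ≤ d
      · have h1 := hcode x hx _ ((hG.mem_orb hxN).2 ⟨l, rfl⟩) ⟨j, by omega⟩
        have h2 := hcode y hy _ ((hG.mem_orb hyN).2 ⟨l, rfl⟩) ⟨j, by omega⟩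
        simp only at h1 h2
        rw [← h1, ← h2, hxy, ih]
      · rw [hG.triv j _ hj, hG.triv j _ hj, ih]
  refine SameRel.sim fun l l' => ⟨fun h => ?_, fun h => ?_⟩
  · apply he y hy ((hG.mem_orb hyN).2 ⟨l, rfl⟩) ((hG.mem_orb hyN).2 ⟨l', rfl⟩)
    rw [← key, ← key, h]
  · apply he x hx ((hG.mem_orb hxN).2 ⟨l, rfl⟩) ((hG.mem_orb hxN).2 ⟨l', rfl⟩)
    rw [key, key, h]

end

section

/-! Breadth-first search in pairs. -/

/-- The word that a code below `S` stands for. -/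
def word (d c : ℕ) : List ℕ := (Nat.digits (d + 1) c).reverse

def flat (d : ℕ) (L : List ℕ) : List ℕ := L.flatMap (word d)

/-- `S` is the number of tabulated codes, `κ` a length such that all words of that length have codes
below `S`, and `Z` a bound that keeps arithmetic from wrapping and indices inside their arrays. -/
structure Ctx (d N S Z κ : ℕ) (G : ℕ → ℕ → ℕ) : Prop extends Sys d N G where
  d_pos : 0 < d
  κ_pos : 0 < κ
  pow_le : (d + 1) ^ κ ≤ S
  tab_le : S * N ≤ Z
  code_le : S * (d + 1) + (d + 1) < Z
  lt_Z : N * (d + 10) + 100 < Z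

/-- The state stores the action of all codes. -/
structure Std (d N S : ℕ) (G : ℕ → ℕ → ℕ) (σ : HS) : Prop where
  N_eq : σ.N = N
  S_eq : σ.S = S
  tab : ∀ c < S, ∀ y < N, σ.tab (c * N + y) = act G (word d c) y

/-- Edge number `p` leaves the queue entry `p / d` with letter `p % d + 1`. The array `phi` holds
the tentative image plus `1`, so `0` means unvisited. A code that would reach `S` is not extended:
`x` becomes the anchor `top`, and a new code starts with a single letter. A conflict is recorded,
but the search continues. -/
def bfsBody (d : ℕ) : Cmd := block [
  asg .x (.idx .qu (.var .p / .lit d)),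
  asg .j (.var .p % .lit d + 1),
  asg .y (.idx .phi (.var .x) - 1),
  asg .xx (.idx .tab (.var .j * .var .N + .var .x)),
  asg .yy (.idx .tab (.var .j * .var .N + .var .y)),
  ite .eq (.idx .phi (.var .xx)) 0
    (block [
      sto .phi (.var .xx) (.var .yy + 1),
      sto .qu (.var .tl) (.var .xx),
      asg .tl (.var .tl + 1),
      ite .lt (.idx .code (.var .x) * .lit (d + 1) + .var .j) (.var .S)
        (block [
          sto .code (.var .xx) (.idx .code (.var .x) * .lit (d + 1) + .var .j),
          sto .top (.var .xx) (.idx .top (.var .x))])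
        (block [sto .code (.var .xx) (.var .j), sto .top (.var .xx) (.var .x)])])
    (ite .ne (.idx .phi (.var .xx)) (.var .yy + 1)
      (block [asg .ok 0, asg .cx (.var .x), asg .cj (.var .j), asg .cv (.var .xx)])
      skip),
  asg .p (.var .p + 1)]

/-- The last loop clears `phi` along the queue only, so the cost depends on the size of the
component and not on `N`. -/
def bfs (d : ℕ) : Cmd := block [
  sto .qu 0 (.var .r),
  sto .phi (.var .r) (.var .s + 1),
  sto .top (.var .r) (.var .r),
  sto .code (.var .r) 0,
  asg .tl 1,
  asg .ok 1,
  asg .p 0,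
  .loop .lt (.var .p) (.var .tl * .lit d) (bfsBody d),
  asg .i 0,
  .loop .lt (.var .i) (.var .tl)
    (block [sto .phi (.idx .qu (.var .i)) 0, asg .i (.var .i + 1)])]

/-- The search tree: `L x` is the list of the codes on the path from `r` to `x`. -/
structure Tree (d S κ : ℕ) (G : ℕ → ℕ → ℕ) (r tl : ℕ) (qu top code : ℕ → ℕ) (L : ℕ → List ℕ) :
    Prop where
  inj : ∀ i < tl, ∀ i' < tl, qu i = qu i' → i = i'
  reach : ∀ i < tl, act G (flat d (L (qu i))) r = qu i
  code_lt : ∀ i < tl, code (qu i) < S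
  chain : ∀ i < tl, ∃ i' < tl, top (qu i) = qu i' ∧
    (L (qu i')).length * κ + (Nat.digits (d + 1) (code (qu i))).length ≤ i ∧
    (code (qu i) = 0 ∧ L (qu i) = [] ∧ L (qu i') = [] ∨
      code (qu i) ≠ 0 ∧ L (qu i) = L (qu i') ++ [code (qu i)])

/-- The edge `cj` from `cx` to `cv` witnesses that the relations of `r` and `s` differ. -/
def Conflict (d : ℕ) (G : ℕ → ℕ → ℕ) (s tl : ℕ) (qu : ℕ → ℕ) (L : ℕ → List ℕ) (cx cj cv : ℕ) :
    Prop :=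
  ∃ i < tl, ∃ i' < tl, cx = qu i ∧ cv = qu i' ∧ 1 ≤ cj ∧ cj ≤ d ∧ G cj (qu i) = qu i' ∧
    G cj (act G (flat d (L (qu i))) s) ≠ act G (flat d (L (qu i'))) s

structure BfsInv (d N S κ : ℕ) (G : ℕ → ℕ → ℕ) (r s p tl ok cx cj cv : ℕ)
    (qu phi top code : ℕ → ℕ) (L : ℕ → List ℕ) : Prop
    extends Tree d S κ G r tl qu top code L where
  tl_pos : 0 < tl
  root : qu 0 = r
  p_le : p ≤ tl * d
  phi_eq : ∀ i < tl, phi (qu i) = act G (flat d (L (qu i))) s + 1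
  mem_qu : ∀ x < N, phi x ≠ 0 → ∃ i < tl, qu i = x
  done : ∀ p' < p, phi (G (p' % d + 1) (qu (p' / d))) ≠ 0 ∧
    (ok = 1 → phi (G (p' % d + 1) (qu (p' / d))) = G (p' % d + 1) (phi (qu (p' / d)) - 1) + 1)
  conflict : ok ≠ 1 → Conflict d G s tl qu L cx cj cv

variable {d N S Z κ : ℕ} {G : ℕ → ℕ → ℕ} (hG : Ctx d N S Z κ G)

theorem word_zero : word d 0 = [] := by simp [word]

theorem flat_append (L L' : List ℕ) : flat d (L ++ L') = flat d L ++ flat d L' := by simp [flat]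

theorem flat_singleton (c : ℕ) : flat d [c] = word d c := by simp [flat]

/-- Letters start at `1`, so the appended digit is not lost as a leading zero even if `c = 0`. -/
theorem digits_mul_add (hd : 0 < d) {c j : ℕ} (hj : 1 ≤ j) (hjd : j ≤ d) :
    Nat.digits (d + 1) (c * (d + 1) + j) = j :: Nat.digits (d + 1) c := by
  rw [Nat.digits_def' (by omega) (by omega)]
  congr 1
  · rw [Nat.mul_add_mod', Nat.mod_eq_of_lt (by omega)]
  · rw [Nat.add_comm _ j, Nat.add_mul_div_right _ _ (by omega), Nat.div_eq_of_lt (by omega), Nat.zero_add]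

theorem word_mul_add (hd : 0 < d) {c j : ℕ} (hj : 1 ≤ j) (hjd : j ≤ d) :
    word d (c * (d + 1) + j) = word d c ++ [j] := by
  simp [word, digits_mul_add hd hj hjd]

theorem word_letter (hd : 0 < d) {j : ℕ} (hj : 1 ≤ j) (hjd : j ≤ d) : word d j = [j] := by
  have := word_mul_add hd (c := 0) hj hjd
  simpa [word_zero] using this

include hG

theorem Ctx.d_lt : d < S := by
  have := hG.pow_le
  have h := Nat.pow_le_pow_right (n := d + 1) (by omega) (Nat.succ_le_of_lt hG.κ_pos)
  rw [Nat.succ_eq_add_one, Nat.zero_add, pow_one] at h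
  omega

theorem BfsInv.start {r s cx cj cv : ℕ} {qu phi top code : ℕ → ℕ}
    (hphi : ∀ x < N, phi x = 0) :
    BfsInv d N S κ G r s 0 1 1 cx cj cv (Function.update qu 0 r)
      (Function.update phi r (s + 1)) (Function.update top r r) (Function.update code r 0)
      (fun _ => []) := by
  have hS := hG.d_lt
  refine ⟨⟨by omega, ?_, ?_, ?_⟩, by omega, by simp, by omega, ?_, ?_, by omega, by simp⟩
  · intro i hi
    obtain rfl : i = 0 := by omega
    simp [flat]
  · intro i hi
    obtain rfl : i = 0 := by omega
    simp only [Function.update_self]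
    omega
  · intro i hi
    obtain rfl : i = 0 := by omega
    exact ⟨0, by omega, by simp⟩
  · intro i hi
    obtain rfl : i = 0 := by omega
    simp [flat]
  · intro x hx h
    refine ⟨0, by omega, ?_⟩
    by_contra hne
    rw [Function.update_self] at hne
    rw [Function.update_of_ne (Ne.symm hne)] at h
    exact h (hphi x hx)

theorem BfsInv.step_new {r s p tl ok cx cj cv : ℕ} {qu phi top code : ℕ → ℕ} {L : ℕ → List ℕ}
    (h : BfsInv d N S κ G r s p tl ok cx cj cv qu phi top code L) (hp : p < tl * d)
    {xx yy c' t' : ℕ} (hxx : xx = G (p % d + 1) (qu (p / d)))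
    (hyy : yy = G (p % d + 1) (phi (qu (p / d)) - 1)) (hnew : phi xx = 0)
    (hc : code (qu (p / d)) * (d + 1) + (p % d + 1) < S ∧
        c' = code (qu (p / d)) * (d + 1) + (p % d + 1) ∧ t' = top (qu (p / d)) ∨
      S ≤ code (qu (p / d)) * (d + 1) + (p % d + 1) ∧ c' = p % d + 1 ∧ t' = qu (p / d)) :
    BfsInv d N S κ G r s (p + 1) (tl + 1) ok cx cj cv (Function.update qu tl xx)
      (Function.update phi xx (yy + 1)) (Function.update top xx t') (Function.update code xx c')
      (Function.update L xx (L t' ++ [c'])) := by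
  have hd := hG.d_pos
  have hdS := hG.d_lt
  set a := p / d with ha
  set j := p % d + 1 with hj
  have hjd : j ≤ d := Nat.mod_lt _ hd
  have hj1 : 1 ≤ j := by omega
  have hat : a < tl := by rw [ha, Nat.div_lt_iff_lt_mul hd]; exact hp
  have hne : ∀ i < tl, qu i ≠ xx := fun i hi he => by
    have := h.phi_eq i hi
    rw [he, hnew] at this
    omega
  have hneq : ∀ i < tl, Function.update qu tl xx i = qu i := fun i hi =>
    Function.update_of_ne (by omega) _ _
  obtain ⟨b, hb, htop, hlen, hch⟩ := h.chain a hat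
  have hold : ∀ {α : Type} (f : ℕ → α) (v : α), ∀ i < tl, Function.update f xx v (qu i) = f (qu i) :=
    fun f v i hi => Function.update_of_ne (hne i hi) _ _
  -- the new path
  have hpath : flat d (L t' ++ [c']) = flat d (L (qu a)) ++ [j] ∧ c' < S ∧ c' ≠ 0 ∧
      (∃ b' < tl, t' = qu b') ∧
      (L t').length * κ + (Nat.digits (d + 1) c').length ≤ tl := by
    rw [flat_append, flat_singleton]
    rcases hc with ⟨h1, rfl, rfl⟩ | ⟨h1, rfl, rfl⟩
    · refine ⟨?_, h1, by omega, ⟨b, hb, htop⟩, ?_⟩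
      · rw [word_mul_add hd hj1 hjd, htop]
        rcases hch with ⟨h2, h3, h4⟩ | ⟨h2, h3⟩
        · rw [h2, h3, h4, word_zero, List.nil_append]
        · rw [h3, flat_append, flat_singleton, List.append_assoc]
      · rw [digits_mul_add hd hj1 hjd, htop, List.length_cons]
        omega
    · refine ⟨by rw [word_letter hd hj1 hjd], by omega, by omega, ⟨a, hat, rfl⟩, ?_⟩
      -- The rejected code is at least `S ≥ (d + 1) ^ κ`, so it has more than `κ` digits. The code
      -- of `x` itself therefore accounts for at least `κ` letters when it is closed.
      have h2 : κ < (Nat.digits (d + 1) (code (qu a) * (d + 1) + j)).length := by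
        rw [Nat.lt_digits_length_iff (by omega)]
        exact hG.pow_le.trans h1
      have h4 : (Nat.digits (d + 1) j).length = 1 := by
        have := word_letter hd hj1 hjd
        rw [← List.length_reverse]
        exact (congrArg List.length this)
      rw [digits_mul_add hd hj1 hjd, List.length_cons] at h2
      rw [h4]
      have h3 : (L (qu a)).length * κ ≤ (L (qu b)).length * κ + κ := by
        rcases hch with ⟨_, h3, _⟩ | ⟨_, h3⟩
        · rw [h3]; simp
        · rw [h3, List.length_append, List.length_singleton]
          exact le_of_eq (by ring)
      omega
  obtain ⟨hflat, hc'S, hc'0, ⟨b', hb', hb'q⟩, hlen'⟩ := hpath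
  have hphia := h.phi_eq a hat
  refine ⟨⟨?_, ?_, ?_, ?_⟩, by omega, ?_, by nlinarith, ?_, ?_, ?_, ?_⟩
  · intro i hi i' hi' he
    rcases Nat.lt_succ_iff_lt_or_eq.1 hi with hi | rfl <;>
      rcases Nat.lt_succ_iff_lt_or_eq.1 hi' with hi' | rfl
    · rw [hneq i hi, hneq i' hi'] at he
      exact h.inj i hi i' hi' he
    · rw [hneq i hi, Function.update_self] at he
      exact absurd he (hne i hi)
    · rw [hneq i' hi', Function.update_self] at he
      exact absurd he.symm (hne i' hi')
    · rfl
  · intro i hi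
    rcases Nat.lt_succ_iff_lt_or_eq.1 hi with hi | rfl
    · rw [hneq i hi, hold L _ i hi, h.reach i hi]
    · rw [Function.update_self, Function.update_self, hflat, act_append, h.reach a hat, hxx]
      rfl
  · intro i hi
    rcases Nat.lt_succ_iff_lt_or_eq.1 hi with hi | rfl
    · rw [hneq i hi, hold code _ i hi]; exact h.code_lt i hi
    · rw [Function.update_self, Function.update_self]; exact hc'S
  · intro i hi
    rcases Nat.lt_succ_iff_lt_or_eq.1 hi with hi | rfl
    · obtain ⟨i', hi', h1, h2, h3⟩ := h.chain i hi
      refine ⟨i', by omega, ?_⟩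
      rw [hneq i hi, hneq i' hi', hold L _ i hi, hold L _ i' hi', hold code _ i hi,
        hold top _ i hi]
      exact ⟨h1, h2, h3⟩
    · refine ⟨b', by omega, ?_⟩
      rw [Function.update_self, hneq b' hb', hold L _ b' hb', Function.update_self,
        Function.update_self, Function.update_self, ← hb'q]
      exact ⟨rfl, hlen', Or.inr ⟨hc'0, rfl⟩⟩
  · rw [hneq 0 h.tl_pos, h.root]
  · intro i hi
    rcases Nat.lt_succ_iff_lt_or_eq.1 hi with hi | rfl
    · rw [hneq i hi, hold L _ i hi, hold phi _ i hi, h.phi_eq i hi]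
    · rw [Function.update_self, Function.update_self, Function.update_self, hflat, act_append, hyy,
        hphia]
      rfl
  · intro x hx hne'
    by_cases hxe : x = xx
    · exact ⟨tl, by omega, by rw [Function.update_self, hxe]⟩
    · rw [Function.update_of_ne hxe] at hne'
      obtain ⟨i, hi, he⟩ := h.mem_qu x hx hne'
      exact ⟨i, by omega, by rw [hneq i hi, he]⟩
  · intro p' hp'
    have hp'd : p' / d < tl := by rw [Nat.div_lt_iff_lt_mul hd]; omega
    rw [hneq _ hp'd, hold phi _ _ hp'd]
    rcases Nat.lt_succ_iff_lt_or_eq.1 hp' with hlt | rfl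
    · have h1 := h.done p' hlt
      have h2 : G (p' % d + 1) (qu (p' / d)) ≠ xx := fun he => h1.1 (by rw [he, hnew])
      rw [Function.update_of_ne h2]
      exact h1
    · rw [← ha, ← hj, ← hxx, ← hyy, Function.update_self]
      exact ⟨by omega, fun _ => rfl⟩
  · intro hok
    obtain ⟨i, hi, i', hi', h1, h2, h3, h4, h5, h6⟩ := h.conflict hok
    refine ⟨i, by omega, i', by omega, ?_⟩
    rw [hneq i hi, hneq i' hi', hold L _ i hi, hold L _ i' hi']
    exact ⟨h1, h2, h3, h4, h5, h6⟩

omit hG in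
theorem BfsInv.step_old {r s p tl ok cx cj cv : ℕ} {qu phi top code : ℕ → ℕ} {L : ℕ → List ℕ}
    (h : BfsInv d N S κ G r s p tl ok cx cj cv qu phi top code L) (hp : p < tl * d)
    {xx yy : ℕ} (hxx : xx = G (p % d + 1) (qu (p / d)))
    (hyy : yy = G (p % d + 1) (phi (qu (p / d)) - 1)) (hphi : phi xx = yy + 1) :
    BfsInv d N S κ G r s (p + 1) tl ok cx cj cv qu phi top code L := by
  refine ⟨h.toTree, h.tl_pos, h.root, hp, h.phi_eq, h.mem_qu, ?_, h.conflict⟩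
  intro p' hp'
  rcases Nat.lt_succ_iff_lt_or_eq.1 hp' with hlt | rfl
  · exact h.done p' hlt
  · rw [← hxx, ← hyy]
    exact ⟨by omega, fun _ => hphi⟩

/-- The end point `xx` was reached before, with an image other than the one this edge demands. So
the path to the source followed by the letter and the path to `xx` agree at `r` but not at `s`. -/
theorem BfsInv.step_conflict {r s p tl ok cx cj cv : ℕ} {qu phi top code : ℕ → ℕ}
    {L : ℕ → List ℕ} (hr : r < N)
    (h : BfsInv d N S κ G r s p tl ok cx cj cv qu phi top code L) (hp : p < tl * d)
    {xx yy : ℕ} (hxx : xx = G (p % d + 1) (qu (p / d)))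
    (hyy : yy = G (p % d + 1) (phi (qu (p / d)) - 1)) (h0 : phi xx ≠ 0) (hphi : phi xx ≠ yy + 1) :
    BfsInv d N S κ G r s (p + 1) tl 0 (qu (p / d)) (p % d + 1) xx qu phi top code L := by
  have hd := hG.d_pos
  have hat : p / d < tl := by rw [Nat.div_lt_iff_lt_mul hd]; exact hp
  refine ⟨h.toTree, h.tl_pos, h.root, hp, h.phi_eq, h.mem_qu, ?_, fun _ => ?_⟩
  · intro p' hp'
    refine ⟨?_, by simp⟩
    rcases Nat.lt_succ_iff_lt_or_eq.1 hp' with hlt | rfl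
    · exact (h.done p' hlt).1
    · rwa [← hxx]
  · have hqN : qu (p / d) < N := by rw [← h.reach _ hat]; exact hG.act_lt hr _
    obtain ⟨i', hi', he⟩ := h.mem_qu xx (hxx ▸ hG.lt _ _ hqN) h0
    refine ⟨p / d, hat, i', hi', rfl, he.symm, by omega, Nat.mod_lt _ hd, ?_, ?_⟩
    · rw [← hxx, he]
    · intro hcon
      apply hphi
      rw [hyy, h.phi_eq _ hat, Nat.add_sub_cancel, hcon, ← h.phi_eq _ hi', he]

/-- What the completed search yields. -/
structure BfsPost (d N S κ : ℕ) (G : ℕ → ℕ → ℕ) (r s tl ok cx cj cv : ℕ)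
    (qu top code : ℕ → ℕ) (L : ℕ → List ℕ) : Prop
    extends Tree d S κ G r tl qu top code L where
  mem_orb : ∀ i < tl, qu i ∈ orb G N r
  exists_qu : ∀ x ∈ orb G N r, ∃ i < tl, qu i = x
  card : tl = (orb G N r).card
  hom : ok = 1 → ∀ l l', act G l r = act G l' r → act G l s = act G l' s
  conflict : ok ≠ 1 → Conflict d G s tl qu L cx cj cv

/-- Once all `tl * d` edges are processed, the queue is closed under the letters and hence is the
whole component. Without a conflict, `phi` at `act G l r` is `act G l s + 1` for every word `l`, so
the image depends only on the point reached. -/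
theorem BfsInv.post {r s p tl ok cx cj cv : ℕ} {qu phi top code : ℕ → ℕ} {L : ℕ → List ℕ}
    (hr : r < N) (h : BfsInv d N S κ G r s p tl ok cx cj cv qu phi top code L)
    (hp : tl * d ≤ p) : BfsPost d N S κ G r s tl ok cx cj cv qu top code L := by
  have hd := hG.d_pos
  have hmem : ∀ i < tl, qu i ∈ orb G N r := fun i hi => by
    rw [hG.mem_orb hr]
    exact ⟨_, h.reach i hi⟩
  have hqN : ∀ i < tl, qu i < N := fun i hi => hG.reach_lt hr ((hG.mem_orb hr).1 (hmem i hi))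
  have hedge : ∀ i < tl, ∀ j, phi (G j (qu i)) ≠ 0 ∧
      (ok = 1 → 1 ≤ j ∧ j ≤ d → phi (G j (qu i)) = G j (phi (qu i) - 1) + 1) := by
    intro i hi j
    by_cases hj : 1 ≤ j ∧ j ≤ d
    · have h1 : i * d + (j - 1) < p := by
        have : (i + 1) * d ≤ tl * d := Nat.mul_le_mul_right _ hi
        rw [Nat.add_mul] at this
        omega
      have h2 : (i * d + (j - 1)) % d + 1 = j := by
        rw [Nat.mul_add_mod', Nat.mod_eq_of_lt (by omega)]; omega
      have h3 : (i * d + (j - 1)) / d = i := by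
        rw [Nat.add_comm, Nat.add_mul_div_right _ _ hd, Nat.div_eq_of_lt (by omega), Nat.zero_add]
      have := h.done _ h1
      rw [h2, h3] at this
      exact ⟨this.1, fun h _ => this.2 h⟩
    · rw [hG.triv j _ hj, h.phi_eq i hi]
      exact ⟨by omega, fun _ h => absurd h hj⟩
  have hwalk : ∀ l, ∃ i < tl, qu i = act G l r := by
    intro l
    induction l using List.reverseRecOn with
    | nil => exact ⟨0, h.tl_pos, h.root⟩
    | append_singleton l j ih =>
      obtain ⟨i, hi, he⟩ := ih
      rw [act_append, ← he]
      exact h.mem_qu _ (hG.lt _ _ (hqN i hi)) (hedge i hi j).1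
  have hsurj : ∀ x ∈ orb G N r, ∃ i < tl, qu i = x := by
    intro x hx
    obtain ⟨l, rfl⟩ := (hG.mem_orb hr).1 hx
    exact hwalk l
  refine ⟨h.toTree, hmem, hsurj, ?_, fun hok => ?_, h.conflict⟩
  · rw [← Finset.card_range tl]
    refine Finset.card_bij (fun i _ => qu i) (fun i hi => hmem i (Finset.mem_range.1 hi))
      (fun i hi i' hi' => h.inj i (Finset.mem_range.1 hi) i' (Finset.mem_range.1 hi'))
      (fun x hx => ?_)
    obtain ⟨i, hi, he⟩ := hsurj x hx
    exact ⟨i, Finset.mem_range.2 hi, he⟩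
  · have hphi : ∀ l, phi (act G l r) = act G l s + 1 := by
      intro l
      induction l using List.reverseRecOn with
      | nil =>
        obtain ⟨i', hi', _, hlen, hch⟩ := h.chain 0 h.tl_pos
        have h1 := h.phi_eq 0 h.tl_pos
        -- At queue position `0` the length bound of `chain` leaves room for the code `0` only, so
        -- the path to the root is empty.
        have h2 : L (qu 0) = [] := by
          rcases hch with hch | hch
          · exact hch.2.1
          · have h3 : (Nat.digits (d + 1) (code (qu 0))).length = 0 := by omega
            rw [List.length_eq_zero_iff, Nat.digits_eq_nil_iff_eq_zero] at h3
            exact absurd h3 hch.1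
        rw [h2, h.root] at h1
        simpa [flat] using h1
      | append_singleton l j ih =>
        obtain ⟨i, hi, he⟩ := hwalk l
        simp only [act_append, act_cons, act_nil]
        by_cases hj : 1 ≤ j ∧ j ≤ d
        · rw [← he, (hedge i hi j).2 hok hj, he, ih, Nat.add_sub_cancel]
        · rw [hG.triv j _ hj, hG.triv j _ hj, ih]
    intro l l' hll
    have h1 := hphi l
    rw [hll, hphi l'] at h1
    omega

end

/-! ### Correctness and running time of the breadth-first search. -/

section

attribute [local simp] wp_skip wp_asg wp_sto wp_seq wp_ite Cmd.block Exp.val Exp.good Exp.val_ofNat Exp.val_add Exp.val_sub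
  Exp.val_mul Exp.val_div Exp.val_mod Exp.good_ofNat Exp.good_add Exp.good_sub Exp.good_mul
  Exp.good_div Exp.good_mod HS.get HS.set HS.arr HS.upd HS.tick Rel.holds Op.val Op.safe

section

variable {d N S Z κ : ℕ} {G : ℕ → ℕ → ℕ} (hG : Ctx d N S Z κ G)
include hG

theorem Ctx.tab_lt {c y : ℕ} (hc : c < S) (hy : y < N) : c * N + y < Z := by
  have h1 : (c + 1) * N ≤ S * N := Nat.mul_le_mul_right _ hc
  have := hG.tab_le
  rw [Nat.add_mul] at h1
  omega

theorem Ctx.code_lt {c j : ℕ} (hc : c < S) (hj : j ≤ d) : c * (d + 1) + j < Z := by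
  have h1 : c * (d + 1) ≤ S * (d + 1) := Nat.mul_le_mul_right _ hc.le
  have := hG.code_le
  omega

theorem Ctx.letter {σ : HS} (hσ : Std d N S G σ) {j y : ℕ} (hj : 1 ≤ j) (hjd : j ≤ d)
    (hy : y < N) : σ.tab (j * N + y) = G j y := by
  have := hG.d_lt
  rw [hσ.tab j (by omega) y hy, word_letter hG.d_pos hj hjd]
  rfl

theorem BfsInv.qu_lt {r s p tl ok cx cj cv : ℕ} {qu phi top code : ℕ → ℕ} {L : ℕ → List ℕ}
    (hr : r < N) (h : BfsInv d N S κ G r s p tl ok cx cj cv qu phi top code L) {i : ℕ}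
    (hi : i < tl) : qu i < N := by
  rw [← h.reach i hi]; exact hG.act_lt hr _

theorem BfsInv.tl_le {r s p tl ok cx cj cv : ℕ} {qu phi top code : ℕ → ℕ} {L : ℕ → List ℕ}
    (hr : r < N) (h : BfsInv d N S κ G r s p tl ok cx cj cv qu phi top code L) : tl ≤ N := by
  rw [← Finset.card_range tl, ← Finset.card_range N]
  exact Finset.card_le_card_of_injOn qu
    (fun i hi => Finset.mem_coe.2 (Finset.mem_range.2 (h.qu_lt hG hr (by simpa using hi))))
    (fun i hi i' hi' => h.inj i (by simpa using hi) i' (by simpa using hi'))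

theorem wp_bfsBody {σ : HS} (hσ : Std d N S G σ) (hr : σ.r < N) (hs : σ.s < N)
    {L : ℕ → List ℕ} (h : BfsInv d N S κ G σ.r σ.s σ.p σ.tl σ.ok σ.cx σ.cj σ.cv σ.qu σ.phi σ.top
      σ.code L) (hp : σ.p < σ.tl * d) :
    wp Z (bfsBody d) (fun σ' => ∃ tl ok x y j xx yy cx cj cv qu phi top code tm L,
      σ' = { σ with
        p := σ.p + 1, tl := tl, ok := ok, x := x, y := y, j := j, xx := xx, yy := yy,
        cx := cx, cj := cj, cv := cv, qu := qu, phi := phi, top := top, code := code, tm := tm } ∧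
      BfsInv d N S κ G σ.r σ.s (σ.p + 1) tl ok cx cj cv qu phi top code L ∧
      tm ≤ σ.tm + 20) σ := by
  have hd := hG.d_pos
  have hdS := hG.d_lt
  have hZ := hG.lt_Z
  have htl := h.tl_le hG hr
  have hat : σ.p / d < σ.tl := by rw [Nat.div_lt_iff_lt_mul hd]; exact hp
  have hjd : σ.p % d < d := Nat.mod_lt _ hd
  have hq := h.qu_lt hG hr hat
  have hphi := h.phi_eq _ hat
  have hyN : σ.phi (σ.qu (σ.p / d)) - 1 < N := by
    rw [hphi]; exact hG.act_lt hs _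
  have hx := hG.letter hσ (j := σ.p % d + 1) (by omega) (by omega) hq
  have hy := hG.letter hσ (j := σ.p % d + 1) (by omega) (by omega) hyN
  have hxN := hG.lt (σ.p % d + 1) _ hq
  have hyN' := hG.lt (σ.p % d + 1) _ hyN
  have hpN : σ.p < N * d := hp.trans_le (Nat.mul_le_mul_right _ htl)
  have hNd : N * d + 10 * N + 100 < Z := by rw [Nat.mul_add] at hZ; omega
  have hN : 0 < N := by omega
  have hc := hG.code_lt (h.code_lt _ hat) (j := σ.p % d + 1) (by omega)
  have hc0 := hG.code_lt (h.code_lt _ hat) (j := 0) (by omega)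
  have ht1 := hG.tab_lt (c := σ.p % d + 1) (by omega) hq
  have ht2 := hG.tab_lt (c := σ.p % d + 1) (by omega) hyN
  have ht3 := hG.tab_lt (c := σ.p % d + 1) (by omega) hN
  have hdZ : d + 1 < Z := by have := hG.code_le; omega
  have hpZ : σ.p / d < Z := by omega
  simp [bfsBody, hσ.N_eq, hσ.S_eq, hx, hy]
  repeat' first | apply And.intro | intro
  -- Apart from bounds, four cases remain: a new point with an extended code, a new point with a
  -- fresh code, a conflict, and a consistent edge.
  all_goals first | omega | skip
  · rename_i h0 h1
    exact ⟨_, h.step_new hG hp rfl rfl h0 (Or.inl ⟨h1, rfl, rfl⟩)⟩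
  · rename_i h0 h1
    exact ⟨_, h.step_new hG hp rfl rfl h0 (Or.inr ⟨h1, rfl, rfl⟩)⟩
  · rename_i h0 h1
    exact ⟨L, h.step_conflict hG hr hp rfl rfl h0 h1⟩
  · rename_i h0 h1
    exact ⟨L, h.step_old hp rfl rfl h1⟩

theorem wp_bfs {σ : HS} (hσ : Std d N S G σ) (hr : σ.r < N) (hs : σ.s < N)
    (hphi : ∀ x < N, σ.phi x = 0) :
    wp Z (bfs d) (fun σ' => ∃ p tl ok x y j xx yy cx cj cv i qu phi top code tm L,
      σ' = { σ with
        p := p, tl := tl, ok := ok, x := x, y := y, j := j, xx := xx, yy := yy, i := i,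
        cx := cx, cj := cj, cv := cv, qu := qu, phi := phi, top := top, code := code, tm := tm } ∧
      (∀ x < N, phi x = 0) ∧
      BfsPost d N S κ G σ.r σ.s tl ok cx cj cv qu top code L ∧
      tm ≤ σ.tm + (21 * d + 20) * tl) σ := by
  have hZ := hG.lt_Z
  have hNd : N * d + 10 * N + 100 < Z := by rw [Nat.mul_add] at hZ; omega
  have hN : 0 < N := by omega
  have hdZ : d + 1 < Z := by have := hG.code_le; omega
  have h0 := BfsInv.start hG (s := σ.s) (cx := σ.cx) (cj := σ.cj) (cv := σ.cv) (qu := σ.qu)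
    (top := σ.top) (code := σ.code) hphi (r := σ.r)
  simp only [bfs, Cmd.block]
  simp
  refine ⟨by omega, by omega, by omega, by omega, by omega, by omega, by omega, ?_⟩
  refine wp_loop (fun σ' => ∃ p tl ok x y j xx yy cx cj cv qu phi top code tm L,
      σ' = { σ with
        p := p, tl := tl, ok := ok, x := x, y := y, j := j, xx := xx, yy := yy,
        cx := cx, cj := cj, cv := cv, qu := qu, phi := phi, top := top, code := code, tm := tm } ∧
      BfsInv d N S κ G σ.r σ.s p tl ok cx cj cv qu phi top code L ∧
      tm ≤ σ.tm + 8 + 21 * p) (fun σ' => N * d - σ'.p) ?_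
    ⟨_, _, _, _, _, _, _, _, _, _, _, _, _, _, _, _, _, rfl, h0, by simp⟩
  rintro _ ⟨p, tl, ok, x, y, j, xx, yy, cx, cj, cv, qu, phi, top, code, tm, L, rfl, h, htm⟩
  have htl := h.tl_le hG hr
  have htld : tl * d ≤ N * d := Nat.mul_le_mul_right _ htl
  refine ⟨by simp, by simp; omega, fun hp => ?_, fun hp => ?_⟩
  · simp at hp
    refine wp_mono (wp_bfsBody hG (L := L) ⟨hσ.N_eq, hσ.S_eq, hσ.tab⟩ hr hs h hp) ?_
    rintro _ ⟨tl, ok, x, y, j, xx, yy, cx, cj, cv, qu, phi, top, code, tm, L, rfl, h, htm⟩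
    simp at htm ⊢
    exact ⟨⟨⟨L, h⟩, by omega⟩, by omega⟩
  · simp at hp ⊢
    have hpe : p = tl * d := le_antisymm h.p_le hp
    refine ⟨by omega, ?_⟩
    refine wp_loop (fun σ' => ∃ i phi' tm,
      σ' = { σ with
        p := p, tl := tl, ok := ok, x := x, y := y, j := j, xx := xx, yy := yy, i := i,
        cx := cx, cj := cj, cv := cv, qu := qu, phi := phi', top := top, code := code, tm := tm } ∧
      i ≤ tl ∧ (∀ x < N, phi' x ≠ 0 → ∃ i', i ≤ i' ∧ i' < tl ∧ qu i' = x) ∧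
      tm ≤ σ.tm + 12 + 21 * p + 3 * i) (fun σ' => tl - σ'.i) ?_
      ⟨0, phi, _, rfl, Nat.zero_le _, ?_, ?_⟩
    · rintro _ ⟨i, phi', tm', rfl, hi, hphi', htm'⟩
      simp
      refine ⟨fun hlt => ?_, fun hge => ?_⟩
      · have hqN := h.qu_lt hG hr hlt
        refine ⟨by omega, by omega, by omega, ⟨by omega, by omega⟩, ⟨⟨by omega, ?_, by omega⟩, by omega⟩⟩
        intro x hx hne
        by_cases hxe : x = qu i
        · simp [hxe] at hne
        · rw [Function.update_of_ne hxe] at hne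
          obtain ⟨i', h1, h2, h3⟩ := hphi' x hx hne
          refine ⟨i', ?_, h2, h3⟩
          rcases Nat.lt_or_eq_of_le h1 with h4 | rfl
          · omega
          · exact absurd h3.symm hxe
      · refine ⟨?_, ⟨L, h.post hG hr (by omega)⟩, ?_⟩
        · intro x hx
          by_contra hne
          obtain ⟨i', h1, h2, h3⟩ := hphi' x hx hne
          omega
        · have := h.tl_pos
          have h1 : (21 * d + 20) * tl = 21 * (tl * d) + 20 * tl := by ring
          omega
    · intro x hx hne
      obtain ⟨i', h1, h2⟩ := h.mem_qu x hx hne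
      exact ⟨i', by simp, h1, h2⟩
    · simp; omega

end

section

/-! Evaluation of words at candidate roots. -/

/-- Append the path to `x` in the search tree, last code first, to the buffer. -/
def ext : Cmd := .loop .ne (.idx .code (.var .x)) 0 (block [
  sto .buf (.var .k) (.idx .code (.var .x)),
  asg .k (.var .k + 1),
  asg .x (.idx .top (.var .x))])

/-- The buffer is read downwards because `ext` stores a path with its last code first. -/
def eval : Cmd := .loop .lt (.var .lo) (.var .i) (block [
  asg .i (.var .i - 1),
  asg .z (.idx .tab (.idx .buf (.var .i) * .var .N + .var .z))])

def test : Cmd := block [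
  asg .z (.var .y), asg .lo 0, asg .i (.var .k1), eval, asg .z1 (.var .z),
  asg .z (.var .y), asg .lo (.var .k1), asg .i (.var .k), eval]

/-- Move the candidates on which the two words agree to the front. -/
def part : Cmd := block [
  asg .q 0, asg .e 0,
  .loop .lt (.var .q) (.var .c) (block [
    asg .y (.idx .C (.var .o + .var .q)),
    test,
    ite .eq (.var .z1) (.var .z)
      (block [
        sto .C (.var .o + .var .q) (.idx .C (.var .o + .var .e)),
        sto .C (.var .o + .var .e) (.var .y),
        asg .e (.var .e + 1)])
      skip,
    asg .q (.var .q + 1)])]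

/-- The list `cs` is stored backwards from address `lo` on. -/
def Seg (S : ℕ) (buf : ℕ → ℕ) (lo : ℕ) : List ℕ → Prop
  | [] => True
  | c :: cs => buf (lo + cs.length) = c ∧ c < S ∧ Seg S buf lo cs

variable {d N S Z κ : ℕ} {G : ℕ → ℕ → ℕ}

theorem Seg.congr {buf buf' : ℕ → ℕ} {lo : ℕ} {cs : List ℕ} (h : Seg S buf lo cs)
    (he : ∀ q, lo ≤ q → q < lo + cs.length → buf' q = buf q) : Seg S buf' lo cs := by
  induction cs with
  | nil => trivial
  | cons c cs ih =>
    rw [List.length_cons] at he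
    exact ⟨by rw [he _ (by omega) (by omega), h.1], h.2.1,
      ih h.2.2 fun q h1 h2 => he q h1 (by omega)⟩

/-- Every code on a path except the last spans at least `κ` letters, and the queue position bounds
the depth. Hence a path needs only about `i / κ + 1` table look-ups. -/
theorem Tree.length_le {r tl : ℕ} {qu top code : ℕ → ℕ} {L : ℕ → List ℕ}
    (h : Tree d S κ G r tl qu top code L) {i : ℕ} (hi : i < tl) :
    (L (qu i)).length * κ ≤ i + κ := by
  obtain ⟨i', -, -, hl, hc⟩ := h.chain i hi
  rcases hc with ⟨-, h2, -⟩ | ⟨-, h2⟩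
  · simp [h2]
  · rw [h2, List.length_append, List.length_singleton, Nat.add_mul, Nat.one_mul]
    omega

theorem wp_ext {σ : HS} {r tl : ℕ} {L : ℕ → List ℕ}
    (h : Tree d S κ G r tl σ.qu σ.top σ.code L) {i lo : ℕ} {cs : List ℕ} (hi : i < tl)
    (hx : σ.x = σ.qu i) (hseg : Seg S σ.buf lo cs) (hk : σ.k = lo + cs.length)
    (hZ : σ.k + (L (σ.qu i)).length + 1 < Z) (hqu : ∀ i < tl, σ.qu i < Z) :
    wp Z ext (fun σ' => ∃ x k buf tm, σ' = { σ with x := x, k := k, buf := buf, tm := tm } ∧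
      Seg S buf lo (L (σ.qu i) ++ cs) ∧ k = lo + (L (σ.qu i) ++ cs).length ∧
      (∀ q < σ.k, buf q = σ.buf q) ∧ tm ≤ σ.tm + 4 * (L (σ.qu i)).length + 1) σ := by
  refine wp_loop (fun σ' => ∃ x k buf tm i' cs',
      σ' = { σ with x := x, k := k, buf := buf, tm := tm } ∧ i' < tl ∧ x = σ.qu i' ∧
      L (σ.qu i) ++ cs = L (σ.qu i') ++ cs' ∧ Seg S buf lo cs' ∧ k = lo + cs'.length ∧
      σ.k ≤ k ∧ (∀ q < σ.k, buf q = σ.buf q) ∧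
      tm + 4 * (L (σ.qu i')).length ≤ σ.tm + 4 * (L (σ.qu i)).length)
    (fun σ' => (L σ'.x).length) ?_ ⟨_, _, _, _, i, cs, rfl, hi, hx, rfl, hseg, hk, le_rfl,
      fun _ _ => rfl, le_rfl⟩
  rintro _ ⟨x, k, buf, tm, i', cs', rfl, hi', rfl, hl, hseg', rfl, hkk, hag, htm⟩
  have hlen := congrArg List.length hl
  rw [List.length_append, List.length_append] at hlen
  have hq := hqu i' hi'
  obtain ⟨i'', hi'', htop, -, hch⟩ := h.chain i' hi'
  refine ⟨by simp; omega, by simp; omega, fun hc => ?_, fun hc => ?_⟩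
  · simp only [Rel.holds, Exp.val, HS.get, HS.arr] at hc
    rcases hch with ⟨h1, -⟩ | ⟨h1, h2⟩
    · exact absurd h1 hc
    · rw [h2] at htm hlen hl
      rw [List.length_append, List.length_singleton] at htm hlen
      simp
      refine ⟨hq, by omega, ⟨by omega, by omega⟩, hq,
        ⟨i'', σ.code (σ.qu i') :: cs', ⟨htop, by simp; omega⟩, hi'', by simpa using hl,
          ⟨by simp, h.code_lt i' hi', hseg'.congr fun q _ hq => ?_⟩, by simp; omega,
          fun q hq => ?_, by omega⟩, ?_⟩
      · rw [Function.update_of_ne (by omega)]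
      · rw [Function.update_of_ne (by omega), hag q hq]
      · rw [htop, h2]; simp
  · simp only [Rel.holds, Exp.val, HS.get, HS.arr, not_not, ne_eq] at hc
    rcases hch with ⟨-, h2, -⟩ | ⟨h1, -⟩
    · rw [h2] at hl htm hlen
      rw [hl]
      simp at htm ⊢
      exact ⟨hseg', hag, by omega⟩
    · exact absurd hc h1

theorem wp_eval (hG : Ctx d N S Z κ G) {σ : HS} (hσ : Std d N S G σ) {cs : List ℕ}
    (hseg : Seg S σ.buf σ.lo cs) (hi : σ.i = σ.lo + cs.length) (hz : σ.z < N) (hZ : σ.i < Z) :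
    wp Z eval (fun σ' => ∃ i tm, σ' = { σ with i := i, z := act G (flat d cs) σ.z, tm := tm } ∧
      tm ≤ σ.tm + 3 * cs.length + 1) σ := by
  refine wp_loop (fun σ' => ∃ i z tm cs',
      σ' = { σ with i := i, z := z, tm := tm } ∧ i = σ.lo + cs'.length ∧ z < N ∧
      Seg S σ.buf σ.lo cs' ∧ cs'.length ≤ cs.length ∧
      act G (flat d cs') z = act G (flat d cs) σ.z ∧
      tm + 3 * cs'.length ≤ σ.tm + 3 * cs.length)
    (fun σ' => σ'.i) ?_ ⟨_, _, _, cs, rfl, hi, hz, hseg, le_rfl, rfl, le_rfl⟩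
  rintro _ ⟨i, z, tm, cs', rfl, rfl, hz', hseg', hlen, hact, htm⟩
  refine ⟨by simp, by simp, fun hc => ?_, fun hc => ?_⟩
  · cases cs' with
    | nil => simp at hc
    | cons c cs' =>
      obtain ⟨h1, h2, h3⟩ := hseg'
      rw [List.length_cons] at hlen
      have h4 := hG.tab_lt h2 hz'
      have h5 := hσ.tab c h2 z hz'
      have h6 : σ.lo + (cs'.length + 1) - 1 = σ.lo + cs'.length := by omega
      simp [h6, h1, hσ.N_eq, h5]
      refine ⟨by omega, ⟨⟨by omega, by omega⟩, by omega⟩, cs', rfl, hG.act_lt hz' _, h3, by omega,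
        ?_, ?_⟩
      · rw [← hact]; simp [flat]
      · rw [List.length_cons] at htm; omega
  · have h0 : cs' = [] := by
      rw [← List.length_eq_zero_iff]
      simpa using hc
    subst h0
    simp [flat] at hact htm ⊢
    exact ⟨hact, by omega⟩

/-- The buffer holds the words `cs₁` and `cs₂`. -/
structure Words (S : ℕ) (σ : HS) (cs₁ cs₂ : List ℕ) : Prop where
  seg₁ : Seg S σ.buf 0 cs₁
  k1 : σ.k1 = cs₁.length
  seg₂ : Seg S σ.buf σ.k1 cs₂
  k : σ.k = σ.k1 + cs₂.length

theorem wp_test (hG : Ctx d N S Z κ G) {σ : HS} (hσ : Std d N S G σ) {cs₁ cs₂ : List ℕ}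
    (hw : Words S σ cs₁ cs₂) (hy : σ.y < N) (hZ : σ.k < Z) :
    wp Z test (fun σ' => ∃ i lo tm, σ' = { σ with
        i := i, lo := lo, tm := tm,
        z1 := act G (flat d cs₁) σ.y, z := act G (flat d cs₂) σ.y } ∧
      tm ≤ σ.tm + 3 * (cs₁.length + cs₂.length) + 9) σ := by
  have hk := hw.k
  simp [test]
  refine ⟨by omega, ?_⟩
  refine wp_mono (wp_eval hG (cs := cs₁) ?_ ?_ ?_ ?_ ?_) ?_
  · exact ⟨hσ.N_eq, hσ.S_eq, hσ.tab⟩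
  · exact hw.seg₁
  · simp [hw.k1]
  · exact hy
  · simp; omega
  rintro _ ⟨i, tm, rfl, htm⟩
  simp at htm ⊢
  refine wp_mono (wp_eval hG (cs := cs₂) ?_ ?_ ?_ ?_ ?_) ?_
  · exact ⟨hσ.N_eq, hσ.S_eq, hσ.tab⟩
  · exact hw.seg₂
  · exact hw.k
  · exact hy
  · exact hZ
  rintro _ ⟨i, tm', rfl, htm'⟩
  simp at htm' ⊢
  omega

theorem perm_mem_of_fix {p : ℕ → Prop} {π : Equiv.Perm ℕ} (h : ∀ i, ¬ p i → π i = i) {i : ℕ}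
    (hi : p i) : p (π i) := by
  by_contra hc
  have := π.injective (h _ hc)
  rw [this] at hc
  exact hc hi

/-- `C'` is a rearrangement of `C` on `[o, o + c)` with the points of `P` in the first `e` places. -/
structure Parted (P : ℕ → Prop) (o c e : ℕ) (C C' : ℕ → ℕ) (m : ℕ) : Prop where
  perm : ∃ π : Equiv.Perm ℕ, C' = C ∘ π ∧ ∀ i, ¬ (o ≤ i ∧ i < o + c) → π i = i
  le : e ≤ m
  yes : ∀ i < e, P (C' (o + i))
  no : ∀ i, e ≤ i → i < m → ¬ P (C' (o + i))

/-- Position `e` either is `m` itself or holds the first point outside `P`, so swapping positions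
`e` and `m` extends the front block by one. -/
theorem Parted.step_yes {P : ℕ → Prop} {o c e : ℕ} {C C' : ℕ → ℕ} {m : ℕ}
    (h : Parted P o c e C C' m) (hm : m < c) (hP : P (C' (o + m))) :
    Parted P o c (e + 1) C
      (Function.update (Function.update C' (o + m) (C' (o + e))) (o + e) (C' (o + m))) (m + 1) := by
  obtain ⟨⟨π, hC, hπ⟩, hle, hyes, hno⟩ := h
  have hval : Function.update (Function.update C' (o + m) (C' (o + e))) (o + e) (C' (o + m)) =
      C' ∘ Equiv.swap (o + m) (o + e) := by
    ext i
    simp only [Function.comp, Function.update_apply, Equiv.swap_apply_def]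
    split_ifs <;> simp_all
  refine ⟨⟨Equiv.swap (o + m) (o + e) |>.trans π, ?_, ?_⟩, by omega, ?_, ?_⟩
  · rw [hval, hC]; rfl
  · intro i hi
    rw [Equiv.trans_apply, Equiv.swap_apply_of_ne_of_ne (by omega) (by omega), hπ i hi]
  · intro i hi
    rcases Nat.lt_succ_iff_lt_or_eq.1 hi with hi | rfl
    · rw [Function.update_of_ne (by omega), Function.update_of_ne (by omega)]
      exact hyes i hi
    · rw [Function.update_self]; exact hP
  · intro i h1 h2
    rw [Function.update_of_ne (by omega)]
    rcases Nat.lt_succ_iff_lt_or_eq.1 h2 with h2 | rfl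
    · rw [Function.update_of_ne (by omega)]
      exact hno i (by omega) h2
    · rw [Function.update_self]
      exact hno e le_rfl (by omega)

theorem Parted.step_no {P : ℕ → Prop} {o c e : ℕ} {C C' : ℕ → ℕ} {m : ℕ}
    (h : Parted P o c e C C' m) (hP : ¬ P (C' (o + m))) : Parted P o c e C C' (m + 1) := by
  refine ⟨h.perm, by have := h.le; omega, h.yes, fun i h1 h2 => ?_⟩
  rcases Nat.lt_succ_iff_lt_or_eq.1 h2 with h2 | rfl
  · exact h.no i h1 h2
  · exact hP

theorem wp_part (hG : Ctx d N S Z κ G) {σ : HS} (hσ : Std d N S G σ) {cs₁ cs₂ : List ℕ}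
    (hw : Words S σ cs₁ cs₂) (hZ : σ.k < Z) (hC : ∀ i < σ.c, σ.C (σ.o + i) < N)
    (ho : σ.o + σ.c + 1 < Z) :
    wp Z part (fun σ' => ∃ q e y lo i z z1 C tm, σ' = { σ with
        q := q, e := e, y := y, lo := lo, i := i, z := z, z1 := z1, C := C, tm := tm } ∧
      Parted (fun y => act G (flat d cs₁) y = act G (flat d cs₂) y) σ.o σ.c e σ.C C σ.c ∧
      tm ≤ σ.tm + σ.c * (3 * (cs₁.length + cs₂.length) + 20) + 3) σ := by
  simp only [part, Cmd.block]
  simp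
  refine ⟨by omega, ?_⟩
  refine wp_loop (fun σ' => ∃ q e y lo i z z1 C tm, σ' = { σ with
        q := q, e := e, y := y, lo := lo, i := i, z := z, z1 := z1, C := C, tm := tm } ∧
      q ≤ σ.c ∧
      Parted (fun y => act G (flat d cs₁) y = act G (flat d cs₂) y) σ.o σ.c e σ.C C q ∧
      tm ≤ σ.tm + 2 + q * (3 * (cs₁.length + cs₂.length) + 20)) (fun σ' => σ.c - σ'.q) ?_
    ⟨_, _, _, _, _, _, _, _, _, rfl, Nat.zero_le _,
      ⟨⟨Equiv.refl _, rfl, fun _ _ => rfl⟩, le_rfl, by simp, by simp⟩, by simp⟩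
  rintro _ ⟨q, e, y, lo, i, z, z1, C, tm, rfl, hq, h, htm⟩
  refine ⟨by simp, by simp, fun hc => ?_, fun hc => ?_⟩
  · simp at hc
    have hyN : C (σ.o + q) < N := by
      obtain ⟨π, hCπ, hπ⟩ := h.perm
      have h1 := perm_mem_of_fix hπ (i := σ.o + q) ⟨by omega, by omega⟩
      obtain ⟨i', hi'⟩ := Nat.exists_eq_add_of_le h1.1
      rw [hCπ, Function.comp, hi']
      exact hC i' (by omega)
    have hle := h.le
    simp
    refine ⟨by omega, ?_⟩
    refine wp_mono (wp_test hG (cs₁ := cs₁) (cs₂ := cs₂) ?_ ?_ hyN hZ) ?_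
    · exact ⟨hσ.N_eq, hσ.S_eq, hσ.tab⟩
    · exact ⟨hw.seg₁, hw.k1, hw.seg₂, hw.k⟩
    rintro _ ⟨i, lo, tm', rfl, htm'⟩
    simp at htm' ⊢
    have hmul : (q + 1) * (3 * (cs₁.length + cs₂.length) + 20) =
      q * (3 * (cs₁.length + cs₂.length) + 20) + (3 * (cs₁.length + cs₂.length) + 20) := by ring
    refine ⟨fun hP => ?_, fun hP => ?_⟩
    · have h1 := h.step_yes hc hP
      repeat' apply And.intro
      all_goals first | exact h1 | omega
    · exact ⟨⟨by omega, by omega⟩, ⟨by omega, h.step_no hP, by omega⟩, by omega⟩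
  · simp at hc ⊢
    obtain rfl : q = σ.c := by omega
    exact ⟨h, by omega⟩

end

section

/-! Isomorphism test for two components of the same size. -/

def copyQueue : Cmd := block [
  asg .i 0,
  .loop .lt (.var .i) (.var .tl) (block [
    sto .C (.var .o + .var .i) (.idx .qu (.var .i)),
    asg .i (.var .i + 1)])]

def conflictWords : Cmd := block [
  sto .buf 0 (.var .cj), asg .k 1, asg .x (.var .cx), ext,
  asg .k1 (.var .k), asg .x (.var .cv), ext]

/-- The value `res = 2` means undecided. After `part` the agreeing candidates come first on both
sides, so the smaller class is selected either by shortening `c` or by moving both offsets past the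
agreeing candidates. -/
def pairBody (d : ℕ) : Cmd := block [
  asg .r (.idx .C (.var .oA)), asg .s (.idx .C (.var .oB)), bfs d,
  ite .eq (.var .ok) 1 (asg .res 1) (block [
    conflictWords,
    asg .o (.var .oA), part, asg .e1 (.var .e), asg .o (.var .oB), part,
    ite .ne (.var .e1) (.var .e) (asg .res 0)
      (ite .le (.var .e + .var .e) (.var .c) (asg .c (.var .e)) (block [
        asg .oA (.var .oA + .var .e), asg .oB (.var .oB + .var .e),
        asg .c (.var .c - .var .e)]))])]

/-- The searches with `s = r` serve only to list the two components, which are copied to `C` from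
position `0` and from position `N` on as the initial candidates. -/
def pair (d : ℕ) : Cmd := block [
  asg .r (.var .r0), asg .s (.var .r0), bfs d, asg .o 0, copyQueue,
  asg .r (.var .s0), asg .s (.var .s0), bfs d, asg .o (.var .N), copyQueue,
  asg .c (.var .tl), asg .oA 0, asg .oB (.var .N), asg .res 2,
  .loop .eq (.var .res) 2 (pairBody d)]

/-- The candidates `C (oA + i)` for `i < c` correspond to the candidates `C (oB + i)` under every
isomorphism between the components of `r0` and `s0`. -/
structure Cand (N : ℕ) (G : ℕ → ℕ → ℕ) (r0 s0 : ℕ) (C : ℕ → ℕ) (oA oB c : ℕ) : Prop where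
  pos : 0 < c
  injA : ∀ i < c, ∀ i' < c, C (oA + i) = C (oA + i') → i = i'
  injB : ∀ i < c, ∀ i' < c, C (oB + i) = C (oB + i') → i = i'
  memA : ∀ i < c, C (oA + i) ∈ orb G N r0
  memB : ∀ i < c, C (oB + i) ∈ orb G N s0
  iff : ∀ x ∈ orb G N r0, ∀ y ∈ orb G N s0, SameRel G x y →
    ((∃ i < c, C (oA + i) = x) ↔ ∃ i < c, C (oB + i) = y)

variable {d N S Z κ : ℕ} {G : ℕ → ℕ → ℕ}

theorem Cand.symm {r0 s0 oA oB c : ℕ} {C : ℕ → ℕ} (h : Cand N G r0 s0 C oA oB c) :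
    Cand N G s0 r0 C oB oA c :=
  ⟨h.pos, h.injB, h.injA, h.memB, h.memA, fun x hx y hy hxy => (h.iff y hy x hx hxy.symm).symm⟩

theorem Cand.congr {r0 s0 oA oB c : ℕ} {C C' : ℕ → ℕ} (h : Cand N G r0 s0 C oA oB c)
    {f : ℕ → ℕ} (hf : ∀ i < c, f i < c) (hfi : ∀ i < c, ∀ i' < c, f i = f i' → i = i')
    (hA : ∀ i < c, C' (oA + i) = C (oA + f i)) (hB : ∀ i < c, C' (oB + i) = C (oB + i)) :
    Cand N G r0 s0 C' oA oB c := by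
  have hsurj : ∀ i < c, ∃ i' < c, f i' = i := by
    have h1 : (Finset.range c).image f = Finset.range c :=
      Finset.eq_of_subset_of_card_le (fun i hi => by
        obtain ⟨a, ha, rfl⟩ := Finset.mem_image.1 hi
        exact Finset.mem_range.2 (hf a (Finset.mem_range.1 ha)))
        (by
          rw [Finset.card_image_of_injOn]
          exact fun i hi i' hi' => hfi i (by simpa using hi) i' (by simpa using hi'))
    intro i hi
    have h2 := Finset.mem_range.2 hi
    rw [← h1, Finset.mem_image] at h2
    obtain ⟨a, ha, he⟩ := h2
    exact ⟨a, Finset.mem_range.1 ha, he⟩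
  refine ⟨h.pos, ?_, ?_, ?_, ?_, ?_⟩
  · intro i hi i' hi' he
    rw [hA i hi, hA i' hi'] at he
    exact hfi i hi i' hi' (h.injA _ (hf i hi) _ (hf i' hi') he)
  · intro i hi i' hi' he
    rw [hB i hi, hB i' hi'] at he
    exact h.injB i hi i' hi' he
  · intro i hi
    rw [hA i hi]; exact h.memA _ (hf i hi)
  · intro i hi
    rw [hB i hi]; exact h.memB _ hi
  · intro x hx y hy hxy
    have h1 : (∃ i < c, C' (oA + i) = x) ↔ ∃ i < c, C (oA + i) = x := by
      constructor
      · rintro ⟨i, hi, he⟩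
        exact ⟨f i, hf i hi, by rw [← hA i hi, he]⟩
      · rintro ⟨i, hi, he⟩
        obtain ⟨a, ha, rfl⟩ := hsurj i hi
        exact ⟨a, ha, by rw [hA a ha, he]⟩
    have h2 : (∃ i < c, C' (oB + i) = y) ↔ ∃ i < c, C (oB + i) = y := by
      constructor <;> rintro ⟨i, hi, he⟩
      · exact ⟨i, hi, by rw [← hB i hi, he]⟩
      · exact ⟨i, hi, by rw [hB i hi, he]⟩
    rw [h1, h2]
    exact h.iff x hx y hy hxy

theorem Parted.eq_of_not_mem {P : ℕ → Prop} {o c e m : ℕ} {C C' : ℕ → ℕ}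
    (h : Parted P o c e C C' m) {i : ℕ} (hi : ¬ (o ≤ i ∧ i < o + c)) : C' i = C i := by
  obtain ⟨π, rfl, hπ⟩ := h.perm
  rw [Function.comp, hπ i hi]

theorem Cand.parted {r0 s0 oA oB c e m : ℕ} {C C' : ℕ → ℕ} {P : ℕ → Prop}
    (h : Cand N G r0 s0 C oA oB c) (hp : Parted P oA c e C C' m)
    (hd : oA + c ≤ oB ∨ oB + c ≤ oA) : Cand N G r0 s0 C' oA oB c := by
  obtain ⟨π, hC, hπ⟩ := hp.perm
  have hmem : ∀ i < c, oA ≤ π (oA + i) ∧ π (oA + i) < oA + c := fun i hi =>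
    perm_mem_of_fix hπ (i := oA + i) ⟨by omega, by omega⟩
  refine h.congr (f := fun i => π (oA + i) - oA) ?_ ?_ ?_ ?_
  · intro i hi
    have := hmem i hi
    omega
  · intro i hi i' hi' he
    have h1 := hmem i hi
    have h2 := hmem i' hi'
    have := π.injective (show π (oA + i) = π (oA + i') by
      have he : π (oA + i) - oA = π (oA + i') - oA := he
      omega)
    omega
  · intro i hi
    have := hmem i hi
    rw [hC, Function.comp, Nat.add_sub_cancel' this.1]
  · intro i hi
    exact hp.eq_of_not_mem (by omega)

/-- An isomorphism preserves `P`, so it maps the candidates with `P` on one side injectively to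
candidates with `P` on the other. Applied in both directions, this shows that unequal counts rule
out an isomorphism. -/
theorem Cand.le_of_sim {r0 s0 oA oB c e e' : ℕ} {C : ℕ → ℕ} {P : ℕ → Prop} (hG : Sys d N G)
    (hr : r0 < N) (hs : s0 < N) (h : Cand N G r0 s0 C oA oB c)
    (hP : ∀ x y, SameRel G x y → (P x ↔ P y)) (he : e ≤ c)
    (hA : ∀ i < e, P (C (oA + i))) (hB : ∀ i, e' ≤ i → i < c → ¬ P (C (oB + i)))
    (hsim : Sim G r0 s0) : e ≤ e' := by
  obtain ⟨l0, hl0⟩ := hsim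
  have hex : ∀ i < e, ∃ i' < e', SameRel G (C (oA + i)) (C (oB + i')) ∧
      ∃ l, C (oA + i) = act G l r0 ∧ C (oB + i') = act G l (act G l0 s0) := by
    intro i hi
    have h1 := h.memA i (by omega)
    obtain ⟨l, hl⟩ := (hG.mem_orb hr).1 h1
    have h2 := hl0.act l
    have h3 : act G l (act G l0 s0) ∈ orb G N s0 := (hG.mem_orb hs).2 ⟨l0 ++ l, by simp⟩
    obtain ⟨i', hi', he'⟩ := (h.iff _ (hl ▸ h1) _ h3 h2).1 ⟨i, by omega, hl.symm⟩
    refine ⟨i', ?_, by rwa [he', ← hl], l, hl.symm, he'⟩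
    by_contra hc
    apply hB i' (by omega) hi'
    rw [he', ← hP _ _ h2, hl]
    exact hA i hi
  choose! f hf hfs hfl using hex
  have := Finset.card_le_card_of_injOn (s := Finset.range e) (t := Finset.range e') f
    (fun i hi => by simpa using hf i (by simpa using hi))
    (fun i hi i' hi' hff => by
      have hi : i < e := by simpa using hi
      have hi' : i' < e := by simpa using hi'
      obtain ⟨l, h1, h2⟩ := hfl i hi
      obtain ⟨l', h1', h2'⟩ := hfl i' hi'
      rw [hff, h2'] at h2
      exact h.injA i (by omega) i' (by omega) (by rw [h1, h1', (hl0 l l').2 h2.symm]))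
  simpa using this

/-- Because `P` is invariant under isomorphisms, the correspondence between candidates restricts to
those with `P`. -/
theorem Cand.head {r0 s0 oA oB c e : ℕ} {C : ℕ → ℕ} {P : ℕ → Prop}
    (h : Cand N G r0 s0 C oA oB c) (hP : ∀ x y, SameRel G x y → (P x ↔ P y)) (he : e ≤ c)
    (hA : ∀ i < e, P (C (oA + i))) (hA' : ∀ i, e ≤ i → i < c → ¬ P (C (oA + i)))
    (hB : ∀ i < e, P (C (oB + i))) (hB' : ∀ i, e ≤ i → i < c → ¬ P (C (oB + i)))
    (h0 : 0 < e) : Cand N G r0 s0 C oA oB e := by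
  refine ⟨h0, fun i hi i' hi' => h.injA i (by omega) i' (by omega),
    fun i hi i' hi' => h.injB i (by omega) i' (by omega), fun i hi => h.memA i (by omega),
    fun i hi => h.memB i (by omega), fun x hx y hy hxy => ⟨?_, ?_⟩⟩
  · rintro ⟨i, hi, rfl⟩
    obtain ⟨i', hi', rfl⟩ := (h.iff _ hx y hy hxy).1 ⟨i, by omega, rfl⟩
    refine ⟨i', ?_, rfl⟩
    by_contra hc
    exact hB' i' (by omega) hi' ((hP _ _ hxy).1 (hA i hi))
  · rintro ⟨i, hi, rfl⟩
    obtain ⟨i', hi', rfl⟩ := (h.iff _ hx _ hy hxy).2 ⟨i, by omega, rfl⟩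
    refine ⟨i', ?_, rfl⟩
    by_contra hc
    exact hA' i' (by omega) hi' ((hP _ _ hxy).2 (hB i hi))

/-- The same restriction for the candidates outside `P`, which occupy the places from `e` on. -/
theorem Cand.tail {r0 s0 oA oB c e : ℕ} {C : ℕ → ℕ} {P : ℕ → Prop}
    (h : Cand N G r0 s0 C oA oB c) (hP : ∀ x y, SameRel G x y → (P x ↔ P y))
    (hA : ∀ i < e, P (C (oA + i))) (hA' : ∀ i, e ≤ i → i < c → ¬ P (C (oA + i)))
    (hB : ∀ i < e, P (C (oB + i))) (hB' : ∀ i, e ≤ i → i < c → ¬ P (C (oB + i)))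
    (h0 : e < c) : Cand N G r0 s0 C (oA + e) (oB + e) (c - e) := by
  refine ⟨by omega, fun i hi i' hi' he => ?_, fun i hi i' hi' he => ?_, fun i hi => ?_,
    fun i hi => ?_, fun x hx y hy hxy => ⟨?_, ?_⟩⟩
  · rw [Nat.add_assoc, Nat.add_assoc] at he
    have := h.injA _ (by omega) _ (by omega) he
    omega
  · rw [Nat.add_assoc, Nat.add_assoc] at he
    have := h.injB _ (by omega) _ (by omega) he
    omega
  · rw [Nat.add_assoc]; exact h.memA _ (by omega)
  · rw [Nat.add_assoc]; exact h.memB _ (by omega)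
  · rintro ⟨i, hi, rfl⟩
    rw [Nat.add_assoc] at hx hxy
    obtain ⟨i', hi', rfl⟩ := (h.iff _ hx y hy hxy).1 ⟨e + i, by omega, rfl⟩
    have : e ≤ i' := by
      by_contra hc
      exact hA' (e + i) (by omega) (by omega) ((hP _ _ hxy).2 (hB i' (by omega)))
    exact ⟨i' - e, by omega, by rw [Nat.add_assoc, Nat.add_sub_cancel' this]⟩
  · rintro ⟨i, hi, rfl⟩
    rw [Nat.add_assoc] at hy hxy
    obtain ⟨i', hi', rfl⟩ := (h.iff _ hx _ hy hxy).2 ⟨e + i, by omega, rfl⟩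
    have : e ≤ i' := by
      by_contra hc
      exact hB' (e + i) (by omega) (by omega) ((hP _ _ hxy).1 (hA i' (by omega)))
    exact ⟨i' - e, by omega, by rw [Nat.add_assoc, Nat.add_sub_cancel' this]⟩

theorem wp_copyQueue {σ : HS} (hZ : σ.o + σ.tl + 1 < Z) :
    wp Z copyQueue (fun σ' => ∃ i C tm, σ' = { σ with i := i, C := C, tm := tm } ∧
      (∀ q < σ.tl, C (σ.o + q) = σ.qu q) ∧
      (∀ q, ¬ (σ.o ≤ q ∧ q < σ.o + σ.tl) → C q = σ.C q) ∧ tm ≤ σ.tm + 3 * σ.tl + 2) σ := by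
  simp only [copyQueue, Cmd.block]
  simp
  refine ⟨by omega, ?_⟩
  refine wp_loop (fun σ' => ∃ i C tm, σ' = { σ with i := i, C := C, tm := tm } ∧ i ≤ σ.tl ∧
      (∀ q < i, C (σ.o + q) = σ.qu q) ∧
      (∀ q, ¬ (σ.o ≤ q ∧ q < σ.o + σ.tl) → C q = σ.C q) ∧ tm ≤ σ.tm + 3 * i + 1)
    (fun σ' => σ.tl - σ'.i) ?_
    ⟨_, _, _, rfl, Nat.zero_le _, by simp, fun _ _ => rfl, by simp⟩
  rintro _ ⟨i, C, tm, rfl, hi, h1, h2, htm⟩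
  simp
  refine ⟨fun hlt => ?_, fun hge => ?_⟩
  · refine ⟨by omega, by omega, by omega, ⟨by omega, by omega⟩, ⟨⟨by omega, ?_, ?_, by omega⟩,
      by omega⟩⟩
    · intro q hq
      rcases Nat.lt_or_eq_of_le hq with hq | rfl
      · rw [Function.update_of_ne (by omega), h1 q hq]
      · simp
    · intro q hq
      rw [Function.update_of_ne (by omega), h2 q (by omega)]
  · exact ⟨fun q hq => h1 q (by omega), fun q hq => h2 q (by omega), by omega⟩

/-- A word splits the candidates according to whether it closes up. -/
def Agree (d : ℕ) (G : ℕ → ℕ → ℕ) (cs₁ cs₂ : List ℕ) (y : ℕ) : Prop :=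
  act G (flat d cs₁) y = act G (flat d cs₂) y

/-- The two words are the path to `cx` followed by the letter `cj`, and the path to `cv`; both lead
from `r` to `cv`. Each path has at most `tl / κ + 1` codes, and the letter contributes one more. -/
theorem wp_conflictWords (hG : Ctx d N S Z κ G) {σ : HS} {r s : ℕ} {L : ℕ → List ℕ} (hr : r < N)
    (h : BfsPost d N S κ G r s σ.tl σ.ok σ.cx σ.cj σ.cv σ.qu σ.top σ.code L) (hok : σ.ok ≠ 1) :
    wp Z conflictWords (fun σ' => ∃ x k k1 buf tm cs₁ cs₂,
      σ' = { σ with x := x, k := k, k1 := k1, buf := buf, tm := tm } ∧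
      Words S { σ with x := x, k := k, k1 := k1, buf := buf, tm := tm } cs₁ cs₂ ∧ k < Z ∧
      cs₁.length + cs₂.length ≤ 2 * (σ.tl / κ) + 3 ∧
      Agree d G cs₁ cs₂ r ∧ ¬ Agree d G cs₁ cs₂ s ∧
      tm ≤ σ.tm + 8 * (σ.tl / κ) + 20) σ := by
  have hZ := hG.lt_Z
  have hNd : N * d + 10 * N + 100 < Z := by rw [Nat.mul_add] at hZ; omega
  have hdS := hG.d_lt
  have hSZ : S < Z := by
    have := hG.code_le
    have : S * 1 ≤ S * (d + 1) := Nat.mul_le_mul_left _ (by omega)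
    omega
  have hquN : ∀ i < σ.tl, σ.qu i < N := fun i hi =>
    hG.reach_lt hr ((hG.mem_orb hr).1 (h.mem_orb i hi))
  have hquZ : ∀ i < σ.tl, σ.qu i < Z := fun i hi => by have := hquN i hi; omega
  have htl : σ.tl ≤ N := by
    rw [h.card]
    exact card_orb_le
  obtain ⟨i, hi, i', hi', hcx, hcv, hj, hjd, hG1, hG2⟩ := h.conflict hok
  have hlen : ∀ i < σ.tl, (L (σ.qu i)).length ≤ σ.tl / κ + 1 := by
    intro i hi
    have h1 := h.toTree.length_le hi
    rw [← Nat.add_div_right _ hG.κ_pos, Nat.le_div_iff_mul_le hG.κ_pos]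
    omega
  have hκ : σ.tl / κ ≤ σ.tl := Nat.div_le_self _ _
  have hl1 := hlen i hi
  have hl2 := hlen i' hi'
  have hr1 := h.reach i hi
  have hr2 := h.reach i' hi'
  simp [conflictWords]
  refine ⟨by omega, by omega, ?_⟩
  refine wp_mono (wp_ext (d := d) (κ := κ) (G := G) (r := r) (tl := σ.tl) (L := L) (i := i)
    (lo := 0) (cs := [σ.cj]) (S := S) ?_ hi ?_ ?_ ?_ ?_ ?_) ?_
  · exact h.toTree
  · exact hcx
  · exact ⟨by simp, by omega, trivial⟩
  · rfl
  · simp; omega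
  · exact hquZ
  rintro _ ⟨x, k, buf, tm, rfl, hseg, hk, hbuf, htm⟩
  simp at hk htm ⊢
  refine wp_mono (wp_ext (d := d) (κ := κ) (G := G) (r := r) (tl := σ.tl) (L := L) (i := i')
    (lo := k) (cs := []) (S := S) ?_ hi' ?_ ?_ ?_ ?_ ?_) ?_
  · exact h.toTree
  · exact hcv
  · trivial
  · rfl
  · simp; omega
  · exact hquZ
  rintro _ ⟨x', k', buf', tm', rfl, hseg', hk', hbuf', htm'⟩
  simp at hk' htm' ⊢
  refine ⟨L (σ.qu i) ++ [σ.cj], L (σ.qu i'), ⟨?_, ?_, ?_, ?_⟩, by omega, ?_, ?_, ?_, by omega⟩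
  · exact hseg.congr fun q _ hq => hbuf' q (by simp at hq ⊢; omega)
  · simpa using hk
  · simpa using hseg'
  · exact hk'
  · simp; omega
  · rw [Agree, flat_append, flat_singleton, word_letter hG.d_pos hj hjd, act_append, hr1, hr2]
    exact hG1
  · rw [Agree, flat_append, flat_singleton, word_letter hG.d_pos hj hjd, act_append]
    exact hG2

end

/-! ### Correctness and running time of the isomorphism test. -/

section

/-- The variables and arrays that the isomorphism test does not touch. -/
structure Kept (σ σ' : HS) : Prop where
  n : σ'.n = σ.n
  N : σ'.N = σ.N
  S : σ'.S = σ.S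
  v : σ'.v = σ.v
  R : σ'.R = σ.R
  m : σ'.m = σ.m
  t : σ'.t = σ.t
  found : σ'.found = σ.found
  r0 : σ'.r0 = σ.r0
  s0 : σ'.s0 = σ.s0
  tab : σ'.tab = σ.tab
  vis : σ'.vis = σ.vis
  rep : σ'.rep = σ.rep
  rsz : σ'.rsz = σ.rsz
  cnt : σ'.cnt = σ.cnt

theorem Kept.trans {σ σ' σ'' : HS} (h : Kept σ σ') (h' : Kept σ' σ'') : Kept σ σ'' := by
  constructor
  · rw [h'.n, h.n]
  · rw [h'.N, h.N]
  · rw [h'.S, h.S]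
  · rw [h'.v, h.v]
  · rw [h'.R, h.R]
  · rw [h'.m, h.m]
  · rw [h'.t, h.t]
  · rw [h'.found, h.found]
  · rw [h'.r0, h.r0]
  · rw [h'.s0, h.s0]
  · rw [h'.tab, h.tab]
  · rw [h'.vis, h.vis]
  · rw [h'.rep, h.rep]
  · rw [h'.rsz, h.rsz]
  · rw [h'.cnt, h.cnt]

variable {d N S Z κ : ℕ} {G : ℕ → ℕ → ℕ}

theorem Kept.std {σ σ' : HS} (h : Kept σ σ') (hσ : Std d N S G σ) : Std d N S G σ' :=
  ⟨by rw [h.N, hσ.N_eq], by rw [h.S, hσ.S_eq], by rw [h.tab]; exact hσ.tab⟩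

structure PairInv (N : ℕ) (G : ℕ → ℕ → ℕ) (σ : HS) : Prop where
  phi : ∀ x < N, σ.phi x = 0
  cand : Cand N G σ.r0 σ.s0 σ.C σ.oA σ.oB σ.c
  leA : σ.oA + σ.c ≤ N
  geB : N ≤ σ.oB
  leB : σ.oB + σ.c ≤ 2 * N

theorem agree_iff {cs₁ cs₂ : List ℕ} (x y : ℕ) (h : SameRel G x y) :
    Agree d G cs₁ cs₂ x ↔ Agree d G cs₁ cs₂ y := h _ _

theorem Parted.exists_eq {P : ℕ → Prop} {o c e m : ℕ} {C C' : ℕ → ℕ}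
    (h : Parted P o c e C C' m) {i : ℕ} (hi : i < c) : ∃ i' < c, C' (o + i') = C (o + i) := by
  obtain ⟨π, rfl, hπ⟩ := h.perm
  have hs : ∀ i, ¬ (o ≤ i ∧ i < o + c) → π.symm i = i := fun i hi => by
    rw [Equiv.symm_apply_eq, hπ i hi]
  have h1 := perm_mem_of_fix hs (i := o + i) ⟨by omega, by omega⟩
  exact ⟨π.symm (o + i) - o, by omega, by
    rw [Nat.add_sub_cancel' h1.1, Function.comp, Equiv.apply_symm_apply]⟩

theorem wp_pairBody (hG : Ctx d N S Z κ G) {σ : HS} (hσ : Std d N S G σ) (hr0 : σ.r0 < N)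
    (hs0 : σ.s0 < N) (hcard : (orb G N σ.r0).card = (orb G N σ.s0).card) (h : PairInv N G σ)
    (hres : σ.res = 2) :
    wp Z (pairBody d) (fun σ' => Kept σ σ' ∧
      (σ'.res = 2 → PairInv N G σ' ∧ 2 * σ'.c ≤ σ.c) ∧
      (σ'.res ≠ 2 → (∀ x < N, σ'.phi x = 0) ∧
        (σ'.res = 1 ∧ Sim G σ.r0 σ.s0 ∨ σ'.res = 0 ∧ ¬ Sim G σ.r0 σ.s0)) ∧
      σ'.tm ≤ σ.tm + ((21 * d + 100) * (orb G N σ.r0).card +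
        σ.c * (12 * ((orb G N σ.r0).card / κ) + 58))) σ := by
  have hZ := hG.lt_Z
  have hNd : N * d + 10 * N + 100 < Z := by rw [Nat.mul_add] at hZ; omega
  have hc := h.cand
  have hA0 := hc.memA 0 hc.pos
  have hB0 := hc.memB 0 hc.pos
  have hra := (hG.mem_orb hr0).1 hA0
  have hrb := (hG.mem_orb hs0).1 hB0
  have hrN := hG.reach_lt hr0 hra
  have hsN := hG.reach_lt hs0 hrb
  have horA := hG.orb_eq hr0 hra
  have horB := hG.orb_eq hs0 hrb
  rw [Nat.add_zero] at hra hrb hrN hsN horA horB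
  have hleA := h.leA
  have hgeB := h.geB
  have hleB := h.leB
  have hpos := hc.pos
  set m := (orb G N σ.r0).card with hm
  have hm1 : 0 < m := Finset.card_pos.2 ⟨_, hG.self_mem_orb hr0⟩
  have hκm : m / κ ≤ m := Nat.div_le_self _ _
  simp [pairBody]
  refine ⟨by omega, by omega, ?_⟩
  refine wp_mono (wp_bfs hG ?_ ?_ ?_ ?_) ?_
  · exact ⟨hσ.N_eq, hσ.S_eq, hσ.tab⟩
  · exact hrN
  · exact hsN
  · exact h.phi
  rintro _ ⟨p, tl, ok, x, y, j, xx, yy, cx, cj, cv, i, qu, phi, top, code, tm, L, rfl, hphi, hpost,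
    htm⟩
  have hpost' : BfsPost d N S κ G (σ.C σ.oA) (σ.C σ.oB) tl ok cx cj cv qu top code L := hpost
  have htl : tl = m := by rw [hpost'.card, horA]
  simp at htm ⊢
  have hmul : (21 * d + 100) * m = (21 * d + 20) * m + 80 * m := by ring
  rw [htl] at htm
  refine ⟨by omega, fun hok => ?_, fun hok => ?_⟩
  · refine ⟨by omega, ⟨rfl, rfl, rfl, rfl, rfl, rfl, rfl, rfl, rfl, rfl, rfl, rfl, rfl, rfl, rfl⟩,
      ⟨hphi, ?_⟩, by omega⟩
    -- A search without conflict gives a homomorphism, which the equal sizes turn into an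
    -- isomorphism.
    have h1 := hG.sameRel_of_hom hrN hsN (hpost'.hom hok) (by rw [horA, horB]; exact hcard)
    exact ((hG.sim_of_reach hr0 hra).trans h1.sim).trans
      (hG.sim_symm hsN (hG.sim_of_reach hs0 hrb))
  refine wp_mono (wp_conflictWords hG (r := σ.C σ.oA) (s := σ.C σ.oB) (L := L) hrN ?_ hok) ?_
  · exact hpost'
  rintro _ ⟨x, k, k1, buf, tm', cs₁, cs₂, rfl, hw, hk, hlen, hagA, hagB, htm'⟩
  simp at htm' hlen hk ⊢
  rw [htl] at htm' hlen
  have hCA : ∀ i < σ.c, σ.C (σ.oA + i) < N := fun i hi =>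
    hG.reach_lt hr0 ((hG.mem_orb hr0).1 (hc.memA i hi))
  have hCB : ∀ i < σ.c, σ.C (σ.oB + i) < N := fun i hi =>
    hG.reach_lt hs0 ((hG.mem_orb hs0).1 (hc.memB i hi))
  refine wp_mono (wp_part hG (cs₁ := cs₁) (cs₂ := cs₂) ?_ ?_ ?_ ?_ ?_) ?_
  · exact ⟨hσ.N_eq, hσ.S_eq, hσ.tab⟩
  · exact ⟨hw.seg₁, hw.k1, hw.seg₂, hw.k⟩
  · exact hk
  · exact hCA
  · simp; omega
  rintro _ ⟨q, e1, y, lo, i, z, z1, C₁, tm₁, rfl, hp₁, htm₁⟩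
  simp at htm₁ hp₁ ⊢
  refine wp_mono (wp_part hG (cs₁ := cs₁) (cs₂ := cs₂) ?_ ?_ ?_ ?_ ?_) ?_
  · exact ⟨hσ.N_eq, hσ.S_eq, hσ.tab⟩
  · exact ⟨hw.seg₁, hw.k1, hw.seg₂, hw.k⟩
  · exact hk
  · intro i hi
    simp at hi ⊢
    rw [hp₁.eq_of_not_mem (by omega)]
    exact hCB i hi
  · simp; omega
  rintro _ ⟨q, e, y, lo, i, z, z1, C₂, tm₂, rfl, hp₂, htm₂⟩
  simp at htm₂ hp₂ ⊢
  have hcand : Cand N G σ.r0 σ.s0 C₂ σ.oA σ.oB σ.c :=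
    ((hc.parted hp₁ (by omega)).symm.parted hp₂ (by omega)).symm
  have hP := fun x y => agree_iff (d := d) (G := G) (cs₁ := cs₁) (cs₂ := cs₂) x y
  have hA1 : ∀ i < e1, Agree d G cs₁ cs₂ (C₂ (σ.oA + i)) := fun i hi => by
    have := hp₁.le
    rw [hp₂.eq_of_not_mem (by omega)]
    exact hp₁.yes i hi
  have hA2 : ∀ i, e1 ≤ i → i < σ.c → ¬ Agree d G cs₁ cs₂ (C₂ (σ.oA + i)) := fun i hi hi' => by
    rw [hp₂.eq_of_not_mem (by omega)]
    exact hp₁.no i hi hi'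
  have hB1 : ∀ i < e, Agree d G cs₁ cs₂ (C₂ (σ.oB + i)) := hp₂.yes
  have hB2 : ∀ i, e ≤ i → i < σ.c → ¬ Agree d G cs₁ cs₂ (C₂ (σ.oB + i)) := hp₂.no
  have he1 := hp₁.le
  have he := hp₂.le
  -- Both words together have at most `2 * (m / κ) + 3` codes, which gives `3 * (2 * (m / κ) + 3) +
  -- 20 = 6 * (m / κ) + 29` per candidate and side.
  have hcost : σ.c * (3 * (cs₁.length + cs₂.length) + 20) ≤ σ.c * (6 * (m / κ) + 29) :=
    Nat.mul_le_mul_left _ (by omega)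
  have hcost' : σ.c * (12 * (m / κ) + 58) = 2 * (σ.c * (6 * (m / κ) + 29)) := by ring
  -- The candidate `C oA`, from which the search started, agrees.
  have he0 : 0 < e1 := by
    obtain ⟨i, hi, hCi⟩ := hp₁.exists_eq (i := 0) hpos
    by_contra hcon
    apply hp₁.no i (by omega) hi
    rw [hCi]
    exact hagA
  -- The candidate `C oB`, its tentative image, disagrees. So if `e1 = e`, neither class is empty,
  -- and keeping the smaller one at least halves the candidates.
  have hec : e < σ.c := by
    obtain ⟨i, hi, hCi⟩ := hp₂.exists_eq (i := 0) hpos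
    rw [hp₁.eq_of_not_mem (by omega)] at hCi
    by_contra hcon
    apply hagB
    have := hp₂.yes i (by omega)
    rw [hCi] at this
    exact this
  refine ⟨fun hne => ?_, fun heq => ⟨by omega, fun hle => ?_, fun hgt => ?_⟩⟩
  · refine ⟨by omega, ⟨rfl, rfl, rfl, rfl, rfl, rfl, rfl, rfl, rfl, rfl, rfl, rfl, rfl, rfl, rfl⟩,
      ⟨hphi, fun hsim => hne ?_⟩, by omega⟩
    exact le_antisymm (hcand.le_of_sim hG.toSys hr0 hs0 hP he1 hA1 hB2 hsim)
      (hcand.symm.le_of_sim hG.toSys hs0 hr0 hP he hB1 hA2 (hG.sim_symm hs0 hsim))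
  · subst heq
    exact ⟨⟨rfl, rfl, rfl, rfl, rfl, rfl, rfl, rfl, rfl, rfl, rfl, rfl, rfl, rfl, rfl⟩,
      fun _ => ⟨⟨hphi, hcand.head hP he hA1 hA2 hB1 hB2 he0, by simp; omega, hgeB,
        by simp; omega⟩, by omega⟩, fun hcon => absurd hres hcon, by omega⟩
  · subst heq
    refine ⟨by omega, by omega, ⟨rfl, rfl, rfl, rfl, rfl, rfl, rfl, rfl, rfl, rfl, rfl, rfl, rfl,
      rfl, rfl⟩, fun _ => ⟨⟨hphi, hcand.tail hP hA1 hA2 hB1 hB2 hec, by simp; omega,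
        by simp; omega, by simp; omega⟩, by omega⟩, fun hcon => absurd hres hcon, by omega⟩

/-- The first summand pays for one search per halving of the candidates and for the set-up. In the
second, the factor `2` sums the geometric series of the evaluation costs. -/
def pairCost (d κ m : ℕ) : ℕ :=
  (21 * d + 101) * m * (Nat.log 2 m + 5) + 2 * (m * (12 * (m / κ) + 58)) + 50

theorem wp_pair (hG : Ctx d N S Z κ G) {σ : HS} (hσ : Std d N S G σ) (hr0 : σ.r0 < N)
    (hs0 : σ.s0 < N) (hcard : (orb G N σ.r0).card = (orb G N σ.s0).card)
    (hphi0 : ∀ x < N, σ.phi x = 0) :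
    wp Z (pair d) (fun σ' => Kept σ σ' ∧ (∀ x < N, σ'.phi x = 0) ∧
      (σ'.res = 1 ∧ Sim G σ.r0 σ.s0 ∨ σ'.res = 0 ∧ ¬ Sim G σ.r0 σ.s0) ∧
      σ'.tm ≤ σ.tm + pairCost d κ (orb G N σ.r0).card) σ := by
  have hZ := hG.lt_Z
  have hNd : N * d + 10 * N + 100 < Z := by rw [Nat.mul_add] at hZ; omega
  set m := (orb G N σ.r0).card with hm
  have hm1 : 0 < m := Finset.card_pos.2 ⟨_, hG.self_mem_orb hr0⟩
  have hmN : m ≤ N := card_orb_le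
  have hNe := hσ.N_eq
  simp [pair]
  refine wp_mono (wp_bfs hG ?_ ?_ ?_ ?_) ?_
  · exact ⟨hσ.N_eq, hσ.S_eq, hσ.tab⟩
  · exact hr0
  · exact hr0
  · exact hphi0
  rintro _ ⟨p, tl, ok, x, y, j, xx, yy, cx, cj, cv, i, qu, phi, top, code, tm, L, rfl, hphi, hpost,
    htm⟩
  have hpost : BfsPost d N S κ G σ.r0 σ.r0 tl ok cx cj cv qu top code L := hpost
  obtain rfl : tl = m := hpost.card
  simp at htm ⊢
  refine ⟨by omega, ?_⟩
  refine wp_mono (wp_copyQueue ?_) ?_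
  · simp; omega
  rintro _ ⟨i', C, tm', rfl, hC, hC', htm'⟩
  simp at htm' hC hC' ⊢
  refine wp_mono (wp_bfs hG ?_ ?_ ?_ ?_) ?_
  · exact ⟨hσ.N_eq, hσ.S_eq, hσ.tab⟩
  · exact hs0
  · exact hs0
  · exact hphi
  rintro _ ⟨p', tl', ok', x', y', j', xx', yy', cx', cj', cv', i'', qu', phi', top', code', tm₁, L',
    rfl, hphi', hpost', htm₁⟩
  have hpost' : BfsPost d N S κ G σ.s0 σ.s0 tl' ok' cx' cj' cv' qu' top' code' L' := hpost'
  obtain rfl : tl' = m := hpost'.card.trans hcard.symm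
  simp at htm₁ ⊢
  refine wp_mono (wp_copyQueue ?_) ?_
  · simp; omega
  rintro _ ⟨i₂, C₂, tm₂, rfl, hD, hD', htm₂⟩
  simp at htm₂ hD hD' ⊢
  refine ⟨by omega, by omega, ?_⟩
  have hCm : ∀ i < m, C₂ i = qu i := fun i hi => by rw [hD' i (by omega), hC i hi]
  rw [hNe] at hD
  have hcand : Cand N G σ.r0 σ.s0 C₂ 0 N m := by
    refine ⟨hm1, ?_, ?_, ?_, ?_, ?_⟩
    · intro i hi i' hi' he
      rw [Nat.zero_add, Nat.zero_add, hCm i hi, hCm i' hi'] at he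
      exact hpost.inj i hi i' hi' he
    · intro i hi i' hi' he
      rw [hD i hi, hD i' hi'] at he
      exact hpost'.inj i hi i' hi' he
    · intro i hi
      rw [Nat.zero_add, hCm i hi]; exact hpost.mem_orb i hi
    · intro i hi
      rw [hD i hi]; exact hpost'.mem_orb i hi
    · intro x hx y hy _
      obtain ⟨i, hi, he⟩ := hpost.exists_qu x hx
      obtain ⟨i', hi', he'⟩ := hpost'.exists_qu y hy
      exact ⟨fun _ => ⟨i', hi', by rw [hD i' hi', he']⟩,
        fun _ => ⟨i, hi, by rw [Nat.zero_add, hCm i hi, he]⟩⟩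
  -- The right side is a potential: halving `c` lowers the logarithmic term by the cost of one
  -- search and the linear term by the cost of the evaluations.
  have hcost : ∀ c : ℕ, 0 < c → ∀ c', 2 * c' ≤ c → 0 < c' →
      (21 * d + 101) * m * (Nat.log 2 c' + 1) + 2 * (c' * (12 * (m / κ) + 58)) +
        ((21 * d + 100) * m + c * (12 * (m / κ) + 58)) + 1 ≤
      (21 * d + 101) * m * (Nat.log 2 c + 1) + 2 * (c * (12 * (m / κ) + 58)) := by
    intro c hc c' hcc hc'
    have h1 : Nat.log 2 c' + 1 ≤ Nat.log 2 c := by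
      rw [← Nat.log_mul_base (by omega) (by omega)]
      exact Nat.log_mono_right (by omega)
    have h2 : (21 * d + 101) * m * (Nat.log 2 c' + 1) ≤ (21 * d + 101) * m * Nat.log 2 c :=
      Nat.mul_le_mul_left _ h1
    have h3 : 2 * c' * (12 * (m / κ) + 58) ≤ c * (12 * (m / κ) + 58) := Nat.mul_le_mul_right _ hcc
    have h4 : (21 * d + 101) * m = (21 * d + 100) * m + m := by ring
    nlinarith
  refine wp_loop (fun σ' => Kept σ σ' ∧ (∀ x < N, σ'.phi x = 0) ∧
      (σ'.res = 2 → PairInv N G σ' ∧ σ'.tm +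
        ((21 * d + 101) * m * (Nat.log 2 σ'.c + 1) + 2 * (σ'.c * (12 * (m / κ) + 58))) + 1 ≤
          σ.tm + pairCost d κ m) ∧
      (σ'.res ≠ 2 → (σ'.res = 1 ∧ Sim G σ.r0 σ.s0 ∨ σ'.res = 0 ∧ ¬ Sim G σ.r0 σ.s0) ∧
        σ'.tm + 1 ≤ σ.tm + pairCost d κ m))
    (fun σ' => if σ'.res = 2 then σ'.c + 1 else 0) ?_ ?_
  · rintro σ' ⟨hk, hphi, h2, hn2⟩
    refine ⟨by simp, by simp; omega, fun hc => ?_, fun hc => ?_⟩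
    · simp at hc
      obtain ⟨hinv, htm⟩ := h2 hc
      have hcpos := hinv.cand.pos
      refine wp_mono (wp_pairBody hG ?_ ?_ ?_ ?_ ?_ ?_) ?_
      · have := hk.std hσ
        exact ⟨this.N_eq, this.S_eq, this.tab⟩
      · simp [hk.r0, hr0]
      · simp [hk.s0, hs0]
      · change (orb G N σ'.r0).card = (orb G N σ'.s0).card
        rw [hk.r0, hk.s0]; exact hcard
      · exact ⟨hinv.phi, hinv.cand, hinv.leA, hinv.geB, hinv.leB⟩
      · exact hc
      rintro σ'' ⟨hk', h2', hn2', htm'⟩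
      simp [hk.r0, hk.s0, ← hm] at htm' hn2' h2'
      have hk'' : Kept σ σ'' := hk.trans ⟨hk'.1, hk'.2, hk'.3, hk'.4, hk'.5, hk'.6, hk'.7, hk'.8,
        hk'.9, hk'.10, hk'.11, hk'.12, hk'.13, hk'.14, hk'.15⟩
      rw [if_pos hc]
      by_cases hres : σ''.res = 2
      · obtain ⟨hinv', hcc⟩ := h2' hres
        have hcpos' := hinv'.cand.pos
        have := hcost σ'.c hcpos σ''.c hcc hcpos'
        rw [if_pos hres]
        exact ⟨⟨hk'', hinv'.phi, fun _ => ⟨hinv', by omega⟩, fun h => absurd hres h⟩, by omega⟩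
      · obtain ⟨h3, h4⟩ := hn2' hres
        rw [if_neg hres]
        refine ⟨⟨hk'', h3, fun h => absurd h hres, fun _ => ⟨h4, ?_⟩⟩, by omega⟩
        have h4 : (21 * d + 101) * m = (21 * d + 100) * m + m := by ring
        have h5 : (21 * d + 101) * m * (Nat.log 2 σ'.c + 1) =
          (21 * d + 101) * m + (21 * d + 101) * m * Nat.log 2 σ'.c := by ring
        omega
    · simp at hc
      simp
      obtain ⟨h3, h4⟩ := hn2 hc
      exact ⟨⟨hk.1, hk.2, hk.3, hk.4, hk.5, hk.6, hk.7, hk.8, hk.9, hk.10, hk.11, hk.12, hk.13,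
        hk.14, hk.15⟩, hphi, h3, by omega⟩
  · refine ⟨⟨rfl, rfl, rfl, rfl, rfl, rfl, rfl, rfl, rfl, rfl, rfl, rfl, rfl, rfl, rfl⟩, hphi',
      fun _ => ⟨⟨hphi', ?_, ?_, ?_, ?_⟩, ?_⟩, fun h => absurd rfl h⟩
    · simpa [hNe] using hcand
    · simpa using hmN
    · simp [hNe]
    · simp [hNe]; omega
    · have h5 : (21 * d + 101) * m * (Nat.log 2 m + 5) =
          (21 * d + 101) * m * (Nat.log 2 m + 1) + 4 * ((21 * d + 101) * m) := by ring
      have h6 : (21 * d + 101) * m = (21 * d + 20) * m + 81 * m := by ring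
      simp only [pairCost]
      omega

end

section

/-! The table of the actions of all codes. -/

/-- The loop finds the least `S ≥ d + 1` with `n ≤ S * S`. With about `√n` codes the table has order
`n ^ (3/2)` entries, and still covers words of logarithmic length. -/
def tableSize (d : ℕ) : Cmd := block [
  asg .N (.var .n + .var .n),
  asg .S (.lit (d + 1)),
  .loop .lt (.var .S * .var .S) (.var .n) (asg .S (.var .S + 1))]

/-- Codes are treated in increasing order: `0` is the identity, `1, …, d` come from the input (with
the points of `b` shifted by `n`), and a larger code acts as `x / (d + 1)` followed by its last
digit, both of which are smaller codes. -/
def tableBody (d : ℕ) : Cmd := block [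
  asg .x (.var .i / .var .N),
  asg .y (.var .i % .var .N),
  ite .eq (.var .x) 0 (sto .tab (.var .i) (.var .y))
    (ite .le (.var .x) (.lit d)
      (ite .lt (.var .y) (.var .n)
        (sto .tab (.var .i) (.idx .inp ((.var .x - 1) * .var .n + .var .y)))
        (sto .tab (.var .i) (.var .n +
          .idx .inp (.lit d * .var .n + ((.var .x - 1) * .var .n + (.var .y - .var .n))))))
      (sto .tab (.var .i) (.idx .tab (.var .x % .lit (d + 1) * .var .N +
        .idx .tab (.var .x / .lit (d + 1) * .var .N + .var .y))))),
  asg .i (.var .i + 1)]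

def table (d : ℕ) : Cmd := block [
  asg .i 0,
  .loop .lt (.var .i) (.var .S * .var .N) (tableBody d)]

/-- The memory bound for inputs of size `n`. -/
def memSize (d n : ℕ) : ℕ := (2 * n + 2 * d + 10) * (2 * n + 2 * d + 10)

/-- The length of the words that the table covers. -/
def blockLen (d n : ℕ) : ℕ := Nat.log (d + 1) (max (d + 1) (Nat.sqrt n))

variable {d N S Z κ n : ℕ} {G : ℕ → ℕ → ℕ}

/-- The block length satisfies `(d + 1) ^ κ ≤ max (d + 1) √n ≤ S`; the maximum makes `κ` positive
also for small `n`. -/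
theorem Ctx.of_sys (hd : 0 < d) (hG : Sys d (2 * n) G) (hS1 : d + 1 ≤ S) (hS2 : n ≤ S * S)
    (hS3 : S ≤ n + d + 1) : Ctx d (2 * n) S (memSize d n) (blockLen d n) G := by
  refine ⟨hG, hd, ?_, ?_, ?_, ?_, ?_⟩
  · exact Nat.log_pos (by omega) (le_max_left _ _)
  · refine (Nat.pow_log_le_self _ (by omega)).trans (max_le hS1 ?_)
    exact (Nat.sqrt_le_sqrt hS2).trans_eq (Nat.sqrt_eq S)
  · simp only [memSize]; nlinarith
  · simp only [memSize]; nlinarith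
  · simp only [memSize]; nlinarith

theorem wp_tableSize {σ : HS} :
    wp (memSize d σ.n) (tableSize d) (fun σ' => ∃ S tm,
      σ' = { σ with N := 2 * σ.n, S := S, tm := tm } ∧ d + 1 ≤ S ∧ σ.n ≤ S * S ∧
      S ≤ σ.n + d + 1 ∧ S ≤ d + 1 + (Nat.sqrt σ.n + 1) ∧ tm ≤ σ.tm + 2 * S + 5) σ := by
  have hb : ∀ S, S ≤ σ.n + d + 1 → S * S < memSize d σ.n ∧ S + 1 < memSize d σ.n := by
    intro S hS
    simp only [memSize]
    constructor <;> nlinarith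
  have hb1 : σ.n + σ.n < memSize d σ.n := by simp only [memSize]; nlinarith
  have hb2 := (hb (d + 1) (by omega)).2
  simp only [tableSize, Cmd.block]
  simp
  refine ⟨by omega, by omega, ?_⟩
  refine wp_loop (fun σ' => ∃ S tm, σ' = { σ with N := 2 * σ.n, S := S, tm := tm } ∧
      d + 1 ≤ S ∧ (S = d + 1 ∨ (S - 1) * (S - 1) < σ.n) ∧ tm ≤ σ.tm + 2 * S + 2)
    (fun σ' => σ.n - (σ'.S - 1)) ?_ ⟨d + 1, _, by rw [two_mul], le_rfl, Or.inl rfl, by simp⟩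
  rintro _ ⟨S, tm, rfl, h1, h2, htm⟩
  have hSn : S ≤ σ.n + d + 1 := by
    rcases h2 with h2 | h2
    · omega
    · by_contra hcon
      have : σ.n * 1 ≤ (S - 1) * (S - 1) := Nat.mul_le_mul (by omega) (by omega)
      omega
  refine ⟨by simp; exact (hb S hSn).1, by simp, fun hc => ?_, fun hc => ?_⟩
  · simp at hc ⊢
    have h3 := hb S hSn
    have h4 : S * 1 ≤ S * S := Nat.mul_le_mul_left _ (by omega)
    refine ⟨⟨by omega, by omega⟩, ⟨by omega, by omega⟩, by omega⟩
  · simp at hc ⊢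
    refine ⟨h1, hc, hSn, ?_, by omega⟩
    rcases h2 with h2 | h2
    · omega
    · have : S - 1 ≤ Nat.sqrt σ.n := by rw [Nat.le_sqrt]; exact h2.le
      omega

theorem word_eq (hd : 0 < d) {c : ℕ} (hc : c ≠ 0) :
    word d c = word d (c / (d + 1)) ++ [c % (d + 1)] := by
  rw [word, word, Nat.digits_def' (by omega) (by omega), List.reverse_cons]

/-- A digit `0` may occur in a code. The letter `0` and the code `0` both act trivially, so the
recursion of the table holds for all non-zero codes. -/
theorem Sys.act_word (hG : Sys d N G) (hd : 0 < d) {c : ℕ} (hc : c ≠ 0) (y : ℕ) :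
    act G (word d c) y = act G (word d (c % (d + 1))) (act G (word d (c / (d + 1))) y) := by
  rw [word_eq hd hc, act_append, act_cons, act_nil]
  by_cases h0 : c % (d + 1) = 0
  · rw [h0, word_zero, act_nil, hG.triv 0 _ (by omega)]
  · have := Nat.mod_lt c (show d + 1 > 0 by omega)
    rw [word_letter (d := d) (j := c % (d + 1)) hd (by omega) (by omega)]
    rfl

/-- The input arrays describe `G`. -/
def InputOk (d n : ℕ) (G : ℕ → ℕ → ℕ) (inp : ℕ → ℕ) : Prop :=
  ∀ j, 1 ≤ j → j ≤ d → ∀ y < 2 * n,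
    (y < n → inp ((j - 1) * n + y) = G j y) ∧
    (n ≤ y → n + inp (d * n + ((j - 1) * n + (y - n))) = G j y)

theorem wp_table {σ : HS} (hG : Ctx d (2 * σ.n) σ.S Z κ G) (hN : σ.N = 2 * σ.n)
    (hZ : 2 * (d * σ.n) ≤ Z) (hSZ : σ.S * (2 * σ.n) + 1 < Z) (hinp : InputOk d σ.n G σ.inp) :
    wp Z (table d) (fun σ' => ∃ i x y tab tm,
      σ' = { σ with i := i, x := x, y := y, tab := tab, tm := tm } ∧
      (∀ c < σ.S, ∀ y < 2 * σ.n, tab (c * (2 * σ.n) + y) = act G (word d c) y) ∧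
      tm ≤ σ.tm + 10 * (σ.S * (2 * σ.n)) + 2) σ := by
  have hd := hG.d_pos
  have hltZ := hG.lt_Z
  have hNd : 2 * σ.n * d + 10 * (2 * σ.n) + 100 < Z := by rw [Nat.mul_add] at hltZ; omega
  have hdZ : d + 1 < Z := by have := hG.code_le; omega
  have hdS := hG.d_lt
  simp only [table, Cmd.block]
  simp
  refine ⟨by omega, ?_⟩
  refine wp_loop (fun σ' => ∃ i x y tab tm,
      σ' = { σ with i := i, x := x, y := y, tab := tab, tm := tm } ∧ i ≤ σ.S * (2 * σ.n) ∧
      (∀ i' < i, tab i' = act G (word d (i' / (2 * σ.n))) (i' % (2 * σ.n))) ∧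
      tm ≤ σ.tm + 10 * i + 1) (fun σ' => σ.S * (2 * σ.n) - σ'.i) ?_
    ⟨_, _, _, _, _, rfl, Nat.zero_le _, fun _ h => absurd h (Nat.not_lt_zero _), by simp⟩
  rintro _ ⟨i, x, y, tab, tm, rfl, hi, htab, htm⟩
  refine ⟨by simp, by simp [hN]; omega, fun hc => ?_, fun hc => ?_⟩
  · simp [hN] at hc
    have hN0 : 0 < 2 * σ.n := by
      by_contra h0
      rw [Nat.eq_zero_of_not_pos h0] at hc
      omega
    have hx : i / (2 * σ.n) < σ.S := by rw [Nat.div_lt_iff_lt_mul hN0]; exact hc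
    have hy := Nat.mod_lt i hN0
    have hdm := Nat.div_add_mod' i (2 * σ.n)
    set x := i / (2 * σ.n) with hxdef
    set y := i % (2 * σ.n) with hydef
    clear_value x y
    have hstep : ∀ v, v = act G (word d x) y → ∀ i' < i + 1, Function.update tab i v i' =
        act G (word d (i' / (2 * σ.n))) (i' % (2 * σ.n)) := by
      intro v hv i' hi'
      rcases Nat.lt_or_eq_of_le (Nat.lt_succ_iff.1 hi') with hlt | rfl
      · rw [Function.update_of_ne (by omega)]; exact htab i' hlt
      · rw [Function.update_self, hv, ← hxdef, ← hydef]
    have hget : ∀ c y', c < x → y' < 2 * σ.n → c * (2 * σ.n) + y' < i ∧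
        tab (c * (2 * σ.n) + y') = act G (word d c) y' := by
      intro c y' hcx hy'
      have h1 : (c + 1) * (2 * σ.n) ≤ x * (2 * σ.n) := Nat.mul_le_mul_right _ hcx
      rw [Nat.add_mul] at h1
      have h2 : c * (2 * σ.n) + y' < i := by omega
      refine ⟨h2, ?_⟩
      have h3 : (c * (2 * σ.n) + y') / (2 * σ.n) = c := by
        rw [Nat.add_comm, Nat.add_mul_div_right _ _ hN0, Nat.div_eq_of_lt hy', Nat.zero_add]
      have h4 : (c * (2 * σ.n) + y') % (2 * σ.n) = y' := by
        rw [Nat.mul_add_mod', Nat.mod_eq_of_lt hy']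
      rw [htab _ h2, h3, h4]
    simp [tableBody, hN, ← hxdef, ← hydef]
    refine ⟨by omega, fun hx0 => ?_, fun hx0 => ⟨by omega, fun hxd => ⟨fun hyn => ?_, fun hyn => ?_⟩,
      fun hxd => ?_⟩⟩
    · have h1 := hstep y (by rw [hx0, word_zero, act_nil])
      exact ⟨by omega, ⟨by omega, by omega⟩,
        ⟨by omega, fun i' hi' => h1 i' (Nat.lt_succ_of_le hi'), by omega⟩, by omega⟩
    · have h1 := hstep (σ.inp ((x - 1) * σ.n + y)) (by
        rw [(hinp x (by omega) hxd y hy).1 hyn, word_letter hd (by omega) hxd]; rfl)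
      have h2 : (x - 1 + 1) * σ.n ≤ d * σ.n := Nat.mul_le_mul_right _ (by omega)
      rw [Nat.add_mul] at h2
      exact ⟨⟨⟨by omega, by omega⟩, by omega⟩, by omega, ⟨by omega, by omega⟩,
        ⟨by omega, fun i' hi' => h1 i' (Nat.lt_succ_of_le hi'), by omega⟩, by omega⟩
    · have h0 := (hinp x (by omega) hxd y hy).2 hyn
      have h1 := hstep (σ.n + σ.inp (d * σ.n + ((x - 1) * σ.n + (y - σ.n)))) (by
        rw [h0, word_letter hd (by omega) hxd]; rfl)
      have h2 : (x - 1 + 1) * σ.n ≤ d * σ.n := Nat.mul_le_mul_right _ (by omega)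
      rw [Nat.add_mul] at h2
      have h3 := hG.lt x y hy
      rw [h0]
      rw [h0] at h1
      repeat' apply And.intro
      all_goals first | exact fun i' hi' => h1 i' (Nat.lt_succ_of_le hi') | omega
    · have hlt : x / (d + 1) < x := Nat.div_lt_self (by omega) (by omega)
      have hlt' : x % (d + 1) < x := (Nat.mod_lt x (by omega)).trans_le hxd
      obtain ⟨h2, h3⟩ := hget _ y hlt hy
      have h4 := hG.act_lt hy (word d (x / (d + 1)))
      obtain ⟨h5, h6⟩ := hget _ _ hlt' h4
      rw [h3, h6, ← hG.act_word hd hx0]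
      have h1 := hstep _ rfl
      repeat' apply And.intro
      all_goals first | exact fun i' hi' => h1 i' (Nat.lt_succ_of_le hi') | omega
  · simp [hN] at hc ⊢
    refine ⟨fun c hc' y hy => ?_, by omega⟩
    have h1 : (c + 1) * (2 * σ.n) ≤ σ.S * (2 * σ.n) := Nat.mul_le_mul_right _ hc'
    rw [Nat.add_mul] at h1
    rw [htab _ (by omega), Nat.mul_add_mod', Nat.mod_eq_of_lt hy, Nat.add_comm,
      Nat.add_mul_div_right _ _ (by omega), Nat.div_eq_of_lt hy, Nat.zero_add]

end

section

/-! Classification of the components. -/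

/-- Account for a component of size `m` that is isomorphic to the `t`-th representative. -/
def addCnt : Cmd := ite .lt (.var .v) (.var .n)
  (sto .cnt (.var .t) (.idx .cnt (.var .t) + .var .m))
  (sto .cnt (.var .t) (.idx .cnt (.var .t) - .var .m))

def scanBody (d : ℕ) : Cmd := block [
  ite .eq (.idx .rsz (.var .t)) (.var .m)
    (block [asg .r0 (.idx .rep (.var .t)), pair d,
      ite .eq (.var .res) 1 (block [asg .found 1, addCnt]) skip])
    skip,
  asg .t (.var .t + 1)]

def mark : Cmd := block [
  asg .i 0,
  .loop .lt (.var .i) (.var .tl)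
    (block [sto .vis (.idx .qu (.var .i)) 1, asg .i (.var .i + 1)])]

/-- A new count starts at `N` instead of `0`, so that truncated subtraction is exact. -/
def component (d : ℕ) : Cmd := block [
  asg .r (.var .v), asg .s (.var .v), bfs d, asg .m (.var .tl), mark,
  asg .s0 (.var .v), asg .found 0, asg .t 0,
  .loop .lt (.var .t) (.var .R) (scanBody d),
  ite .eq (.var .found) 0 (block [
    sto .rep (.var .R) (.var .v), sto .rsz (.var .R) (.var .m), sto .cnt (.var .R) (.var .N),
    addCnt, asg .R (.var .R + 1)]) skip]

def classify (d : ℕ) : Cmd := block [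
  asg .v 0, asg .R 0,
  .loop .lt (.var .v) (.var .N)
    (block [ite .eq (.idx .vis (.var .v)) 0 (component d) skip, asg .v (.var .v + 1)])]

def verdict : Cmd := block [
  asg .found 1, asg .t 0,
  .loop .lt (.var .t) (.var .R) (block [
    ite .ne (.idx .cnt (.var .t)) (.var .N) (asg .found 0) skip,
    asg .t (.var .t + 1)]),
  asg .n (.var .found)]

variable {d N S Z κ n : ℕ} {G : ℕ → ℕ → ℕ}

/-- The variables and arrays that the search for an isomorphic representative does not touch. -/
structure Fixed (σ σ' : HS) : Prop where
  n : σ'.n = σ.n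
  N : σ'.N = σ.N
  S : σ'.S = σ.S
  v : σ'.v = σ.v
  R : σ'.R = σ.R
  m : σ'.m = σ.m
  s0 : σ'.s0 = σ.s0
  tab : σ'.tab = σ.tab
  vis : σ'.vis = σ.vis
  rep : σ'.rep = σ.rep
  rsz : σ'.rsz = σ.rsz

theorem Fixed.trans {σ σ' σ'' : HS} (h : Fixed σ σ') (h' : Fixed σ' σ'') : Fixed σ σ'' := by
  constructor
  · rw [h'.n, h.n]
  · rw [h'.N, h.N]
  · rw [h'.S, h.S]
  · rw [h'.v, h.v]
  · rw [h'.R, h.R]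
  · rw [h'.m, h.m]
  · rw [h'.s0, h.s0]
  · rw [h'.tab, h.tab]
  · rw [h'.vis, h.vis]
  · rw [h'.rep, h.rep]
  · rw [h'.rsz, h.rsz]

theorem Fixed.std {σ σ' : HS} (h : Fixed σ σ') (hσ : Std d N S G σ) : Std d N S G σ' :=
  ⟨by rw [h.N, hσ.N_eq], by rw [h.S, hσ.S_eq], by rw [h.tab]; exact hσ.tab⟩

def updCnt (n v m c : ℕ) : ℕ := if v < n then c + m else c - m

/-- Representatives of another size are dismissed by comparing sizes, without an isomorphism test.
-/
def scanCost (d κ m k : ℕ) : ℕ := 10 + if k = m then pairCost d κ m else 0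

theorem wp_scanBody (hG : Ctx d N S Z κ G) {σ : HS} (hσ : Std d N S G σ) (hv : σ.v < N)
    (hs0 : σ.s0 = σ.v) (hm : σ.m = (orb G N σ.v).card) (hphi : ∀ x < N, σ.phi x = 0)
    (hrep : σ.rep σ.t < N) (hrsz : σ.rsz σ.t = (orb G N (σ.rep σ.t)).card) (ht : σ.t < N)
    (hcnt : σ.cnt σ.t ≤ 3 * N) :
    wp Z (scanBody d) (fun σ' => Fixed σ σ' ∧ σ'.t = σ.t + 1 ∧ (∀ x < N, σ'.phi x = 0) ∧
      (Sim G (σ.rep σ.t) σ.v → σ'.found = 1 ∧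
        σ'.cnt = Function.update σ.cnt σ.t (updCnt σ.n σ.v σ.m (σ.cnt σ.t))) ∧
      (¬ Sim G (σ.rep σ.t) σ.v → σ'.found = σ.found ∧ σ'.cnt = σ.cnt) ∧
      σ'.tm + 1 ≤ σ.tm + scanCost d κ σ.m (σ.rsz σ.t)) σ := by
  have hZ := hG.lt_Z
  have hNd : N * d + 10 * N + 100 < Z := by rw [Nat.mul_add] at hZ; omega
  have hmN : σ.m ≤ N := hm ▸ card_orb_le
  simp [scanBody, scanCost]
  refine ⟨by omega, fun heq => ⟨by omega, ?_⟩, fun hne => ?_⟩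
  · refine wp_mono (wp_pair hG ?_ ?_ ?_ ?_ ?_) ?_
    · exact ⟨hσ.N_eq, hσ.S_eq, hσ.tab⟩
    · exact hrep
    · exact hs0 ▸ hv
    · change (orb G N (σ.rep σ.t)).card = (orb G N σ.s0).card
      rw [hs0, ← hm, ← heq, hrsz]
    · exact hphi
    rintro σ' ⟨hk, hphi', hres, htm⟩
    have k1 := hk.n
    have k2 := hk.v
    have k3 := hk.m
    have k4 := hk.t
    have k5 := hk.cnt
    have k6 := hk.found
    simp at htm hres k1 k2 k3 k4 k5 k6
    rw [← hrsz, heq] at htm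
    rw [hs0] at hres
    have hF : Fixed σ σ' := ⟨hk.n, hk.N, hk.S, hk.v, hk.R, hk.m, hk.s0, hk.tab, hk.vis, hk.rep,
      hk.rsz⟩
    simp only [if_pos heq]
    simp [addCnt, k1, k2, k3, k4, k5, k6]
    refine ⟨by omega, fun h1 => ⟨by omega, fun hlt => ?_, fun hge => ?_⟩, fun h1 => ?_⟩
    · have hsim : Sim G (σ.rep σ.t) σ.v := by
        rcases hres with h | h
        · exact h.2
        · rw [h1] at h; exact absurd h.1 (by omega)
      refine ⟨⟨by omega, by omega⟩, by omega, ⟨by omega, by omega⟩, ⟨rfl, hF.2, hF.3, rfl, hF.5, rfl, hF.7,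
        hF.8, hF.9, hF.10, hF.11⟩, hphi', fun _ => ?_, fun h => absurd hsim h, by omega⟩
      rw [updCnt, if_pos hlt]
    · have hsim : Sim G (σ.rep σ.t) σ.v := by
        rcases hres with h | h
        · exact h.2
        · rw [h1] at h; exact absurd h.1 (by omega)
      refine ⟨by omega, ⟨by omega, by omega⟩, ⟨rfl, hF.2, hF.3, rfl, hF.5, rfl, hF.7,
        hF.8, hF.9, hF.10, hF.11⟩, hphi', fun _ => ?_, fun h => absurd hsim h, by omega⟩
      rw [updCnt, if_neg (by omega)]
    · have hsim : ¬ Sim G (σ.rep σ.t) σ.v := by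
        rcases hres with h | h
        · exact absurd h.1 h1
        · exact h.2
      exact ⟨⟨by omega, by omega⟩, ⟨rfl, hF.2, hF.3, rfl, hF.5, rfl, hF.7,
        hF.8, hF.9, hF.10, hF.11⟩, hphi', fun h => absurd h hsim, by omega⟩
  · simp only [if_neg hne]
    refine ⟨⟨by omega, by omega⟩, ⟨rfl, rfl, rfl, rfl, rfl, rfl, rfl, rfl, rfl, rfl, rfl⟩, hphi,
      fun hsim => ?_, by omega⟩
    exact absurd (by rw [hrsz, hm, hG.card_orb_of_sim hrep hv hsim]) hne

theorem wp_scan (hG : Ctx d N S Z κ G) {σ : HS} (hσ : Std d N S G σ) (hv : σ.v < N)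
    (hs0 : σ.s0 = σ.v) (hm : σ.m = (orb G N σ.v).card) (hphi : ∀ x < N, σ.phi x = 0)
    (hR : σ.R ≤ N) (hrep : ∀ t < σ.R, σ.rep t < N)
    (hrsz : ∀ t < σ.R, σ.rsz t = (orb G N (σ.rep t)).card) (hcnt : ∀ t < σ.R, σ.cnt t ≤ 3 * N)
    (ht : σ.t = 0) (hf : σ.found = 0) :
    wp Z (.loop .lt (.var .t) (.var .R) (scanBody d)) (fun σ' => Fixed σ σ' ∧ σ'.t = σ.R ∧
      (∀ x < N, σ'.phi x = 0) ∧
      (σ'.found ≠ 0 ∧ (∃ t < σ.R, Sim G (σ.rep t) σ.v) ∨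
        σ'.found = 0 ∧ ∀ t < σ.R, ¬ Sim G (σ.rep t) σ.v) ∧
      (∀ t < σ.R, (Sim G (σ.rep t) σ.v → σ'.cnt t = updCnt σ.n σ.v σ.m (σ.cnt t)) ∧
        (¬ Sim G (σ.rep t) σ.v → σ'.cnt t = σ.cnt t)) ∧
      σ'.tm ≤ σ.tm + ∑ t ∈ Finset.range σ.R, scanCost d κ σ.m (σ.rsz t) + 1) σ := by
  refine wp_loop (fun σ' => Fixed σ σ' ∧ σ'.t ≤ σ.R ∧
      (∀ x < N, σ'.phi x = 0) ∧
      (σ'.found ≠ 0 ∧ (∃ t < σ'.t, Sim G (σ.rep t) σ.v) ∨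
        σ'.found = 0 ∧ ∀ t < σ'.t, ¬ Sim G (σ.rep t) σ.v) ∧
      (∀ t < σ'.t, (Sim G (σ.rep t) σ.v → σ'.cnt t = updCnt σ.n σ.v σ.m (σ.cnt t)) ∧
        (¬ Sim G (σ.rep t) σ.v → σ'.cnt t = σ.cnt t)) ∧
      (∀ t, σ'.t ≤ t → σ'.cnt t = σ.cnt t) ∧
      σ'.tm ≤ σ.tm + ∑ t ∈ Finset.range σ'.t, scanCost d κ σ.m (σ.rsz t))
    (fun σ' => σ.R - σ'.t) ?_ ?_
  · rintro σ' ⟨hF, ht', hphi', hfound, hc1, hc2, htm⟩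
    refine ⟨by simp, by simp, fun hc => ?_, fun hc => ?_⟩
    · simp [hF.R] at hc
      refine wp_mono (wp_scanBody hG ?_ ?_ ?_ ?_ ?_ ?_ ?_ ?_ ?_) ?_
      · have := hF.std hσ
        exact ⟨this.N_eq, this.S_eq, this.tab⟩
      · simp [hF.v, hv]
      · simp [hF.v, hF.s0, hs0]
      · simp [hF.v, hF.m, hm]
      · exact hphi'
      · simp [hF.rep]; exact hrep _ hc
      · simp [hF.rep, hF.rsz]; exact hrsz _ hc
      · simp; omega
      · simp [hc2]; exact hcnt _ hc
      rintro σ'' ⟨hF', ht'', hphi'', hs, hns, htm''⟩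
      simp [hF.n, hF.rep, hF.v, hF.m, hF.rsz, hc2] at ht'' hs hns htm''
      have hF'' : Fixed σ σ'' := hF.trans ⟨hF'.1, hF'.2, hF'.3, hF'.4, hF'.5, hF'.6, hF'.7, hF'.8,
        hF'.9, hF'.10, hF'.11⟩
      refine ⟨⟨hF'', by omega, hphi'', ?_, ?_, ?_, ?_⟩, by omega⟩
      · by_cases hsim : Sim G (σ.rep σ'.t) σ.v
        · exact Or.inl ⟨by rw [(hs hsim).1]; omega, σ'.t, by omega, hsim⟩
        · rw [(hns hsim).1]
          rcases hfound with ⟨h1, t, h2, h3⟩ | ⟨h1, h2⟩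
          · exact Or.inl ⟨h1, t, by omega, h3⟩
          · refine Or.inr ⟨h1, fun t h3 => ?_⟩
            rw [ht''] at h3
            rcases Nat.lt_succ_iff_lt_or_eq.1 h3 with h3 | rfl
            · exact h2 t h3
            · exact hsim
      · intro t h3
        rw [ht''] at h3
        rcases Nat.lt_succ_iff_lt_or_eq.1 h3 with h3 | rfl
        · by_cases hsim : Sim G (σ.rep σ'.t) σ.v
          · rw [(hs hsim).2, Function.update_of_ne (by omega)]
            exact hc1 t h3
          · rw [(hns hsim).2]
            exact hc1 t h3
        · refine ⟨fun hsim => ?_, fun hsim => ?_⟩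
          · rw [(hs hsim).2, Function.update_self]
          · rw [(hns hsim).2, hc2 _ le_rfl]
      · intro t h3
        by_cases hsim : Sim G (σ.rep σ'.t) σ.v
        · rw [(hs hsim).2, Function.update_of_ne (by omega)]
          exact hc2 t (by omega)
        · rw [(hns hsim).2]
          exact hc2 t (by omega)
      · rw [ht'', Finset.sum_range_succ]
        omega
    · simp [hF.R] at hc
      have hte : σ'.t = σ.R := by omega
      rw [hte] at hfound hc1 htm
      exact ⟨⟨hF.1, hF.2, hF.3, hF.4, hF.5, hF.6, hF.7, hF.8, hF.9, hF.10, hF.11⟩, hte, hphi',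
        hfound, hc1, by simp; omega⟩
  · exact ⟨⟨rfl, rfl, rfl, rfl, rfl, rfl, rfl, rfl, rfl, rfl, rfl⟩, by omega, hphi,
      Or.inr ⟨hf, by omega⟩, by omega, fun _ _ => rfl, by simp⟩

theorem wp_mark {σ : HS} (hq : ∀ i < σ.tl, σ.qu i < N) (hN : N + 1 < Z) (htl : σ.tl ≤ N) :
    wp Z mark (fun σ' => ∃ i vis tm, σ' = { σ with i := i, vis := vis, tm := tm } ∧
      (∀ x, vis x ≠ 0 ↔ σ.vis x ≠ 0 ∨ ∃ i < σ.tl, σ.qu i = x) ∧ tm ≤ σ.tm + 3 * σ.tl + 2) σ := by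
  simp only [mark, Cmd.block]
  simp
  refine ⟨by omega, ?_⟩
  refine wp_loop (fun σ' => ∃ i vis tm, σ' = { σ with i := i, vis := vis, tm := tm } ∧ i ≤ σ.tl ∧
      (∀ x, vis x ≠ 0 ↔ σ.vis x ≠ 0 ∨ ∃ i' < i, σ.qu i' = x) ∧ tm ≤ σ.tm + 3 * i + 1)
    (fun σ' => σ.tl - σ'.i) ?_ ⟨_, _, _, rfl, Nat.zero_le _, by simp, by simp⟩
  rintro _ ⟨i, vis, tm, rfl, hi, h1, htm⟩
  refine ⟨by simp, by simp, fun hc => ?_, fun hc => ?_⟩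
  · simp at hc
    have := hq i hc
    simp
    refine ⟨by omega, by omega, by omega, ⟨by omega, by omega⟩, ⟨by omega, fun x => ?_, by omega⟩,
      by omega⟩
    have h1x := h1 x
    by_cases hx : x = σ.qu i
    · subst hx
      simp only [Function.update_self]
      exact ⟨fun _ => Or.inr ⟨i, by omega, rfl⟩, fun _ => by omega⟩
    · rw [Function.update_of_ne hx]
      simp only [ne_eq] at h1x
      rw [h1x]
      refine or_congr_right ⟨fun ⟨i', h2, h3⟩ => ⟨i', by omega, h3⟩, fun ⟨i', h2, h3⟩ => ⟨i', ?_, h3⟩⟩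
      rcases Nat.lt_or_eq_of_le h2 with h2 | rfl
      · omega
      · exact absurd h3.symm hx
  · simp at hc ⊢
    obtain rfl : i = σ.tl := by omega
    exact ⟨by simpa using h1, by omega⟩

end

/-! ### Processing one component. -/

section

variable {d N S Z κ n : ℕ} {G : ℕ → ℕ → ℕ}

/-- The effect of processing the unvisited component of `v`. -/
structure CompPost (d N κ : ℕ) (G : ℕ → ℕ → ℕ) (σ σ' : HS) : Prop where
  n_eq : σ'.n = σ.n
  N_eq : σ'.N = σ.N
  S_eq : σ'.S = σ.S
  v_eq : σ'.v = σ.v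
  tab_eq : σ'.tab = σ.tab
  phi_eq : ∀ x < N, σ'.phi x = 0
  vis_iff : ∀ x < N, σ'.vis x ≠ 0 ↔ σ.vis x ≠ 0 ∨ Reach G σ.v x
  rep_cases : (∃ t < σ.R, Sim G (σ.rep t) σ.v) ∧ σ'.R = σ.R ∧ σ'.rep = σ.rep ∧ σ'.rsz = σ.rsz ∨
    (∀ t < σ.R, ¬ Sim G (σ.rep t) σ.v) ∧ σ'.R = σ.R + 1 ∧
      σ'.rep = Function.update σ.rep σ.R σ.v ∧
      σ'.rsz = Function.update σ.rsz σ.R (orb G N σ.v).card ∧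
      σ'.cnt σ.R = updCnt σ.n σ.v (orb G N σ.v).card N
  cnt_eq : ∀ t < σ.R,
    (Sim G (σ.rep t) σ.v → σ'.cnt t = updCnt σ.n σ.v (orb G N σ.v).card (σ.cnt t)) ∧
    (¬ Sim G (σ.rep t) σ.v → σ'.cnt t = σ.cnt t)
  tm_le : σ'.tm ≤ σ.tm + (21 * d + 23) * (orb G N σ.v).card +
    ∑ t ∈ Finset.range σ.R, scanCost d κ (orb G N σ.v).card (σ.rsz t) + 17

theorem wp_component (hG : Ctx d N S Z κ G) {σ : HS} (hσ : Std d N S G σ) (hv : σ.v < N)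
    (hphi : ∀ x < N, σ.phi x = 0) (hR : σ.R ≤ N) (hrep : ∀ t < σ.R, σ.rep t < N)
    (hrsz : ∀ t < σ.R, σ.rsz t = (orb G N (σ.rep t)).card) (hcnt : ∀ t < σ.R, σ.cnt t ≤ 3 * N) :
    wp Z (component d) (CompPost d N κ G σ) σ := by
  have hZ := hG.lt_Z
  have hNd : N * d + 10 * N + 100 < Z := by rw [Nat.mul_add] at hZ; omega
  have hNe := hσ.N_eq
  simp only [component, Cmd.block]
  simp
  refine wp_mono (wp_bfs hG ?_ ?_ ?_ ?_) ?_
  · exact ⟨hσ.N_eq, hσ.S_eq, hσ.tab⟩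
  · exact hv
  · exact hv
  · exact hphi
  rintro _ ⟨p, tl, ok, x, y, j, xx, yy, cx, cj, cv, i, qu, phi, top, code, tm, L, rfl, hphi', hpost, htm⟩
  simp at htm
  have hmN : (orb G N σ.v).card ≤ N := card_orb_le
  have hcard : tl = (orb G N σ.v).card := hpost.card
  have hmem : ∀ i < tl, qu i ∈ orb G N σ.v := hpost.mem_orb
  have hex : ∀ x ∈ orb G N σ.v, ∃ i < tl, qu i = x := hpost.exists_qu
  simp
  refine wp_mono (wp_mark (N := N) ?_ ?_ ?_) ?_
  · exact fun i hi => hG.reach_lt hv ((hG.mem_orb hv).1 (hmem i hi))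
  · omega
  · simp; omega
  rintro _ ⟨i', vis, tm', rfl, hvis, htm'⟩
  simp at htm' hvis
  simp
  refine ⟨by omega, ?_⟩
  refine wp_mono (wp_scan hG ?_ ?_ ?_ ?_ ?_ ?_ ?_ ?_ ?_ ?_ ?_) ?_
  · exact ⟨hσ.N_eq, hσ.S_eq, hσ.tab⟩
  · exact hv
  · rfl
  · exact hcard
  · exact hphi'
  · exact hR
  · exact hrep
  · exact hrsz
  · exact hcnt
  · rfl
  · rfl
  rintro σ' ⟨hF, ht, hphi'', hfound, hcnt', htm''⟩
  obtain ⟨f1, f2, f3, f4, f5, f6, f7, f8, f9, f10, f11⟩ := hF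
  simp at f1 f2 f3 f4 f5 f6 f7 f8 f9 f10 f11 ht hfound hcnt' htm''
  rw [hcard] at htm'' htm f6 hcnt'
  have hvis' : ∀ x < N, σ'.vis x ≠ 0 ↔ σ.vis x ≠ 0 ∨ Reach G σ.v x := by
    intro x hx
    rw [f9]
    simp only [ne_eq]
    rw [hvis]
    refine or_congr_right ⟨?_, fun h => hex x ((hG.mem_orb hv).2 h)⟩
    rintro ⟨i, hi, rfl⟩
    exact (hG.mem_orb hv).1 (hmem i hi)
  simp [addCnt]
  have hmul : (21 * d + 23) * (orb G N σ.v).card =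
      (21 * d + 20) * (orb G N σ.v).card + 3 * (orb G N σ.v).card := by ring
  refine ⟨by omega, fun h0 => ⟨by omega, fun hlt => ?_, fun hge => ?_⟩, fun h1 => ?_⟩
  · rw [ht, f5, Function.update_self]
    refine ⟨⟨by omega, by omega⟩, by omega, ⟨by omega, by omega⟩, f1, f2, f3, f4, f8, hphi'', hvis',
      Or.inr ⟨?_, ?_, ?_, ?_, ?_⟩, fun t ht' => ?_, ?_⟩
    · rcases hfound with h | h
      · exact absurd h0 h.1
      · exact h.2
    · rfl
    · simp [f10, f4]
    · simp [f11, f6]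
    · simp only [Function.update_self]
      rw [updCnt, if_pos (by omega), f2, f6, hNe]
    · simp only [Function.update_of_ne (show t ≠ σ.R by omega)]
      exact hcnt' t ht'
    · simp only
      omega
  · rw [ht, f5, Function.update_self]
    refine ⟨by omega, ⟨by omega, by omega⟩, f1, f2, f3, f4, f8, hphi'', hvis',
      Or.inr ⟨?_, ?_, ?_, ?_, ?_⟩, fun t ht' => ?_, ?_⟩
    · rcases hfound with h | h
      · exact absurd h0 h.1
      · exact h.2
    · rfl
    · simp [f10, f4]
    · simp [f11, f6]
    · simp only [Function.update_self]
      rw [updCnt, if_neg (by omega), f2, f6, hNe]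
    · simp only [Function.update_of_ne (show t ≠ σ.R by omega)]
      exact hcnt' t ht'
    · simp only
      omega
  · refine ⟨f1, f2, f3, f4, f8, hphi'', hvis', Or.inl ⟨?_, f5, f10, f11⟩, hcnt', ?_⟩
    · rcases hfound with h | h
      · exact h.2
      · exact absurd h.1 h1
    · simp only
      omega

end

/-! ### Invariant and amortised cost of the classification. -/

section

variable {d N S Z κ n : ℕ} {G : ℕ → ℕ → ℕ}

/-- The cost, per point, of testing a component with `m` points for isomorphism. -/
def weight (κ m : ℕ) : ℕ := m / κ + Nat.log 2 m + 1

theorem weight_pos (κ m : ℕ) : 0 < weight κ m := Nat.succ_pos _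

theorem pairCost_le {m : ℕ} (hm : 0 < m) :
    pairCost d κ m ≤ m * ((105 * d + 800) * weight κ m) := by
  have h1 : Nat.log 2 m + 5 ≤ 5 * weight κ m := by
    unfold weight; generalize m / κ = q; omega
  have h2 : 12 * (m / κ) + 58 ≤ 70 * weight κ m := by
    unfold weight; generalize m / κ = q; omega
  have h3 : 1 ≤ m * weight κ m := Nat.mul_pos hm (weight_pos _ _)
  calc pairCost d κ m = (21*d+101)*m*(Nat.log 2 m+5)+2*(m*(12*(m/κ)+58))+50 := rfl
    _ ≤ (21*d+101)*m*(5 * weight κ m)+2*(m*(70 * weight κ m))+50 * (m * weight κ m) := by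
        gcongr
        omega
    _ ≤ m * ((105 * d + 800) * weight κ m) := by nlinarith

/-- `B` bounds the total weight of any family of pairwise non-isomorphic components. -/
def WeightLe (N κ : ℕ) (G : ℕ → ℕ → ℕ) (B : ℕ) : Prop :=
  ∀ T : Finset ℕ, T ⊆ Finset.range N → (∀ x ∈ T, ∀ y ∈ T, Sim G x y → x = y) →
    ∑ x ∈ T, weight κ (orb G N x).card ≤ B

/-- A test takes place only for a representative of size `k = m`, where `m * weight κ m` equals `m *
weight κ k`. So each representative costs at most a multiple of `m` times its own weight, and the
weights add up to at most `B`. -/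
theorem sum_scanCost_le {B m R : ℕ} {rep rsz : ℕ → ℕ} (hB : WeightLe N κ G B) (hm : 0 < m)
    (hrep : ∀ t < R, rep t < N) (hrsz : ∀ t < R, rsz t = (orb G N (rep t)).card)
    (hsep : ∀ t < R, ∀ t' < R, Sim G (rep t) (rep t') → t = t') :
    ∑ t ∈ Finset.range R, scanCost d κ m (rsz t) ≤ m * ((105 * d + 810) * B) := by
  have hinj : Set.InjOn rep (Finset.range R) := fun t ht t' ht' h =>
    hsep t (by simpa using ht) t' (by simpa using ht') (h ▸ Sim.refl _)
  have hsum : ∑ t ∈ Finset.range R, weight κ (rsz t) ≤ B := by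
    have h1 := hB ((Finset.range R).image rep) ?_ ?_
    · rw [Finset.sum_image hinj] at h1
      refine (Finset.sum_le_sum fun t ht => ?_).trans h1
      rw [hrsz t (Finset.mem_range.1 ht)]
    · intro x hx
      obtain ⟨t, ht, rfl⟩ := Finset.mem_image.1 hx
      exact Finset.mem_range.2 (hrep t (Finset.mem_range.1 ht))
    · intro x hx y hy hxy
      obtain ⟨t, ht, rfl⟩ := Finset.mem_image.1 hx
      obtain ⟨t', ht', rfl⟩ := Finset.mem_image.1 hy
      rw [hsep t (Finset.mem_range.1 ht) t' (Finset.mem_range.1 ht') hxy]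
  have hone : ∀ k, scanCost d κ m k ≤ m * (105 * d + 810) * weight κ k := by
    intro k
    have h3 : 1 ≤ m * weight κ k := Nat.mul_pos hm (weight_pos _ _)
    unfold scanCost
    split_ifs with hk
    · subst hk
      have := pairCost_le (d := d) (κ := κ) hm
      nlinarith
    · nlinarith [Nat.zero_le (m * (105 * d + 800) * weight κ k)]
  calc _ ≤ ∑ t ∈ Finset.range R, m * (105 * d + 810) * weight κ (rsz t) :=
        Finset.sum_le_sum fun t _ => hone _
    _ = m * (105 * d + 810) * ∑ t ∈ Finset.range R, weight κ (rsz t) := by rw [Finset.mul_sum]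
    _ ≤ m * (105 * d + 810) * B := Nat.mul_le_mul_left _ hsum
    _ = _ := by ring

open Classical in
/-- The points with the property `P` in the components of the points below `v`. -/
noncomputable def seen (G : ℕ → ℕ → ℕ) (N v : ℕ) (P : ℕ → Prop) : Finset ℕ :=
  (Finset.range N).filter fun x => P x ∧ ∃ u < v, Reach G u x

theorem card_seen_le {v : ℕ} {P : ℕ → Prop} : (seen G N v P).card ≤ N := by
  classical
  exact (Finset.card_filter_le _ _).trans_eq (Finset.card_range N)

theorem seen_succ {v : ℕ} {P : ℕ → Prop} (h : ∃ u < v, Reach G u v) :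
    seen G N (v + 1) P = seen G N v P := by
  classical
  unfold seen
  refine Finset.filter_congr fun x _ => and_congr_right fun _ => ⟨?_, ?_⟩
  · rintro ⟨u, hu, hux⟩
    rcases Nat.lt_succ_iff_lt_or_eq.1 hu with hu | rfl
    · exact ⟨u, hu, hux⟩
    · obtain ⟨u', hu', h'⟩ := h
      exact ⟨u', hu', h'.trans hux⟩
  · rintro ⟨u, hu, hux⟩
    exact ⟨u, by omega, hux⟩

theorem Sys.card_seen_succ (hG : Sys d N G) {v : ℕ} {P : ℕ → Prop} (hv : v < N)
    (h : ¬ ∃ u < v, Reach G u v) (hP : ∀ x, Reach G v x → (P x ↔ P v)) [Decidable (P v)] :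
    (seen G N (v + 1) P).card = (seen G N v P).card + if P v then (orb G N v).card else 0 := by
  classical
  by_cases hPv : P v
  · rw [if_pos hPv, ← Finset.card_union_of_disjoint]
    · congr 1
      ext x
      simp only [seen, Finset.mem_union, Finset.mem_filter, Finset.mem_range, orb]
      constructor
      · rintro ⟨hx, hPx, u, hu, hux⟩
        rcases Nat.lt_succ_iff_lt_or_eq.1 hu with hu | rfl
        · exact Or.inl ⟨hx, hPx, u, hu, hux⟩
        · exact Or.inr ⟨hx, hux⟩
      · rintro (⟨hx, hPx, u, hu, hux⟩ | ⟨hx, hvx⟩)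
        · exact ⟨hx, hPx, u, by omega, hux⟩
        · exact ⟨hx, (hP x hvx).2 hPv, v, by omega, hvx⟩
    · rw [Finset.disjoint_left]
      intro x hx hx'
      simp only [seen, Finset.mem_filter] at hx
      obtain ⟨_, _, u, hu, hux⟩ := hx
      exact h ⟨u, hu, hux.trans (hG.reach_symm hv ((hG.mem_orb hv).1 hx'))⟩
  · rw [if_neg hPv]
    change _ = (seen G N v P).card
    refine congrArg Finset.card (Finset.ext fun x => ?_)
    simp only [seen, Finset.mem_filter, Finset.mem_range]
    refine and_congr_right fun hx => and_congr_right fun hPx => ⟨?_, ?_⟩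
    · rintro ⟨u, hu, hux⟩
      rcases Nat.lt_succ_iff_lt_or_eq.1 hu with hu | rfl
      · exact ⟨u, hu, hux⟩
      · exact absurd ((hP x hux).1 hPx) hPv
    · rintro ⟨u, hu, hux⟩
      exact ⟨u, by omega, hux⟩

/-- The cost of treating a component, per point of it. -/
def compCost (d B : ℕ) : ℕ := 21 * d + 40 + (105 * d + 810) * B

/-- `G` maps points below `n` to points below `n`, and others to others. -/
def Sided (N n : ℕ) (G : ℕ → ℕ → ℕ) : Prop := ∀ j, ∀ x < N, (G j x < n ↔ x < n)

theorem Sided.reach (h : Sided N n G) (hG : Sys d N G) {x y : ℕ} (hx : x < N) (hxy : Reach G x y) :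
    y < n ↔ x < n := by
  obtain ⟨l, rfl⟩ := hxy
  induction l generalizing x with
  | nil => exact Iff.rfl
  | cons j l ih => rw [act_cons, ih (hG.lt j x hx), h j x hx]

/-- The state of the classification when the points below `v` have been processed. -/
structure ClsInv (d N S κ n B : ℕ) (G : ℕ → ℕ → ℕ) (tm₁ : ℕ) (σ : HS) : Prop where
  std : Std d N S G σ
  n_eq : σ.n = n
  v_le : σ.v ≤ N
  phi_eq : ∀ x < N, σ.phi x = 0
  vis_iff : ∀ x < N, σ.vis x ≠ 0 ↔ ∃ u < σ.v, Reach G u x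
  rep_lt : ∀ t < σ.R, σ.rep t < σ.v
  rsz_eq : ∀ t < σ.R, σ.rsz t = (orb G N (σ.rep t)).card
  sep : ∀ t < σ.R, ∀ t' < σ.R, Sim G (σ.rep t) (σ.rep t') → t = t'
  cover : ∀ u < σ.v, ∃ t < σ.R, Sim G (σ.rep t) u
  cnt_eq : ∀ t < σ.R, σ.cnt t + (seen G N σ.v fun x => n ≤ x ∧ Sim G (σ.rep t) x).card =
    N + (seen G N σ.v fun x => x < n ∧ Sim G (σ.rep t) x).card
  tm_le : σ.tm ≤ tm₁ + 4 * σ.v + (seen G N σ.v fun _ => True).card * compCost d B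

theorem ClsInv.R_le {B tm₁ : ℕ} {σ : HS} (h : ClsInv d N S κ n B G tm₁ σ) : σ.R ≤ N := by
  have h1 := Finset.card_le_card_of_injOn (s := Finset.range σ.R) (t := Finset.range N) σ.rep
    (fun t ht => by
      have h2 := h.rep_lt t (by simpa using ht)
      have h3 := h.v_le
      simp
      omega)
    (fun t ht t' ht' he => h.sep t (by simpa using ht) t' (by simpa using ht') (he ▸ Sim.refl _))
  simpa using h1

theorem ClsInv.step_visited {B tm₁ : ℕ} {σ σ' : HS} (h : ClsInv d N S κ n B G tm₁ σ)
    (hG : Sys d N G) (hv : σ.v < N)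
    (hvis : ∃ u < σ.v, Reach G u σ.v) (hσ' : σ' = { σ with v := σ.v + 1, tm := σ.tm + 4 }) :
    ClsInv d N S κ n B G tm₁ σ' := by
  subst hσ'
  refine ⟨⟨h.std.N_eq, h.std.S_eq, h.std.tab⟩, h.n_eq, hv, h.phi_eq, fun x hx => ?_,
    fun t ht => Nat.lt_succ_of_lt (h.rep_lt t ht), h.rsz_eq, h.sep, fun u hu => ?_, fun t ht => ?_, ?_⟩
  · refine (h.vis_iff x hx).trans ⟨fun ⟨u, hu, hux⟩ => ⟨u, Nat.lt_succ_of_lt hu, hux⟩, ?_⟩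
    rintro ⟨u, hu, hux⟩
    rcases Nat.lt_succ_iff_lt_or_eq.1 hu with hu | rfl
    · exact ⟨u, hu, hux⟩
    · obtain ⟨u', hu', h'⟩ := hvis
      exact ⟨u', hu', h'.trans hux⟩
  · rcases Nat.lt_succ_iff_lt_or_eq.1 hu with hu | rfl
    · exact h.cover u hu
    · obtain ⟨u', hu', h'⟩ := hvis
      obtain ⟨t, ht, h1⟩ := h.cover u' hu'
      exact ⟨t, ht, h1.trans (hG.sim_of_reach (by have := h.v_le; omega) h')⟩
  · simp only
    rw [seen_succ hvis, seen_succ hvis]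
    exact h.cnt_eq t ht
  · simp only
    rw [seen_succ hvis]
    have := h.tm_le
    omega

/-- The time is charged to the points of the component. Each point is charged once, however many
components there are. -/
theorem ClsInv.step_component {B tm₁ : ℕ} {σ σ₁ σ' : HS} (h : ClsInv d N S κ n B G tm₁ σ)
    (hG : Sys d N G) (hB : WeightLe N κ G B) (hside : Sided N n G) (hv : σ.v < N)
    (hvis : ¬ ∃ u < σ.v, Reach G u σ.v)
    (hc : CompPost d N κ G { σ with tm := σ.tm + 2 } σ₁)
    (hσ' : σ' = { σ₁ with v := σ₁.v + 1, tm := σ₁.tm + 1 }) :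
    ClsInv d N S κ n B G tm₁ σ' := by
  classical
  subst hσ'
  obtain ⟨c1, c2, c3, c4, c5, c6, c7, c8, c9, c10⟩ := hc
  simp only at c1 c2 c3 c4 c5 c6 c7 c8 c9 c10
  have hmpos : 0 < (orb G N σ.v).card := Finset.card_pos.2 ⟨_, hG.self_mem_orb hv⟩
  have hrepN : ∀ t < σ.R, σ.rep t < N := fun t ht => (h.rep_lt t ht).trans hv
  have hcost := sum_scanCost_le (d := d) hB hmpos hrepN h.rsz_eq h.sep
  have hP1 : ∀ r x, Reach G σ.v x → ((x < n ∧ Sim G r x) ↔ (σ.v < n ∧ Sim G r σ.v)) := by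
    intro r x hx
    have h1 := hG.sim_of_reach hv hx
    have h2 := hG.sim_of_reach (hG.reach_lt hv hx) (hG.reach_symm hv hx)
    exact and_congr (hside.reach hG hv hx) ⟨fun h => h.trans h2, fun h => h.trans h1⟩
  have hP2 : ∀ r x, Reach G σ.v x → ((n ≤ x ∧ Sim G r x) ↔ (n ≤ σ.v ∧ Sim G r σ.v)) := by
    intro r x hx
    have h1 := hG.sim_of_reach hv hx
    have h2 := hG.sim_of_reach (hG.reach_lt hv hx) (hG.reach_symm hv hx)
    have h3 := hside.reach hG hv hx
    exact and_congr (by omega) ⟨fun h => h.trans h2, fun h => h.trans h1⟩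
  have hupd : ∀ r c, c + (seen G N σ.v fun x => n ≤ x ∧ Sim G r x).card =
      N + (seen G N σ.v fun x => x < n ∧ Sim G r x).card → Sim G r σ.v →
      updCnt σ.n σ.v (orb G N σ.v).card c +
        (seen G N (σ.v + 1) fun x => n ≤ x ∧ Sim G r x).card =
      N + (seen G N (σ.v + 1) fun x => x < n ∧ Sim G r x).card := by
    intro r c he hs
    -- At most `N` points of the type lie on the right even after this step, so the count offset by
    -- `N` is large enough for the subtraction not to be truncated.
    have hle : (seen G N (σ.v + 1) fun x => n ≤ x ∧ Sim G r x).card ≤ N := card_seen_le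
    rw [hG.card_seen_succ hv hvis (hP2 r)] at hle ⊢
    rw [hG.card_seen_succ hv hvis (hP1 r), updCnt, h.n_eq]
    by_cases hlt : σ.v < n
    · rw [if_pos hlt, if_neg (by omega), if_pos ⟨hlt, hs⟩]
      omega
    · rw [if_pos (show n ≤ σ.v ∧ _ from ⟨by omega, hs⟩)] at hle ⊢
      rw [if_neg hlt, if_neg (by omega)]
      omega
  have hold : ∀ t < σ.R, σ₁.cnt t +
      (seen G N (σ.v + 1) fun x => n ≤ x ∧ Sim G (σ.rep t) x).card =
      N + (seen G N (σ.v + 1) fun x => x < n ∧ Sim G (σ.rep t) x).card := by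
    intro t ht
    have he := h.cnt_eq t ht
    by_cases hs : Sim G (σ.rep t) σ.v
    · rw [(c9 t ht).1 hs]
      exact hupd _ _ he hs
    · rw [hG.card_seen_succ hv hvis (hP2 _), hG.card_seen_succ hv hvis (hP1 _), (c9 t ht).2 hs,
        if_neg (fun h => hs h.2), if_neg (fun h => hs h.2)]
      exact he
  have hvis' : ∀ x < N, σ₁.vis x ≠ 0 ↔ ∃ u < σ.v + 1, Reach G u x := by
    intro x hx
    rw [c7 x hx, h.vis_iff x hx]
    constructor
    · rintro (⟨u, hu, hux⟩ | hvx)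
      · exact ⟨u, by omega, hux⟩
      · exact ⟨σ.v, by omega, hvx⟩
    · rintro ⟨u, hu, hux⟩
      rcases Nat.lt_succ_iff_lt_or_eq.1 hu with hu | rfl
      · exact Or.inl ⟨u, hu, hux⟩
      · exact Or.inr hux
  have htm : σ₁.tm + 1 ≤ tm₁ + 4 * (σ.v + 1) +
      (seen G N (σ.v + 1) fun _ => True).card * compCost d B := by
    rw [hG.card_seen_succ hv hvis (fun _ _ => Iff.rfl), if_pos trivial, Nat.add_mul]
    have h1 : (orb G N σ.v).card * compCost d B = (21 * d + 23) * (orb G N σ.v).card +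
      (orb G N σ.v).card * ((105 * d + 810) * B) + 17 * (orb G N σ.v).card := by
      unfold compCost; ring
    have := h.tm_le
    omega
  have hstd : ∀ c < S, ∀ y < N, σ₁.tab (c * N + y) = act G (word d c) y := by
    rw [c5]; exact h.std.tab
  have hN : σ₁.N = N := by rw [c2, h.std.N_eq]
  have hS : σ₁.S = S := by rw [c3, h.std.S_eq]
  rcases c8 with ⟨⟨t₀, ht₀, hs₀⟩, e1, e2, e3⟩ | ⟨hns, e1, e2, e3, e4⟩
  · refine ⟨⟨hN, hS, hstd⟩, c1.trans h.n_eq, by simp only [c4]; exact hv, c6, by simpa only [c4],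
      fun t ht => ?_, fun t ht => ?_, ?_, fun u hu => ?_, fun t ht => ?_, by simpa only [c4]⟩
    · simp only [e1, e2, c4] at ht ⊢
      have := h.rep_lt t ht
      omega
    · simp only [e1, e2, e3] at ht ⊢
      exact h.rsz_eq t ht
    · simp only [e1, e2]
      exact h.sep
    · simp only [e1, e2, c4] at hu ⊢
      rcases Nat.lt_succ_iff_lt_or_eq.1 hu with hu | rfl
      · exact h.cover u hu
      · exact ⟨t₀, ht₀, hs₀⟩
    · simp only [e1, e2, c4] at ht ⊢
      exact hold t ht
  · have hne : ∀ t < σ.R, σ₁.rep t = σ.rep t := fun t ht => by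
      rw [e2, Function.update_of_ne (by omega)]
    have hself : σ₁.rep σ.R = σ.v := by rw [e2, Function.update_self]
    refine ⟨⟨hN, hS, hstd⟩, c1.trans h.n_eq, by simp only [c4]; exact hv, c6, by simpa only [c4],
      fun t ht => ?_, fun t ht => ?_, fun t ht t' ht' hs => ?_, fun u hu => ?_, fun t ht => ?_,
      by simpa only [c4]⟩
    · simp only [e1, c4] at ht ⊢
      rcases Nat.lt_succ_iff_lt_or_eq.1 ht with ht | rfl
      · rw [hne t ht]
        have := h.rep_lt t ht
        omega
      · rw [hself]; omega
    · simp only [e1] at ht ⊢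
      rcases Nat.lt_succ_iff_lt_or_eq.1 ht with ht | rfl
      · rw [hne t ht, e3, Function.update_of_ne (by omega)]
        exact h.rsz_eq t ht
      · rw [hself, e3, Function.update_self]
    · simp only [e1] at ht ht' hs
      rcases Nat.lt_succ_iff_lt_or_eq.1 ht with ht | rfl <;>
        rcases Nat.lt_succ_iff_lt_or_eq.1 ht' with ht' | rfl
      · rw [hne t ht, hne t' ht'] at hs
        exact h.sep t ht t' ht' hs
      · rw [hne t ht, hself] at hs
        exact absurd hs (hns t ht)
      · rw [hne t' ht', hself] at hs
        exact absurd (hG.sim_symm (hrepN t' ht') hs) (hns t' ht')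
      · rfl
    · simp only [e1, c4] at hu ⊢
      rcases Nat.lt_succ_iff_lt_or_eq.1 hu with hu | rfl
      · obtain ⟨t, ht, h1⟩ := h.cover u hu
        exact ⟨t, by omega, by rwa [hne t ht]⟩
      · exact ⟨σ.R, by omega, by rw [hself]; exact Sim.refl _⟩
    · simp only [e1, c4] at ht ⊢
      rcases Nat.lt_succ_iff_lt_or_eq.1 ht with ht | rfl
      · rw [hne t ht]
        exact hold t ht
      · rw [hself, e4]
        refine hupd _ _ ?_ (Sim.refl _)
        -- If an earlier point had this type, `cover` would provide a representative similar to `v`.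
        -- So both counts of a new type are still zero.
        have hempty : ∀ x, x < N → Sim G σ.v x → ¬ ∃ u < σ.v, Reach G u x := by
          rintro x hx hs ⟨u, hu, hux⟩
          obtain ⟨t, ht, h1⟩ := h.cover u hu
          exact hns t ht ((h1.trans (hG.sim_of_reach (hu.trans hv) hux)).trans (hG.sim_symm hx hs))
        have hz : ∀ P : ℕ → Prop, (∀ x, P x → Sim G σ.v x) → (seen G N σ.v P).card = 0 := by
          intro P hP
          rw [Finset.card_eq_zero, seen, Finset.filter_eq_empty_iff]
          exact fun x hx hh => hempty x (Finset.mem_range.1 hx) (hP x hh.1) hh.2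
        rw [hz _ fun x h => h.2, hz _ fun x h => h.2]

theorem wp_classify (hG : Ctx d N S Z κ G) {B : ℕ} (hB : WeightLe N κ G B) (hside : Sided N n G)
    {σ : HS} (hσ : Std d N S G σ) (hn : σ.n = n) (hphi : ∀ x < N, σ.phi x = 0)
    (hvis : ∀ x < N, σ.vis x = 0) :
    wp Z (classify d) (fun σ' => σ'.v = N ∧ ClsInv d N S κ n B G (σ.tm + 3) σ') σ := by
  have hZ := hG.lt_Z
  have hNd : N * d + 10 * N + 100 < Z := by rw [Nat.mul_add] at hZ; omega
  simp only [classify, Cmd.block]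
  simp
  refine ⟨by omega, ?_⟩
  refine wp_loop (fun σ' => ClsInv d N S κ n B G (σ.tm + 2) σ') (fun σ' => N - σ'.v) ?_ ?_
  · intro σ' h
    have hNe := h.std.N_eq
    refine ⟨by simp, by simp, fun hc => ?_, fun hc => ?_⟩
    · simp [hNe] at hc
      simp
      refine ⟨by omega, by omega, fun h0 => ?_, fun h0 => ?_⟩
      · refine wp_mono (wp_component hG ?_ ?_ ?_ ?_ ?_ ?_ ?_) ?_
        · exact ⟨h.std.N_eq, h.std.S_eq, h.std.tab⟩
        · exact hc
        · exact h.phi_eq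
        · exact h.R_le
        · exact fun t ht => (h.rep_lt t ht).trans hc
        · exact h.rsz_eq
        · intro t ht
          have h1 := h.cnt_eq t ht
          have h2 : (seen G N σ'.v fun x => x < n ∧ Sim G (σ'.rep t) x).card ≤ N := card_seen_le
          simp only
          omega
        · intro σ₁ h₁
          have hv₁ : σ₁.v = σ'.v := h₁.v_eq
          simp
          refine ⟨⟨by omega, by omega⟩, ?_, by omega⟩
          refine h.step_component hG.toSys hB hside hc ?_ h₁ rfl
          rw [← h.vis_iff _ hc]
          simpa using h0
      · refine ⟨⟨by omega, by omega⟩, ?_, by omega⟩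
        exact h.step_visited hG.toSys hc ((h.vis_iff _ hc).1 h0) rfl
    · simp [hNe] at hc
      have hv : σ'.v = N := le_antisymm h.v_le hc
      refine ⟨hv, ⟨h.std.N_eq, h.std.S_eq, h.std.tab⟩, h.n_eq, h.v_le, h.phi_eq, h.vis_iff,
        h.rep_lt, h.rsz_eq, h.sep, h.cover, h.cnt_eq, ?_⟩
      have := h.tm_le
      simp
      omega
  · refine ⟨⟨hσ.N_eq, hσ.S_eq, hσ.tab⟩, hn, Nat.zero_le _, hphi, fun x hx => ?_, ?_, ?_, ?_, ?_, ?_, ?_⟩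
    · simp [hvis x hx]
    all_goals simp

end

/-! ### The verdict and the complete decision procedure. -/

section

variable {d N S Z κ n : ℕ} {G : ℕ → ℕ → ℕ}

theorem wp_verdict {σ : HS} (hN : σ.N + 1 < Z) (hR : σ.R ≤ σ.N) :
    wp Z verdict (fun σ' =>
      (σ'.n = 1 ∧ (∀ t < σ.R, σ.cnt t = σ.N) ∨ σ'.n = 0 ∧ ¬ ∀ t < σ.R, σ.cnt t = σ.N) ∧
      σ'.tm ≤ σ.tm + 4 * σ.R + 4) σ := by
  simp only [verdict, Cmd.block]
  simp
  refine ⟨by omega, by omega, ?_⟩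
  refine wp_loop (fun σ' => ∃ t found tm, σ' = { σ with t := t, found := found, tm := tm } ∧
      t ≤ σ.R ∧ (found = 1 ∧ (∀ t' < t, σ.cnt t' = σ.N) ∨ found = 0 ∧ ¬ ∀ t' < t, σ.cnt t' = σ.N) ∧
      tm ≤ σ.tm + 4 * t + 2) (fun σ' => σ.R - σ'.t) ?_
    ⟨_, _, _, rfl, Nat.zero_le _, Or.inl ⟨rfl, by omega⟩, by simp⟩
  rintro _ ⟨t, found, tm, rfl, ht, hf, htm⟩
  refine ⟨by simp, by simp, fun hc => ?_, fun hc => ?_⟩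
  · simp at hc
    have hstep : (∀ t' ≤ t, σ.cnt t' = σ.N) ↔ (∀ t' < t, σ.cnt t' = σ.N) ∧ σ.cnt t = σ.N := by
      rw [← Nat.forall_lt_succ_right]; exact forall_congr' fun _ => by rw [Nat.lt_succ_iff]
    simp [-not_forall]
    refine ⟨by omega, fun hne => ⟨by omega, ⟨by omega, by omega⟩, ⟨by omega, ?_, by omega⟩, by omega⟩,
      fun he => ⟨⟨by omega, by omega⟩, ⟨by omega, ?_, by omega⟩, by omega⟩⟩
    · exact fun h => hne (hstep.1 h).2
    · rcases hf with ⟨h1, h2⟩ | ⟨h1, h2⟩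
      · exact Or.inl ⟨h1, hstep.2 ⟨h2, he⟩⟩
      · exact Or.inr ⟨h1, fun h => h2 (hstep.1 h).1⟩
  · simp at hc
    obtain rfl : t = σ.R := by omega
    simp [-not_forall]
    refine ⟨?_, by omega⟩
    convert hf using 3
    simp

open Classical in
/-- Every type of component has as many points below `n` as from `n` on. -/
def Balanced (N n : ℕ) (G : ℕ → ℕ → ℕ) : Prop :=
  ∀ x < N, ((Finset.range n).filter (Sim G x)).card = ((Finset.Ico n N).filter (Sim G x)).card

/-- At `v = N` every point has been seen, so `cnt - N` is the difference between the two sides for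
the type of the representative, and by `cover` every type has a representative. -/
theorem ClsInv.balanced_iff {B tm₁ : ℕ} {σ : HS} (h : ClsInv d N S κ n B G tm₁ σ) (hG : Sys d N G)
    (hn : n ≤ N) (hv : σ.v = N) : (∀ t < σ.R, σ.cnt t = N) ↔ Balanced N n G := by
  classical
  have hseen : ∀ r, (seen G N σ.v fun x => n ≤ x ∧ Sim G r x) = (Finset.Ico n N).filter (Sim G r) ∧
      (seen G N σ.v fun x => x < n ∧ Sim G r x) = (Finset.range n).filter (Sim G r) := by
    intro r
    constructor <;> ext x <;> simp only [seen, Finset.mem_filter, Finset.mem_range, Finset.mem_Ico]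
    · exact ⟨fun h => ⟨⟨h.2.1.1, h.1⟩, h.2.1.2⟩,
        fun h => ⟨h.1.2, ⟨h.1.1, h.2⟩, x, hv ▸ h.1.2, Reach.refl x⟩⟩
    · exact ⟨fun h => h.2.1, fun h => ⟨by omega, h, x, by omega, Reach.refl x⟩⟩
  have hcnt := h.cnt_eq
  simp only [(hseen _).1, (hseen _).2] at hcnt
  constructor
  · intro hall x hx
    obtain ⟨t, ht, hs⟩ := h.cover x (by omega)
    have h1 := hcnt t ht
    rw [hall t ht] at h1
    have h2 : Sim G x = Sim G (σ.rep t) := funext fun y => propext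
      ⟨fun h => hs.trans h, fun h => (hG.sim_symm hx hs).trans h⟩
    simp only [h2]
    convert (Nat.add_left_cancel h1).symm using 2
  · intro hb t ht
    have h1 := hcnt t ht
    have h2 := h.rep_lt t ht
    have h3 := hb (σ.rep t) (by omega)
    have h4 : ((Finset.range n).filter (Sim G (σ.rep t))).card =
        ((Finset.Ico n N).filter (Sim G (σ.rep t))).card := by convert h3 using 2
    omega

def decider (d : ℕ) : Cmd := block [tableSize d, table d, classify d, verdict]

/-- The running time in terms of a bound for the total weight of non-isomorphic components. -/
def runTime (d n B : ℕ) : ℕ :=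
  20 * ((d + 2 + Nat.sqrt n) * (n + 1)) + 20 * n + 2 * n * compCost d B + 20

theorem wp_decider (hd : 0 < d) (hG : Sys d (2 * n) G) {B : ℕ}
    (hB : WeightLe (2 * n) (blockLen d n) G B) (hside : Sided (2 * n) n G) {σ : HS}
    (hn : σ.n = n) (htm : σ.tm = 0) (hphi : ∀ x < 2 * n, σ.phi x = 0)
    (hvis : ∀ x < 2 * n, σ.vis x = 0) (hinp : InputOk d n G σ.inp) :
    wp (memSize d n) (decider d) (fun σ' =>
      (σ'.n = 1 ∧ Balanced (2 * n) n G ∨ σ'.n = 0 ∧ ¬ Balanced (2 * n) n G) ∧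
      σ'.tm ≤ runTime d n B) σ := by
  simp only [decider, Cmd.block]
  simp only [wp_seq]
  subst hn
  refine wp_mono wp_tableSize ?_
  rintro _ ⟨S, tm, rfl, hS1, hS2, hS3, hS4, htm1⟩
  have hC := Ctx.of_sys hd hG hS1 hS2 hS3
  rw [wp_seq]
  refine wp_mono (wp_table (σ := { σ with N := 2 * σ.n, S := S, tm := tm }) hC ?_ ?_ ?_ ?_) ?_
  · rfl
  · simp only [memSize]; nlinarith
  · simp only [memSize]; nlinarith
  · exact hinp
  rintro _ ⟨i, x, y, tab, tm2, rfl, htab, htm2⟩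
  simp only at htab htm2
  rw [wp_seq]
  refine wp_mono (wp_classify hC hB hside ?_ ?_ ?_ ?_) ?_
  · exact ⟨rfl, rfl, htab⟩
  · rfl
  · exact hphi
  · exact hvis
  rintro σ' ⟨hv, hI⟩
  have hN := hI.std.N_eq
  have hZ : 2 * σ.n + 1 < memSize d σ.n := by simp only [memSize]; nlinarith
  refine wp_mono (wp_verdict (by omega) (by rw [hN]; exact hI.R_le)) ?_
  rintro σ'' ⟨hres, htm3⟩
  rw [hN, hI.balanced_iff hG (by omega) hv] at hres
  refine ⟨hres, ?_⟩
  have h1 := hI.tm_le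
  have h2 := hI.R_le
  have h3 : (seen G (2 * σ.n) σ'.v fun _ => True).card * compCost d B ≤ 2 * σ.n * compCost d B :=
    Nat.mul_le_mul_right _ card_seen_le
  have h4 : S * (σ.n + 1) ≤ (d + 2 + Nat.sqrt σ.n) * (σ.n + 1) := Nat.mul_le_mul_right _ (by omega)
  simp only at h1
  unfold runTime
  have h5 : S * (2 * σ.n) = 2 * (S * (σ.n + 1)) - 2 * S := by
    rw [Nat.mul_add]; ring_nf; omega
  have h6 : S * 1 ≤ S * (σ.n + 1) := Nat.mul_le_mul_left _ (by omega)
  omega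

end

end

section

/-! The system of permutations given by an instance. -/

section
variable {d n : ℕ}

/-- `a` acts on `{0, …, n - 1}` and `b` on `{n, …, 2 n - 1}`. -/
def pairAct (a b : Fin d → Equiv.Perm (Fin n)) (j x : ℕ) : ℕ :=
  if hj : 1 ≤ j ∧ j ≤ d then
    if hx : x < n then a ⟨j - 1, by omega⟩ ⟨x, hx⟩
    else if hx' : x < 2 * n then n + b ⟨j - 1, by omega⟩ ⟨x - n, by omega⟩ else x
  else x

variable (a b : Fin d → Equiv.Perm (Fin n))

theorem pairAct_left (j : Fin d) (x : Fin n) : pairAct a b (j + 1) x = a j x := by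
  rw [pairAct, dif_pos ⟨by omega, j.2⟩, dif_pos x.2]
  rfl

theorem pairAct_right (j : Fin d) (x : Fin n) : pairAct a b (j + 1) (n + x) = n + b j x := by
  rw [pairAct, dif_pos ⟨by omega, j.2⟩, dif_neg (by omega), dif_pos (by omega)]
  simp

theorem pairAct_sided : Sided (2 * n) n (pairAct a b) := by
  intro j x hx
  unfold pairAct
  split_ifs with h1 h2
  · simp [h2]
  · simp [h2]
  · rfl

theorem pairAct_sys : Sys d (2 * n) (pairAct a b) := by
  refine ⟨fun j x hx => ?_, fun j x y hx hy h => ?_, fun j x hj => dif_neg hj⟩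
  · unfold pairAct
    split_ifs with h1 h2
    · have := (a ⟨j - 1, by omega⟩ ⟨x, h2⟩).2
      omega
    · have := (b ⟨j - 1, by omega⟩ ⟨x - n, by omega⟩).2
      omega
    · exact hx
  · have h0 : x < n ↔ y < n := by
      rw [← pairAct_sided a b j x hx, ← pairAct_sided a b j y hy, h]
    unfold pairAct at h
    by_cases h1 : 1 ≤ j ∧ j ≤ d
    · rw [dif_pos h1, dif_pos h1] at h
      by_cases h2 : x < n
      · rw [dif_pos h2, dif_pos (h0.1 h2)] at h
        simpa using (a _).injective (Fin.ext h)
      · rw [dif_neg h2, dif_neg (fun h' => h2 (h0.2 h')), dif_pos hx, dif_pos hy] at h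
        have h3 := (b _).injective (Fin.ext (Nat.add_left_cancel h))
        have h4 : x - n = y - n := by simpa using h3
        omega
    · rwa [dif_neg h1, dif_neg h1] at h

theorem inputOk_pairAct : InputOk d n (pairAct a b) (input a b).mem := by
  intro j hj hjd y hy
  have hcell : ∀ x, x < n → (j - 1) * n + x < d * n ∧ ((j - 1) * n + x) / n = j - 1 ∧
      ((j - 1) * n + x) % n = x := by
    intro x hx
    have h1 : (j - 1 + 1) * n ≤ d * n := Nat.mul_le_mul_right _ (by omega)
    rw [Nat.add_mul] at h1
    refine ⟨by omega, ?_, ?_⟩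
    · rw [Nat.add_comm, Nat.add_mul_div_right _ _ (by omega), Nat.div_eq_of_lt hx, Nat.zero_add]
    · rw [Nat.mul_add_mod', Nat.mod_eq_of_lt hx]
  refine ⟨fun hyn => ?_, fun hny => ?_⟩
  · obtain ⟨h1, h2, h3⟩ := hcell y hyn
    have h4 := pairAct_left a b ⟨j - 1, by omega⟩ ⟨y, hyn⟩
    simp only [Nat.sub_add_cancel hj] at h4
    rw [h4]
    simp only [input, dif_pos h1]
    congr 2
    · congr 1
      exact Fin.ext h2
    · exact Fin.ext h3
  · obtain ⟨h1, h2, h3⟩ := hcell (y - n) (by omega)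
    have h4 := pairAct_right a b ⟨j - 1, by omega⟩ ⟨y - n, by omega⟩
    simp only [Nat.sub_add_cancel hj, Nat.add_sub_cancel' hny] at h4
    rw [h4]
    simp only [input, dif_neg (show ¬ d * n + ((j - 1) * n + (y - n)) < d * n by omega),
      Nat.add_sub_cancel_left, dif_pos h1]
    congr 3
    · congr 1
      exact Fin.ext h2
    · exact Fin.ext h3

/-- The equation `b j = τ⁻¹ * a j * τ` says that `τ` carries the action of `b` to that of `a`. So
conjugators are the equivariant bijections from the right half to the left half, which exist exactly
if the counts of all types match. -/
theorem balanced_iff_simConj : Balanced (2 * n) n (pairAct a b) ↔ SimConj a b := by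
  classical
  have hG := pairAct_sys a b
  have hside := pairAct_sided a b
  have hU : ∀ x ∈ Finset.Ico n (2 * n), x < 2 * n ∧ ∀ j, pairAct a b j x ∈ Finset.Ico n (2 * n) := by
    intro x hx
    rw [Finset.mem_Ico] at hx
    refine ⟨hx.2, fun j => ?_⟩
    have h1 := hside j x hx.2
    have h2 := hG.lt j x hx.2
    rw [Finset.mem_Ico]
    omega
  have hV : ∀ x ∈ Finset.range n, x < 2 * n ∧ ∀ j, pairAct a b j x ∈ Finset.range n := by
    intro x hx
    rw [Finset.mem_range] at hx
    exact ⟨by omega, fun j => Finset.mem_range.2 ((hside j x (by omega)).2 hx)⟩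
  constructor
  · intro hb
    obtain ⟨f, hf, he⟩ := hG.exists_equivariant_bijOn _ _ hU hV fun x hx => by
      convert (hb x hx).symm using 2
    have hmem : ∀ y : Fin n, n + (y : ℕ) ∈ Finset.Ico n (2 * n) := fun y => by
      rw [Finset.mem_Ico]; omega
    have hlt : ∀ y : Fin n, f (n + y) < n := fun y =>
      Finset.mem_range.1 (hf.mapsTo (Finset.mem_coe.2 (hmem y)))
    have hinj : Function.Injective fun y : Fin n => (⟨f (n + y), hlt y⟩ : Fin n) := by
      intro y y' h
      have h1 := hf.injOn (Finset.mem_coe.2 (hmem y)) (Finset.mem_coe.2 (hmem y')) (Fin.mk.inj h)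
      exact Fin.ext (Nat.add_left_cancel h1)
    refine ⟨Equiv.ofBijective _ (Finite.injective_iff_bijective.1 hinj), fun j => ?_⟩
    rw [mul_assoc, eq_inv_mul_iff_mul_eq]
    ext y
    have h1 := he (j + 1) _ (hmem y)
    rw [pairAct_right] at h1
    have h2 := pairAct_left a b j ⟨f (n + y), hlt y⟩
    simp only at h2
    rw [h2] at h1
    simpa using h1
  · rintro ⟨τ, hτ⟩ x hx
    have hτ' : ∀ (j : Fin d) (y : Fin n), a j (τ y) = τ (b j y) := by
      intro j y
      rw [hτ j]
      simp
    let f : ℕ → ℕ := fun x => if h : x - n < n then τ ⟨x - n, h⟩ else 0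
    have hf : ∀ y : Fin n, f (n + y) = τ y := by
      intro y
      simp [f]
    have hex : ∀ x ∈ Finset.Ico n (2 * n), ∃ y : Fin n, x = n + y := by
      intro x hx
      rw [Finset.mem_Ico] at hx
      exact ⟨⟨x - n, by omega⟩, by simp only; omega⟩
    have hbij : Set.BijOn f (Finset.Ico n (2 * n) : Finset ℕ) (Finset.range n : Finset ℕ) := by
      refine ⟨?_, ?_, ?_⟩
      · intro x hx
        obtain ⟨y, rfl⟩ := hex x (Finset.mem_coe.1 hx)
        rw [hf]
        exact Finset.mem_coe.2 (Finset.mem_range.2 (τ y).2)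
      · intro x hx x' hx' h
        obtain ⟨y, rfl⟩ := hex x (Finset.mem_coe.1 hx)
        obtain ⟨y', rfl⟩ := hex x' (Finset.mem_coe.1 hx')
        rw [hf, hf] at h
        rw [τ.injective (Fin.ext h)]
      · intro x hx
        have hx := Finset.mem_range.1 (Finset.mem_coe.1 hx)
        refine ⟨n + (τ.symm ⟨x, hx⟩ : Fin n), ?_, by rw [hf]; simp⟩
        rw [Finset.mem_coe, Finset.mem_Ico]
        omega
    have he : ∀ j, ∀ x ∈ Finset.Ico n (2 * n), f (pairAct a b j x) = pairAct a b j (f x) := by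
      intro j x hx
      obtain ⟨y, rfl⟩ := hex x hx
      by_cases hj : 1 ≤ j ∧ j ≤ d
      · obtain ⟨j, rfl⟩ : ∃ i : Fin d, j = i + 1 := ⟨⟨j - 1, by omega⟩, by simp only; omega⟩
        rw [pairAct_right, hf, hf, pairAct_left, hτ']
      · rw [hG.triv j _ hj, hG.triv j _ hj]
    have := Sys.card_filter_sim_of_bijOn (fun x hx => (hU x hx).2) hbij he x
    convert this.symm using 2

end

/-! The total weight of pairwise non-isomorphic components. -/

/-- The best bound for the total weight of pairwise non-isomorphic components. -/
noncomputable def maxWeight (d n : ℕ) : ℕ :=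
  sInf {B | ∀ G, Sys d (2 * n) G → WeightLe (2 * n) (blockLen d n) G B}

theorem weight_le (κ m : ℕ) : weight κ m ≤ 2 * m + 1 := by
  have h1 := Nat.div_le_self m κ
  have h2 := Nat.log_le_self 2 m
  unfold weight
  omega

/-- The crude bound `2n * (4n + 1)` works for every system, so the infimum is attained. Taking the
worst system makes the time bound depend on `d` and `n` only. -/
theorem weightLe_maxWeight {d n : ℕ} {G : ℕ → ℕ → ℕ} (hG : Sys d (2 * n) G) :
    WeightLe (2 * n) (blockLen d n) G (maxWeight d n) := by
  refine Nat.sInf_mem (s := {B | ∀ G, Sys d (2 * n) G → WeightLe (2 * n) (blockLen d n) G B})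
    ⟨2 * n * (2 * (2 * n) + 1), fun G _ T hT _ => ?_⟩ G hG
  calc _ ≤ ∑ x ∈ T, (2 * (2 * n) + 1) := Finset.sum_le_sum fun x _ =>
        (weight_le _ _).trans (by have := card_orb_le (G := G) (N := 2 * n) (x := x); omega)
    _ = T.card * (2 * (2 * n) + 1) := by rw [Finset.sum_const, smul_eq_mul]
    _ ≤ _ := Nat.mul_le_mul_right _ ((Finset.card_le_card hT).trans_eq (Finset.card_range _))

/-- Points of one component are similar, so the components of pairwise non-similar points are
disjoint. -/
theorem Sys.sum_card_orb_le {d N : ℕ} {G : ℕ → ℕ → ℕ} (hG : Sys d N G) {T : Finset ℕ}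
    (hT : T ⊆ Finset.range N) (hsep : ∀ x ∈ T, ∀ y ∈ T, Sim G x y → x = y) :
    ∑ x ∈ T, (orb G N x).card ≤ N := by
  classical
  rw [← Finset.card_biUnion]
  · refine (Finset.card_le_card (t := Finset.range N) ?_).trans_eq (Finset.card_range N)
    exact Finset.biUnion_subset.2 fun x _ => Finset.filter_subset _ _
  · intro x hx y hy hxy
    refine Finset.disjoint_left.2 ?_
    intro z hz hz'
    have hxN := Finset.mem_range.1 (hT hx)
    have hyN := Finset.mem_range.1 (hT hy)
    exact hxy (hsep x hx y hy (hG.sim_of_reach hxN (((hG.mem_orb hxN).1 hz).trans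
      (hG.reach_symm hyN ((hG.mem_orb hyN).1 hz')))))

/-- An explicit form of `log m = o(m)`: with `l = Nat.log 2 m ≥ 4 * k`, the left side is at most `(l
/ 2) * 2 ^ (l / 2) ≤ 2 ^ l ≤ m`. -/
theorem mul_log_le {k m : ℕ} (hm : 2 ^ (4 * k) ≤ m) : k * (Nat.log 2 m + 1) ≤ m := by
  have hm0 : m ≠ 0 := by have := Nat.two_pow_pos (4 * k); omega
  have h1 : 4 * k ≤ Nat.log 2 m := Nat.le_log_of_pow_le (by omega) hm
  have h2 := Nat.pow_log_le_self 2 hm0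
  set l := Nat.log 2 m
  have h3 : l / 2 < 2 ^ (l / 2) := Nat.lt_two_pow_self
  calc k * (l + 1) ≤ (l / 2) * (2 * 2 ^ (l / 2)) / 2 := by
        rw [Nat.le_div_iff_mul_le (by omega)]
        have h4 : 2 * k ≤ l / 2 := by omega
        nlinarith [show l + 1 ≤ 2 * 2 ^ (l / 2) by omega]
    _ = (l / 2) * 2 ^ (l / 2) := by rw [Nat.mul_left_comm, Nat.mul_div_cancel_left _ (by omega)]
    _ ≤ 2 ^ (l / 2) * 2 ^ (l / 2) := Nat.mul_le_mul_right _ h3.le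
    _ = 2 ^ (l / 2 + l / 2) := (pow_add _ _ _).symm
    _ ≤ 2 ^ l := Nat.pow_le_pow_right (by omega) (by omega)
    _ ≤ m := h2

/-- This is `maxWeight d n = o(n)`. Components with more than `f` points have weight at most `2m /
(8 * (k + 1))`, and their sizes add up to at most `2n`. Smaller ones have only boundedly many types,
so their logarithmic terms contribute a constant. -/
theorem mul_maxWeight_le {d : ℕ} (hd : 0 < d) (k : ℕ) :
    ∃ n₀, ∀ n, n₀ ≤ n → k * maxWeight d n ≤ n := by
  classical
  obtain ⟨B, hB⟩ := card_le_of_not_sim d (2 ^ (4 * (8 * (k + 1))))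
  set f := 2 ^ (4 * (8 * (k + 1))) with hf
  -- The first bound forces `blockLen d n ≥ 8 * (k + 1)`; the second lets `n` absorb the
  -- contribution of the at most `B` small types. Together the scaled weight is at most `4 * n + n`,
  -- and `5 ≤ 8`.
  refine ⟨max (((d + 1) ^ (8 * (k + 1))) * ((d + 1) ^ (8 * (k + 1))))
    (8 * (k + 1) * (f + 1) * B), fun n hn => ?_⟩
  have hn1 := (le_max_left _ _).trans hn
  have hn2 := (le_max_right _ _).trans hn
  have hκ : 8 * (k + 1) ≤ blockLen d n := by
    refine Nat.le_log_of_pow_le (by omega) (le_max_of_le_right ?_)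
    rwa [Nat.le_sqrt]
  have hlt : 8 * (k + 1) * ((4 * n + n) / (8 * (k + 1))) ≤ 5 * n :=
    (Nat.mul_div_le _ _).trans (by omega)
  have hmax : maxWeight d n ≤ (4 * n + n) / (8 * (k + 1)) := by
    refine Nat.sInf_le fun G hG T hT hsep => ?_
    rw [Nat.le_div_iff_mul_le (by omega), Nat.mul_comm, Finset.mul_sum]
    have hone : ∀ x ∈ T, 8 * (k + 1) * weight (blockLen d n) (orb G (2 * n) x).card ≤
        2 * (orb G (2 * n) x).card +
          if (orb G (2 * n) x).card ≤ f then 8 * (k + 1) * (f + 1) else 0 := by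
      intro x _
      set m := (orb G (2 * n) x).card
      have h1 : 8 * (k + 1) * (m / blockLen d n) ≤ m :=
        (Nat.mul_le_mul_right _ hκ).trans (Nat.mul_div_le _ _)
      have h2 : 8 * (k + 1) * weight (blockLen d n) m =
          8 * (k + 1) * (m / blockLen d n) + 8 * (k + 1) * (Nat.log 2 m + 1) := by
        unfold weight; ring
      rw [h2]
      split_ifs with hm
      · have h3 : 8 * (k + 1) * (Nat.log 2 m + 1) ≤ 8 * (k + 1) * (f + 1) :=
          Nat.mul_le_mul_left _ (by have := Nat.log_le_self 2 m; omega)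
        omega
      · have h3 := mul_log_le (k := 8 * (k + 1)) (m := m) (by rw [← hf]; omega)
        omega
    refine (Finset.sum_le_sum hone).trans ?_
    rw [Finset.sum_add_distrib, ← Finset.mul_sum, ← Finset.sum_filter, Finset.sum_const, smul_eq_mul]
    have h1 := hG.sum_card_orb_le hT hsep
    have h2 := hB (2 * n) G hG (T.filter fun x => (orb G (2 * n) x).card ≤ f)
      (fun x hx => ⟨Finset.mem_range.1 (hT (Finset.mem_filter.1 hx).1), (Finset.mem_filter.1 hx).2⟩)
      (fun x hx y hy => hsep x (Finset.mem_filter.1 hx).1 y (Finset.mem_filter.1 hy).1)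
    have h3 := Nat.mul_le_mul_right (8 * (k + 1) * (f + 1)) h2
    rw [Nat.mul_comm B] at h3
    omega
  have h4 := Nat.mul_le_mul_left (8 * (k + 1)) hmax
  have h5 : 8 * (k + 1) * maxWeight d n = 8 * (k * maxWeight d n) + 8 * maxWeight d n := by ring
  omega

/-! ### From the weight bound to `o(n ^ 2)`. -/

theorem isLittleO_of_mul_le {T : ℕ → ℕ} (h : ∀ k, ∃ n₀, ∀ n, n₀ ≤ n → k * T n ≤ n ^ 2) :
    Asymptotics.IsLittleO Filter.atTop (fun n : ℕ => (T n : ℝ)) (fun n : ℕ => (n : ℝ) ^ 2) := by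
  rw [Asymptotics.isLittleO_iff]
  intro c hc
  obtain ⟨k, hk⟩ := exists_nat_gt (1 / c)
  obtain ⟨n₀, hn₀⟩ := h k
  refine Filter.eventually_atTop.2 ⟨n₀, fun n hn => ?_⟩
  have h1 : (k : ℝ) * T n ≤ (n : ℝ) ^ 2 := by exact_mod_cast hn₀ n hn
  rw [Real.norm_of_nonneg (by positivity), Real.norm_of_nonneg (by positivity)]
  have h2 : 1 ≤ c * k := by
    rw [div_lt_iff₀ hc] at hk
    linarith
  have h3 : (0 : ℝ) ≤ T n := by positivity
  nlinarith [mul_le_mul_of_nonneg_left h1 hc.le, mul_le_mul_of_nonneg_right h2 h3]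

theorem mul_runTime_le {d : ℕ} (hd : 0 < d) (K k : ℕ) :
    ∃ n₀, ∀ n, n₀ ≤ n → k * (K * runTime d n (maxWeight d n) + 4) ≤ n ^ 2 := by
  -- The running time divided by `n` has three parts: one of order `√n` from the table, a constant,
  -- and a multiple of `B`. The factors `4` make each of them, multiplied by `k`, at most `n / 4`.
  obtain ⟨n₁, hn₁⟩ := mul_maxWeight_le hd (4 * (k * (2 * K * (105 * d + 810))))
  set M := d + 2 + 4 * (k * (K * 80)) with hM
  set C := 4 * (k * (K * (20 + 2 * (21 * d + 40) + 20) + 4)) with hC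
  refine ⟨n₁ + M * M + C + 1, fun n hn => ?_⟩
  have h1 := hn₁ n (by omega)
  set B := maxWeight d n
  have hs : M ≤ Nat.sqrt n := by rw [Nat.le_sqrt]; omega
  have hs2 := Nat.sqrt_le n
  set s := Nat.sqrt n
  have h2 : 4 * (k * (K * 80)) * s ≤ n :=
    (Nat.mul_le_mul_right s (show 4 * (k * (K * 80)) ≤ s by omega)).trans hs2
  have h3 : (d + 2 + s) * (n + 1) ≤ (2 * s) * (2 * n) := Nat.mul_le_mul (by omega) (by omega)
  have h4 : K * runTime d n B + 4 ≤ n * (K * 80 * s + (K * (20 + 2 * (21 * d + 40) + 20) + 4) +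
      2 * K * (105 * d + 810) * B) := by
    have h5 : runTime d n B ≤ 20 * ((2 * s) * (2 * n)) + 20 * n + 2 * n * compCost d B + 20 * n := by
      change 20 * ((d + 2 + s) * (n + 1)) + _ + _ + _ ≤ _
      omega
    calc _ ≤ K * (20 * ((2 * s) * (2 * n)) + 20 * n + 2 * n * compCost d B + 20 * n) + 4 * n := by
          have := Nat.mul_le_mul_left K h5
          omega
      _ = _ := by unfold compCost; ring
  calc _ ≤ k * (n * (K * 80 * s + (K * (20 + 2 * (21 * d + 40) + 20) + 4) +
      2 * K * (105 * d + 810) * B)) := Nat.mul_le_mul_left _ h4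
    _ = n * (k * (K * 80 * s + (K * (20 + 2 * (21 * d + 40) + 20) + 4) +
      2 * K * (105 * d + 810) * B)) := by ring
    _ ≤ n * n := by
        refine Nat.mul_le_mul_left _ ?_
        have h6 : 4 * (k * (K * 80 * s + (K * (20 + 2 * (21 * d + 40) + 20) + 4) +
          2 * K * (105 * d + 810) * B)) = 4 * (k * (K * 80)) * s + C +
          4 * (k * (2 * K * (105 * d + 810))) * B := by rw [hC]; ring
        omega
    _ = n ^ 2 := (sq n).symm

/-! The program. -/

/-- Store the memory bound in register `60`. -/
def sizeProg (d : ℕ) : Prog :=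
  .seq (.const 61 (2 * d + 10)) (.seq (.arith .add 60 0 0)
    (.seq (.arith .add 60 60 61) (.arith .mul 60 60 60)))

/-- The variables and arrays at the start. -/
def HS.start (n : ℕ) (inp : ℕ → ℕ) : HS :=
  ⟨n, 0, 0, 0, 0, 0, 0, 0, 0, 0, 0, 0, 0, 0, 0, 0, 0, 0, 0, 0, 0, 0, 0, 0, 0, 0, 0, 0, 0, 0, 0, 0, 0,
    0, 0, 0, 0, inp, 0, 0, 0, 0, 0, 0, 0, 0, 0, 0, 0, 0⟩

/-- With `L = Nat.log 2 n + 1` one has `n < 2 ^ L`, and the constant `C` is below `2 ^ C ≤ 2 ^ (C *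
L)`. So `20` arrays of size `memSize d n`, more than are used, are addressable with `(C + 2) * L`
bits. -/
theorem memSize_le_two_pow {d n w : ℕ}
    (hw : (20 * ((2 * d + 12) * (2 * d + 12)) + 2) * (Nat.log 2 n + 1) ≤ w) :
    20 * memSize d n ≤ 2 ^ w := by
  set C := 20 * ((2 * d + 12) * (2 * d + 12)) with hC
  set L := Nat.log 2 n + 1
  have h1 : n < 2 ^ L := Nat.lt_pow_succ_log_self (by omega) n
  have h2 : 2 * n + 2 * d + 10 ≤ (2 * d + 12) * 2 ^ L := by nlinarith
  calc 20 * memSize d n ≤ 20 * (((2 * d + 12) * 2 ^ L) * ((2 * d + 12) * 2 ^ L)) :=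
        Nat.mul_le_mul_left _ (Nat.mul_le_mul h2 h2)
    _ = C * 2 ^ (2 * L) := by rw [hC]; ring
    _ ≤ 2 ^ (C * L) * 2 ^ (2 * L) := by
        refine Nat.mul_le_mul_right _ (Nat.lt_two_pow_self.le.trans
          (Nat.pow_le_pow_right (by omega) ?_))
        exact Nat.le_mul_of_pos_right _ (Nat.succ_pos _)
    _ = 2 ^ ((C + 2) * L) := by rw [← pow_add, Nat.add_mul]
    _ ≤ 2 ^ w := Nat.pow_le_pow_right (by omega) hw

/-- No data have to be moved: the input occupies `2 * d * n ≤ memSize d n` cells from address `0`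
on, which is the array `inp`, and all other arrays lie beyond it and hold zeros. -/
theorem exec_sizeProg {d n w : ℕ} (hw : 20 * memSize d n ≤ 2 ^ w)
    (a b : Fin d → Equiv.Perm (Fin n)) :
    ∃ ρ, Exec w (sizeProg d) (input a b) ρ 4 ∧
      Repr (memSize d n) (HS.start n (input a b).mem) ρ := by
  have hq : 2 * n + 2 * d + 10 ≤ memSize d n := Nat.le_mul_self _
  have hmem : memSize d n = (2 * n + 2 * d + 10) * (2 * n + 2 * d + 10) := rfl
  refine ⟨_, .seq (.const _ _ _) (.seq (.arith _ _ _ _ _) (.seq (.arith _ _ _ _ _)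
    (.arith _ _ _ _ _))), fun x => ?_, ?_, fun A i hi => ?_⟩
  · have := x.reg_lt
    simp only [State.setReg]
    rw [Function.update_of_ne (by omega), Function.update_of_ne (by omega),
      Function.update_of_ne (by omega), Function.update_of_ne (by omega)]
    cases x <;> rfl
  · have h0 : (input a b).reg 0 = n := rfl
    simp only [State.setReg, Op.eval, Function.update_self,
      Function.update_of_ne (show 0 ≠ 61 by omega), Function.update_of_ne (show 61 ≠ 60 by omega), h0]
    rw [Nat.mod_eq_of_lt (show 2 * d + 10 < 2 ^ w by omega),
      Nat.mod_eq_of_lt (show n + n < 2 ^ w by omega),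
      Nat.mod_eq_of_lt (show n + n + (2 * d + 10) < 2 ^ w by omega), ← Nat.add_assoc, ← two_mul,
      ← hmem, Nat.mod_eq_of_lt (by omega)]
  · simp only [State.setReg]
    have hz : d * n + d * n ≤ memSize d n := by simp only [memSize]; nlinarith
    have hA : A ≠ .inp → (input a b).mem (A.num * memSize d n + i) = 0 := by
      intro hA
      have h1 : A.num ≠ 0 := fun h => hA (Arr.num_inj (h.trans rfl))
      have h2 : 1 * memSize d n ≤ A.num * memSize d n := Nat.mul_le_mul_right _ (by omega)
      simp only [input]
      rw [dif_neg (by omega), dif_neg (by omega)]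
    by_cases h : A = .inp
    · subst h
      change (input a b).mem (0 * memSize d n + i) = (input a b).mem i
      rw [Nat.zero_mul, Nat.zero_add]
    · rw [hA h]
      cases A <;> first | rfl | exact absurd rfl h

end

end SCP

theorem theorem1 (d : ℕ) (hd : 0 < d) :
    ∃ (P : SCP.Prog) (c : ℕ) (T : ℕ → ℕ),
      Asymptotics.IsLittleO Filter.atTop (fun n : ℕ => (T n : ℝ)) (fun n : ℕ => (n : ℝ) ^ 2) ∧
      ∀ (n w : ℕ), c * (Nat.log 2 n + 1) ≤ w →
        ∀ a b : Fin d → Equiv.Perm (Fin n), SCP.DecidesWithin w P (T n) a b := by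
  -- The summand `4` in the time bound is the cost of `sizeProg`; the factor `unit` converts ticks
  -- to machine steps.
  refine ⟨.seq (SCP.sizeProg d) (SCP.decider d).comp, 20 * ((2 * d + 12) * (2 * d + 12)) + 2,
    fun n => (SCP.decider d).unit * SCP.runTime d n (SCP.maxWeight d n) + 4,
    SCP.isLittleO_of_mul_le (SCP.mul_runTime_le hd _), fun n w hw a b => ?_⟩
  have hZ := SCP.memSize_le_two_pow hw
  have hG := SCP.pairAct_sys a b
  obtain ⟨ρ, hρ, hr⟩ := SCP.exec_sizeProg hZ a b
  obtain ⟨σ', ρ', t, ht, hr', ⟨hres, htm⟩, hcost⟩ := SCP.Cmd.exec_comp hZ (SCP.decider d) le_rfl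
    (SCP.wp_decider hd hG (SCP.weightLe_maxWeight hG) (SCP.pairAct_sided a b)
      (σ := SCP.HS.start n (SCP.input a b).mem) rfl rfl (fun _ _ => rfl) (fun _ _ => rfl)
      (SCP.inputOk_pairAct a b)) hr
  have h0 : ρ'.reg 0 = σ'.n := hr'.reg .n
  rw [SCP.balanced_iff_simConj] at hres
  refine ⟨ρ', _, .seq hρ ht, ?_, fun h => ?_, fun h => ?_⟩
  · have h1 := Nat.mul_le_mul_left (SCP.decider d).unit htm
    simp only
    omega
  · rcases hres with h1 | h1
    · rw [h0, h1.1]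
    · exact absurd h h1.2
  · rcases hres with h1 | h1
    · exact absurd h1.2 h
    · rw [h0, h1.1]
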